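/- **Theorem 3.1.** Let $M$ be an $n$-dimensional smooth manifold, $\alpha=\sqrt{a_{ij}(x)y^iy^j}$ a smooth Riemannian metric and $\beta=b_i(x)y^i$ a smooth nowhere vanishing $1$-form on $M$, and let $F=\alpha^2/\beta$ be the corresponding Kropina metric on the domain $\{\beta>0\}\subset TM$ (for $n\ge 2$ it is never Riemannian). *Notation.* For a Finsler metric $F$ put $g_{ij}=\frac12[F^2]_{y^iy^j}$, $G^i=\frac14 g^{il}\{[F^2]_{x^ky^l}y^k-[F^2]_{x^l}\}$, $$R^i{}_k=2\frac{\partial G^i}{\partial x^k}-\frac{\partial^2G^i}{\partial x^m\partial y^k}y^m+2G^m\frac{\partial^2G^i}{\partial y^m\partial y^k}-\frac{\partial G^i}{\partial y^m}\frac{\partial G^m}{\partial y^k},\qquad Ric=R^m{}_m .$$ $F$ is an *Einstein metric* with *Einstein scalar* $\sigma$ if $Ric=\sigma(x)F^2$ on its domain for a scalar function $\sigma$ on $M$. $\overline{Ric}$ is the Ricci curvature of $\alpha$, "$|$" is covariant differentiation with respect to the Levi-Civita connection of $\alpha$, indices are raised with $a^{ij}$, $b^2=b_ib^i$, and $$r_{ij}=\tfrac12(b_{i|j}+b_{j|i}),\quad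 s_{ij}=\tfrac12(b_{i|j}-b_{j|i}),\quad s^i{}_j=a^{ik}s_{kj},\quad s_j=b^is_{ij},\quad s^i=a^{ij}s_j .$$ An index $0$ means contraction with $y$: $r_{00}=r_{ij}y^iy^j$, $s_0=s_iy^i$, $s_{0|0}=s_{i|j}y^iy^j$, $s_{0|k}=s_{i|k}y^i$, $s^k{}_0=s^k{}_iy^i$, $s^k{}_{0|k}=s^k{}_{i|k}y^i$. For a function $c$ on $M$, $c_k=\partial c/\partial x^k$ and $c_0=c_ky^k$. The equations below are required at all $x\in M$ and all $y\in T_xM$. 1) For $n=2$, $F$ is an Einstein metric if and only if there exist scalar functions $c=c(x)$ (smooth) and $\lambda=\lambda(x)$ on $M$ such that $$\begin{cases} r_{00}=c\,\alpha^2,\\ \overline{Ric}=\lambda\alpha^2,\\ 0=\lambda b^2\beta-cs_0+b^kc_k\beta+b^ks_{0|k}-b^2s^k{}_{0|k}+s^k{}_0s_k.\end{cases}$$ 2) For $n\ge3$, $F$ is an Einstein metric if and only if there exist scalar functions $c=c(x)$ (smooth) and $f=f(x)$ on $M$ such that $$\begin{cases} r_{00}=c\,\alpha^2,\\ f\alpha^2=\overline{Ric}\,b^4+(n-2)\{b^2s_{0|0}+b^2c_0\beta-2c\beta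 s_0-s_0^2-c^2\beta^2\},\\ 0=\{(n-2)s_ks^k-b^2s^k{}_{|k}-b^2s^i{}_js^j{}_i\}\beta+(n-3)b^2cs_0+b^2b^ks_{0|k}-b^4s^k{}_{0|k}+(n-1)b^2s^k{}_0s_k,\end{cases}$$ where $$f=-(n-2)b^2c^2-b^2b^kc_k+(n-2)s^ks_k-b^2s^k{}_{|k}-b^2s^i{}_js^j{}_i .$$ In both cases (that is, whenever $n\ge2$ and $F$ is an Einstein metric), the Einstein scalar is $$\sigma=-\frac1{2b^2}s^ks_k-\frac14 s^i{}_js^j{}_i .$$ -/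

import Mathlib

open scoped Manifold ContDiff

noncomputable section

namespace Kropina

/-- The coordinate space `ℝⁿ`. -/
abbrev Coord (n : ℕ) : Type := EuclideanSpace ℝ (Fin n)

/-- Partial derivative `∂f/∂zᵏ` of a real function on the coordinate space. -/
def pd {n : ℕ} (k : Fin n) (f : Coord n → ℝ) (z : Coord n) : ℝ :=
  fderiv ℝ f z (EuclideanSpace.single k 1)

/-! Finsler geometry in local coordinates. A function on (an open part of) the tangent bundle is
written in standard coordinates `(x, y)`, where `y` are the components of the tangent vector. -/

/-- `∂H/∂xᵏ` at fixed `y`. -/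
def dx {n : ℕ} (k : Fin n) (H : Coord n → Coord n → ℝ) (x y : Coord n) : ℝ :=
  pd k (fun z => H z y) x

/-- `∂H/∂yᵏ` at fixed `x`. -/
def dy {n : ℕ} (k : Fin n) (H : Coord n → Coord n → ℝ) (x y : Coord n) : ℝ :=
  pd k (H x) y

/-- The fundamental tensor `g_ij = ½ [F²]_{yⁱ yʲ}`. -/
def fundTensor {n : ℕ} (F : Coord n → Coord n → ℝ) (x y : Coord n) : Matrix (Fin n) (Fin n) ℝ :=
  Matrix.of fun i j => (1 / 2) * dy j (dy i fun x y => F x y ^ 2) x y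

/-- Geodesic coefficients `Gⁱ = ¼ gⁱˡ ([F²]_{xᵏ yˡ} yᵏ - [F²]_{xˡ})`. -/
def geodesicCoeff {n : ℕ} (F : Coord n → Coord n → ℝ) (i : Fin n) (x y : Coord n) : ℝ :=
  (1 / 4) * ∑ l, (fundTensor F x y)⁻¹ i l *
    ((∑ k, dy l (dx k fun x y => F x y ^ 2) x y * y k) - dx l (fun x y => F x y ^ 2) x y)

/-- Riemann curvature
`Rⁱ_k = 2 ∂Gⁱ/∂xᵏ - yᵐ ∂²Gⁱ/∂xᵐ∂yᵏ + 2 Gᵐ ∂²Gⁱ/∂yᵐ∂yᵏ - (∂Gⁱ/∂yᵐ)(∂Gᵐ/∂yᵏ)`. -/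
def riemann {n : ℕ} (F : Coord n → Coord n → ℝ) (i k : Fin n) (x y : Coord n) : ℝ :=
  2 * dx k (geodesicCoeff F i) x y
    - ∑ m, dy k (dx m (geodesicCoeff F i)) x y * y m
    + 2 * ∑ m, geodesicCoeff F m x y * dy k (dy m (geodesicCoeff F i)) x y
    - ∑ m, dy m (geodesicCoeff F i) x y * dy k (geodesicCoeff F m) x y

/-- Ricci curvature `Ric = Rᵐ_m`. -/
def ricci {n : ℕ} (F : Coord n → Coord n → ℝ) (x y : Coord n) : ℝ :=
  ∑ m, riemann F m m x y

/-! Tensor calculus of a Riemannian metric and a one-form in local coordinates. -/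

/-- Components `a_ij(x)` of a Riemannian metric and `b_i(x)` of a one-form in a chart. -/
structure LocalPair (n : ℕ) where
  a : Coord n → Matrix (Fin n) (Fin n) ℝ
  b : Coord n → Fin n → ℝ

namespace LocalPair

variable {n : ℕ} (S : LocalPair n)

/-- The inverse matrix `aⁱʲ`. -/
def aInv (x : Coord n) : Matrix (Fin n) (Fin n) ℝ := (S.a x)⁻¹

/-- Christoffel symbols `Γᵏ_ij` of the Levi-Civita connection. -/
def christoffel (k i j : Fin n) (x : Coord n) : ℝ :=
  (1 / 2) * ∑ l, S.aInv x k l *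
    (pd i (fun z => S.a z j l) x + pd j (fun z => S.a z i l) x - pd l (fun z => S.a z i j) x)

/-- Covariant derivative `w_{i|j}` of a covector field. -/
def covCovector (w : Coord n → Fin n → ℝ) (i j : Fin n) (x : Coord n) : ℝ :=
  pd j (fun z => w z i) x - ∑ k, S.christoffel k i j x * w x k

/-- Covariant derivative `uⁱ_{|j}` of a vector field. -/
def covVector (u : Coord n → Fin n → ℝ) (i j : Fin n) (x : Coord n) : ℝ :=
  pd j (fun z => u z i) x + ∑ k, S.christoffel i j k x * u x k

/-- Covariant derivative `Tⁱ_{j|k}` of a field of endomorphisms. -/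
def covEndo (T : Coord n → Fin n → Fin n → ℝ) (i j k : Fin n) (x : Coord n) : ℝ :=
  pd k (fun z => T z i j) x + (∑ m, S.christoffel i k m x * T x m j)
    - ∑ m, S.christoffel m k j x * T x i m

/-- `r_ij = ½ (b_{i|j} + b_{j|i})`. -/
def r (x : Coord n) (i j : Fin n) : ℝ :=
  (1 / 2) * (S.covCovector S.b i j x + S.covCovector S.b j i x)

/-- `s_ij = ½ (b_{i|j} - b_{j|i})`. -/
def s (x : Coord n) (i j : Fin n) : ℝ :=
  (1 / 2) * (S.covCovector S.b i j x - S.covCovector S.b j i x)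

/-- `bⁱ = aⁱʲ b_j`. -/
def bUp (x : Coord n) (i : Fin n) : ℝ := ∑ j, S.aInv x i j * S.b x j

/-- `b² = b_i bⁱ`, the squared length of the one-form. -/
def bSq (x : Coord n) : ℝ := ∑ i, S.b x i * S.bUp x i

/-- `sⁱ_j = aⁱᵏ s_kj`. -/
def sMix (x : Coord n) (i j : Fin n) : ℝ := ∑ k, S.aInv x i k * S.s x k j

/-- `s_j = bⁱ s_ij`. -/
def s1 (x : Coord n) (j : Fin n) : ℝ := ∑ i, S.bUp x i * S.s x i j

/-- `sⁱ = aⁱʲ s_j`. -/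
def s1Up (x : Coord n) (i : Fin n) : ℝ := ∑ j, S.aInv x i j * S.s1 x j

/-- `r_00 = r_ij yⁱ yʲ`. -/
def r00 (x y : Coord n) : ℝ := ∑ i, ∑ j, S.r x i j * y i * y j

/-- `s_0 = s_i yⁱ`. -/
def s0 (x y : Coord n) : ℝ := ∑ i, S.s1 x i * y i

/-- `s_{0|0} = s_{i|j} yⁱ yʲ`. -/
def s0_0 (x y : Coord n) : ℝ := ∑ i, ∑ j, S.covCovector S.s1 i j x * y i * y j

/-- `bᵏ s_{0|k} = bᵏ s_{i|k} yⁱ`. -/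
def b_s0 (x y : Coord n) : ℝ := ∑ k, ∑ i, S.bUp x k * S.covCovector S.s1 i k x * y i

/-- `sᵏ_{0|k} = sᵏ_{i|k} yⁱ`. -/
def divS0 (x y : Coord n) : ℝ := ∑ k, ∑ i, S.covEndo S.sMix k i k x * y i

/-- `sᵏ_0 s_k = sᵏ_i yⁱ s_k`. -/
def s0s (x y : Coord n) : ℝ := ∑ k, ∑ i, S.sMix x k i * y i * S.s1 x k

/-- `sᵏ s_k`. -/
def sSq (x : Coord n) : ℝ := ∑ k, S.s1Up x k * S.s1 x k

/-- `sᵏ_{|k}`. -/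
def divs (x : Coord n) : ℝ := ∑ k, S.covVector S.s1Up k k x

/-- `sⁱ_j sʲ_i`. -/
def trS (x : Coord n) : ℝ := ∑ i, ∑ j, S.sMix x i j * S.sMix x j i

/-- `bᵏ c_k`, where `c_k = ∂c/∂xᵏ`. -/
def b_dc (c : Coord n → ℝ) (x : Coord n) : ℝ := ∑ k, S.bUp x k * pd k c x

end LocalPair

/-- `c_0 = c_k yᵏ`, where `c_k = ∂c/∂xᵏ`. -/
def dc0 {n : ℕ} (c : Coord n → ℝ) (x y : Coord n) : ℝ := ∑ k, pd k c x * y k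

/-! Passage from a manifold to coordinates. All the curvature quantities and covariant derivatives
are tensorial, so their values on tangent vectors at `p` may be computed in any chart around `p`;
the chart attached to `p` by the manifold structure is used. -/

section Manifold

variable {n : ℕ} {M : Type*} [TopologicalSpace M] [ChartedSpace (Coord n) M]

/-- The coordinates of `p` in the chart at `p`. -/
def pt (p : M) : Coord n := extChartAt (𝓡 n) p p

/-- The components `yⁱ` of the tangent vector `v` at `p` in the chart at `p`. -/
def coord (p : M) (v : TangentSpace (𝓡 n) p) : Coord n :=
  mfderiv (𝓡 n) 𝓘(ℝ, Coord n) (extChartAt (𝓡 n) p) p v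

/-- The tangent vector `yⁱ ∂/∂xⁱ` at the point with coordinates `z` in the chart at `p`. -/
def vec (p : M) (z y : Coord n) : TangentSpace (𝓡 n) ((extChartAt (𝓡 n) p).symm z) :=
  mfderiv 𝓘(ℝ, Coord n) (𝓡 n) (extChartAt (𝓡 n) p).symm z y

/-- A scalar function in the coordinates of the chart at `p`. -/
def inChart (c : M → ℝ) (p : M) (z : Coord n) : ℝ := c ((extChartAt (𝓡 n) p).symm z)

/-- A function on the tangent bundle in the standard coordinates induced by the chart at `p`. -/
def tangentInChart (F : (q : M) → TangentSpace (𝓡 n) q → ℝ) (p : M) (z y : Coord n) : ℝ :=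
  F ((extChartAt (𝓡 n) p).symm z) (vec p z y)

/-- The Ricci curvature of a Finsler metric `F` at the tangent vector `v` at `p`. -/
def Ric (F : (q : M) → TangentSpace (𝓡 n) q → ℝ) (p : M) (v : TangentSpace (𝓡 n) p) : ℝ :=
  ricci (tangentInChart F p) (pt p) (coord p v)

/-- `F`, defined on the conic domain `C` of the tangent bundle, is an Einstein metric with Einstein
scalar `σ`: `Ric = σ F²` on `C`. -/
def IsEinsteinWith (F : (q : M) → TangentSpace (𝓡 n) q → ℝ)
    (C : (q : M) → Set (TangentSpace (𝓡 n) q)) (σ : M → ℝ) : Prop :=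
  ∀ p, ∀ v ∈ C p, Ric F p v = σ p * F p v ^ 2

/-- `F` is an Einstein metric on the conic domain `C`. -/
def IsEinstein (F : (q : M) → TangentSpace (𝓡 n) q → ℝ)
    (C : (q : M) → Set (TangentSpace (𝓡 n) q)) : Prop :=
  ∃ σ : M → ℝ, IsEinsteinWith F C σ

end Manifold

/-- The data of a Kropina metric on an `n`-dimensional smooth manifold: a smooth Riemannian metric
and a smooth, nowhere vanishing one-form `β`. -/
structure KropinaData (n : ℕ) (M : Type*) [TopologicalSpace M] [ChartedSpace (Coord n) M]
    [IsManifold (𝓡 n) ∞ M] where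
  metric : Bundle.ContMDiffRiemannianMetric (𝓡 n) ∞ (Coord n)
    (fun p : M => TangentSpace (𝓡 n) p)
  β : (p : M) → TangentSpace (𝓡 n) p →L[ℝ] ℝ
  smooth_β : ContMDiff (𝓡 n) ((𝓡 n).prod 𝓘(ℝ, Coord n →L[ℝ] ℝ)) ∞
    (fun p : M => Bundle.TotalSpace.mk' (Coord n →L[ℝ] ℝ)
      (E := fun p : M => TangentSpace (𝓡 n) p →L[ℝ] ℝ) p (β p))
  β_ne_zero : ∀ p, β p ≠ 0

namespace KropinaData

variable {n : ℕ} {M : Type*} [TopologicalSpace M] [ChartedSpace (Coord n) M]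
  [IsManifold (𝓡 n) ∞ M] (K : KropinaData n M)

/-- The Riemannian norm `α(v) = √(a_ij vⁱ vʲ)`. -/
def α (p : M) (v : TangentSpace (𝓡 n) p) : ℝ := √(K.metric.inner p v v)

/-- The Kropina metric `F = α² / β`. -/
def F (p : M) (v : TangentSpace (𝓡 n) p) : ℝ := K.α p v ^ 2 / K.β p v

/-- The domain `β > 0` of the Kropina metric. -/
def domain (p : M) : Set (TangentSpace (𝓡 n) p) := {v | 0 < K.β p v}

/-- The components of the metric and of `β` in the chart at `p`. -/
def loc (p : M) : LocalPair n where
  a z := Matrix.of fun i j => K.metric.inner ((extChartAt (𝓡 n) p).symm z)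
    (vec p z (EuclideanSpace.single i 1)) (vec p z (EuclideanSpace.single j 1))
  b z i := K.β ((extChartAt (𝓡 n) p).symm z) (vec p z (EuclideanSpace.single i 1))

/-! The tensors built from `α` and `β`, evaluated at a point `p` and a tangent vector `v`,
whose components are the `yⁱ`. -/

/-- `r_00` -/
def r00 (p : M) (v : TangentSpace (𝓡 n) p) : ℝ := (K.loc p).r00 (pt p) (coord p v)

/-- `s_0` -/
def s0 (p : M) (v : TangentSpace (𝓡 n) p) : ℝ := (K.loc p).s0 (pt p) (coord p v)

/-- `s_{0|0}` -/
def s0_0 (p : M) (v : TangentSpace (𝓡 n) p) : ℝ := (K.loc p).s0_0 (pt p) (coord p v)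

/-- `bᵏ s_{0|k}` -/
def b_s0 (p : M) (v : TangentSpace (𝓡 n) p) : ℝ := (K.loc p).b_s0 (pt p) (coord p v)

/-- `sᵏ_{0|k}` -/
def divS0 (p : M) (v : TangentSpace (𝓡 n) p) : ℝ := (K.loc p).divS0 (pt p) (coord p v)

/-- `sᵏ_0 s_k` -/
def s0s (p : M) (v : TangentSpace (𝓡 n) p) : ℝ := (K.loc p).s0s (pt p) (coord p v)

/-- `b²` -/
def bSq (p : M) : ℝ := (K.loc p).bSq (pt p)

/-- `sᵏ s_k` -/
def sSq (p : M) : ℝ := (K.loc p).sSq (pt p)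

/-- `sᵏ_{|k}` -/
def divs (p : M) : ℝ := (K.loc p).divs (pt p)

/-- `sⁱ_j sʲ_i` -/
def trS (p : M) : ℝ := (K.loc p).trS (pt p)

/-- `bᵏ c_k` for a function `c` on the manifold. -/
def b_dc (c : M → ℝ) (p : M) : ℝ := (K.loc p).b_dc (inChart c p) (pt p)

/-- `c_0` for a function `c` on the manifold. -/
def c0 (_K : KropinaData n M) (c : M → ℝ) (p : M) (v : TangentSpace (𝓡 n) p) : ℝ :=
  dc0 (inChart c p) (pt p) (coord p v)

end KropinaData

end Kropina

end

/-! Write F = α²/β and b^♯ for the vector bⁱ. The spray of F is the spray of α plus T = Q + P y,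
where Q = -(F/2) sⁱ₀ + u bⁱ, u = (F s₀ + r₀₀)/(2b²) and P = -(s₀ + r₀₀ β/α²)/b². `geodesic_equation`
checks this, and `isUnit_det_kropina` shows that g_ij is invertible, so that the equation determines
the spray. Adding T to the spray changes the Ricci curvature by a universal formula (`ric_add`), and
the part P y contributes only (n-1)(P² - ∇₀P + 2 Q(P)) (`ric_add_projective`).

Why r₀₀ = c α² is forced: the only denominator α² sits in P, and `exists_ric_G_polar` finds F² Ric =
3(n-1)(r₀₀/b²)² + F q with q polynomial in y and 1/β. Suppose Ric = σF² and restrict to a line b^♯ +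
t w with β(w) = 0. There β is constant, α² = B + W t² with B, W > 0, and this polynomial divides
r₀₀². Being irreducible over ℝ, it divides r₀₀. Hence r₀₀ is proportional to α², for every n ≥ 2
(`exists_conformal`).

Once r₀₀ = c α², the denominator disappears and `ric_G_conformal` gives b⁴(Ric - σ₀F²) = C + α² g +
(α²/β) B, with σ₀ the asserted Einstein scalar, C quadratic in y, g independent of y and B linear in
y. If Ric = σF², then `separation` yields σ = σ₀, C = f α² and (f + g)β + B = 0; conversely these
equations make the right side vanish. Evaluating the last one at b^♯ computes f (`scalar_eq`). For n
= 2, C is b⁴ times the Ricci curvature of α, so that λ = f/b⁴.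

The computations take place in a commutative ℝ-algebra with derivations ∂/∂xᵏ and ∂/∂yᵏ
(`TangentRing`), where they become polynomial identities modulo relations such as β · (1/β) = 1.
Smooth functions on an open set of the coordinate tangent bundle form such an algebra, and
evaluation at points brings the identities back to coordinates.

On the manifold every tensor at p is computed in the chart at p. The derivative of c, however, needs
r_ij = c a_ij on the whole chart domain, while c is found point by point. This requires one
invariance statement, that of r₀₀ under changes of coordinates (`r00_pullback`). -/

noncomputable section

namespace Kropina

/-! ### The algebra of smooth functions on an open set -/

section SmoothAlgebra

variable {X : Type*} [NormedAddCommGroup X] [NormedSpace ℝ X]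

open Classical in
/-- Extension by zero of a function on `Ω`. -/
def extendZero {Ω : Set X} (f : Ω → ℝ) (x : X) : ℝ := if h : x ∈ Ω then f ⟨x, h⟩ else 0

omit [NormedAddCommGroup X] [NormedSpace ℝ X] in
lemma extendZero_apply {Ω : Set X} (f : Ω → ℝ) (w : Ω) : extendZero f w = f w := by
  simp [extendZero]

omit [NormedSpace ℝ X] in
-- On the open set Ω derivatives depend only on values in Ω, so the default value 0 outside plays no
-- role.
lemma extendZero_eventuallyEq {Ω : Set X} (hΩ : IsOpen Ω) (f : Ω → ℝ) (g : X → ℝ)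
    (h : ∀ w : Ω, g w = f w) (w : Ω) : extendZero f =ᶠ[nhds (w : X)] g := by
  filter_upwards [hΩ.mem_nhds w.2] with z hz
  rw [show z = ((⟨z, hz⟩ : Ω) : X) from rfl, extendZero_apply, h]

/-- The algebra of smooth real functions on the open set `Ω`. -/
def smoothAlg (Ω : Set X) : Subalgebra ℝ (Ω → ℝ) where
  carrier := {f | ContDiffOn ℝ ∞ (extendZero f) Ω}
  mul_mem' := by
    intro f g hf hg
    refine (hf.mul hg).congr fun x hx => ?_
    simp [extendZero, hx]
  add_mem' := by
    intro f g hf hg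
    refine (hf.add hg).congr fun x hx => ?_
    simp [extendZero, hx]
  algebraMap_mem' := by
    intro c
    refine (contDiffOn_const (c := c)).congr fun x hx => ?_
    simp [extendZero, hx]

variable {Ω : Set X}

/-- The restriction to `Ω` of a function that is smooth on `Ω`. -/
def smoothMk (f : X → ℝ) (hf : ContDiffOn ℝ ∞ f Ω) : smoothAlg Ω :=
  ⟨fun w => f w, hf.congr fun x hx => by simp [extendZero, hx]⟩

@[simp] lemma smoothMk_apply (f : X → ℝ) (hf : ContDiffOn ℝ ∞ f Ω) (w : Ω) :
    (smoothMk f hf).1 w = f w := rfl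

/-- Evaluation at a point of `Ω`. -/
def evalAt (w : Ω) : smoothAlg Ω →+* ℝ where
  toFun f := f.1 w
  map_one' := rfl
  map_mul' _ _ := rfl
  map_zero' := rfl
  map_add' _ _ := rfl

lemma evalAt_apply (w : Ω) (f : smoothAlg Ω) : evalAt w f = f.1 w := rfl

@[simp] lemma evalAt_smoothMk (f : X → ℝ) (hf : ContDiffOn ℝ ∞ f Ω) (w : Ω) :
    evalAt w (smoothMk f hf) = f w := rfl

@[simp] lemma evalAt_algebraMap (c : ℝ) (w : Ω) :
    evalAt w (algebraMap ℝ (smoothAlg Ω) c) = c := rfl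

lemma smoothAlg_ext {f g : smoothAlg Ω} (h : ∀ w, evalAt w f = evalAt w g) : f = g :=
  Subtype.ext (funext h)

/-- A smooth function that vanishes nowhere is invertible. -/
lemma smoothAlg_exists_inv (f : smoothAlg Ω) (h : ∀ w, evalAt w f ≠ 0) :
    ∃ g : smoothAlg Ω, f * g = 1 := by
  have hf : ContDiffOn ℝ ∞ (extendZero f.1) Ω := f.2
  refine ⟨smoothMk (fun x => (extendZero f.1 x)⁻¹) (hf.inv fun x hx => ?_), ?_⟩
  · rw [show x = ((⟨x, hx⟩ : Ω) : X) from rfl, extendZero_apply]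
    exact h ⟨x, hx⟩
  · refine smoothAlg_ext fun w => ?_
    rw [map_mul, evalAt_smoothMk, extendZero_apply, map_one]
    exact mul_inv_cancel₀ (h w)

lemma smoothAlg_contDiffAt (hΩ : IsOpen Ω) (f : smoothAlg Ω) (w : Ω) :
    ContDiffAt ℝ ∞ (extendZero f.1) (w : X) :=
  ContDiffOn.contDiffAt f.2 (hΩ.mem_nhds w.2)

lemma smoothAlg_differentiableAt (hΩ : IsOpen Ω) (f : smoothAlg Ω) (w : Ω) :
    DifferentiableAt ℝ (extendZero f.1) (w : X) :=
  (smoothAlg_contDiffAt hΩ f w).differentiableAt (by simp)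

/-- The directional derivative along a constant vector. -/
def dirDeriv (hΩ : IsOpen Ω) (e : X) : Derivation ℝ (smoothAlg Ω) (smoothAlg Ω) :=
  Derivation.mk'
    { toFun := fun f => smoothMk (fun x => fderiv ℝ (extendZero f.1) x e)
        ((ContDiffOn.fderiv_of_isOpen (n := ∞) f.2 hΩ (by simp)).clm_apply contDiffOn_const)
      map_add' := by
        intro f g
        refine smoothAlg_ext fun w => ?_
        have h : extendZero (f + g).1 =ᶠ[nhds (w : X)] extendZero f.1 + extendZero g.1 :=
          extendZero_eventuallyEq hΩ _ _ (fun w => by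
            simp [extendZero_apply]) w
        simp only [map_add, evalAt_smoothMk]
        rw [h.fderiv_eq, fderiv_add (smoothAlg_differentiableAt hΩ f w)
          (smoothAlg_differentiableAt hΩ g w)]
        rfl
      map_smul' := by
        intro c f
        refine smoothAlg_ext fun w => ?_
        have h : extendZero (c • f).1 =ᶠ[nhds (w : X)] c • extendZero f.1 :=
          extendZero_eventuallyEq hΩ _ _ (fun w => by
            simp [extendZero_apply]) w
        simp only [evalAt_smoothMk, RingHom.id_apply]
        rw [h.fderiv_eq, fderiv_const_smul (smoothAlg_differentiableAt hΩ f w)]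
        rfl }
    (by
      intro f g
      refine smoothAlg_ext fun w => ?_
      have h : extendZero (f * g).1 =ᶠ[nhds (w : X)] extendZero f.1 * extendZero g.1 :=
        extendZero_eventuallyEq hΩ _ _ (fun w => by
          simp [extendZero_apply]) w
      simp only [LinearMap.coe_mk, AddHom.coe_mk, smul_eq_mul, map_add, map_mul, evalAt_smoothMk]
      rw [h.fderiv_eq, fderiv_mul (smoothAlg_differentiableAt hΩ f w)
        (smoothAlg_differentiableAt hΩ g w)]
      simp [extendZero_apply, evalAt_apply])

lemma evalAt_dirDeriv (hΩ : IsOpen Ω) (e : X) (f : smoothAlg Ω) (g : X → ℝ)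
    (h : ∀ w : Ω, g w = evalAt w f) (w : Ω) :
    evalAt w (dirDeriv hΩ e f) = fderiv ℝ g w e := by
  change fderiv ℝ (extendZero f.1) w e = _
  rw [(extendZero_eventuallyEq hΩ f.1 g h w).fderiv_eq]

lemma smoothAlg_differentiableAt_of_rep (hΩ : IsOpen Ω) (f : smoothAlg Ω) (g : X → ℝ)
    (h : ∀ w : Ω, g w = evalAt w f) (w : Ω) : DifferentiableAt ℝ g w :=
  (extendZero_eventuallyEq hΩ f.1 g h w).differentiableAt_iff.1
    (smoothAlg_differentiableAt hΩ f w)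

/-- Schwarz's theorem; it supplies the commutation axioms of a `TangentRing`. -/
lemma dirDeriv_comm (hΩ : IsOpen Ω) (e e' : X) (f : smoothAlg Ω) :
    dirDeriv hΩ e (dirDeriv hΩ e' f) = dirDeriv hΩ e' (dirDeriv hΩ e f) := by
  refine smoothAlg_ext fun w => ?_
  have key : ∀ e e' : X, evalAt w (dirDeriv hΩ e (dirDeriv hΩ e' f)) =
      fderiv ℝ (fderiv ℝ (extendZero f.1)) w e e' := by
    intro e e'
    rw [evalAt_dirDeriv hΩ e _ (fun x => fderiv ℝ (extendZero f.1) x e') (fun _ => rfl)]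
    have hd : DifferentiableAt ℝ (fderiv ℝ (extendZero f.1)) (w : X) :=
      ((smoothAlg_contDiffAt hΩ f w).fderiv_right (m := 1) (WithTop.coe_le_coe.2 (le_top : (1 + 1 : ℕ∞) ≤ ⊤))).differentiableAt
        (by simp)
    rw [fderiv_clm_apply hd (differentiableAt_const _)]
    simp
  rw [key, key]
  exact ((smoothAlg_contDiffAt hΩ f w).isSymmSndFDerivAt (by
    rw [minSmoothness_of_isRCLikeNormedField]
    exact WithTop.coe_le_coe.2 (le_top : (2 : ℕ∞) ≤ ⊤))).eq e e'

end SmoothAlgebra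

end Kropina

end

noncomputable section

namespace Kropina

/-! ### Sprays in a ring with position and velocity derivations -/

/-- An algebra with commuting derivations `D k = ∂/∂xᵏ`, `V k = ∂/∂yᵏ` and fibre coordinates `y k`,
modelled on the functions on an open part of a tangent bundle. -/
structure TangentRing (n : ℕ) (A : Type*) [CommRing A] [Algebra ℝ A] where
  D : Fin n → Derivation ℝ A A
  V : Fin n → Derivation ℝ A A
  y : Fin n → A
  V_V : ∀ i j f, V i (V j f) = V j (V i f)
  V_D : ∀ i j f, V i (D j f) = D j (V i f)
  V_y : ∀ i j, V i (y j) = if i = j then 1 else 0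
  D_y : ∀ i j, D i (y j) = 0

namespace TangentRing

variable {n : ℕ} {A : Type*} [CommRing A] [Algebra ℝ A] (R : TangentRing n A)

lemma sum_smul_derivation_apply {ι : Type*} (I : Finset ι) (u : ι → A) (d : ι → Derivation ℝ A A)
    (f : A) : (∑ i ∈ I, u i • d i) f = ∑ i ∈ I, u i * d i f := by
  classical
  induction I using Finset.induction_on with
  | empty => simp
  | insert i I hi ih => simp [Finset.sum_insert hi, ih]

/-- The Ricci curvature of the spray with coefficients `G`. -/
def ric (G : Fin n → A) : A :=
  ∑ m, (2 * R.D m (G m) - ∑ j, R.V m (R.D j (G m)) * R.y j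
    + 2 * ∑ j, G j * R.V m (R.V j (G m)) - ∑ j, R.V j (G m) * R.V m (G j))

/-- The vertical divergence `∂Gᵐ/∂yᵐ`. -/
def vtrace (G : Fin n → A) : A := ∑ m, R.V m (G m)

/-- The vertical derivative along `T`. -/
def along (T : Fin n → A) : Derivation ℝ A A := ∑ j, T j • R.V j

lemma along_apply (T : Fin n → A) (f : A) : R.along T f = ∑ j, T j * R.V j f := by
  rw [along, sum_smul_derivation_apply]

lemma along_add (T U : Fin n → A) (f : A) :
    R.along (T + U) f = R.along T f + R.along U f := by
  simp [along_apply, add_mul, Finset.sum_add_distrib]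

lemma along_smul (u : A) (T : Fin n → A) (f : A) : R.along (u • T) f = u * R.along T f := by
  simp [along_apply, Finset.mul_sum, mul_assoc]

lemma along_zero (f : A) : R.along 0 f = 0 := by
  simp [along_apply]

/-- `∂Qᵐ/∂yʲ ∂Tʲ/∂yᵐ`. -/
def vpair (Q T : Fin n → A) : A := ∑ j, ∑ m, R.V j (Q m) * R.V m (T j)

lemma vpair_comm (Q T : Fin n → A) : R.vpair Q T = R.vpair T Q := by
  unfold vpair
  rw [Finset.sum_comm]
  exact Finset.sum_congr rfl fun _ _ => Finset.sum_congr rfl fun _ _ => mul_comm _ _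

lemma vpair_add_left (Q Q' T : Fin n → A) :
    R.vpair (Q + Q') T = R.vpair Q T + R.vpair Q' T := by
  simp [vpair, add_mul, Finset.sum_add_distrib]

lemma vpair_add_right (Q T T' : Fin n → A) :
    R.vpair Q (T + T') = R.vpair Q T + R.vpair Q T' := by
  simp [vpair, mul_add, Finset.sum_add_distrib]

lemma vtrace_add (Q T : Fin n → A) : R.vtrace (Q + T) = R.vtrace Q + R.vtrace T := by
  simp [vtrace, Finset.sum_add_distrib]

lemma vtrace_smul (u : A) (T : Fin n → A) :
    R.vtrace (u • T) = R.along T u + u * R.vtrace T := by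
  simp [vtrace, along_apply, Finset.mul_sum, Finset.sum_add_distrib, add_comm]

/-- The vertical derivative along `T` of a vector field. -/
def alongVec (T X : Fin n → A) : Fin n → A := fun m => R.along T (X m)

lemma vpair_smul_smul (u w : A) (X Y : Fin n → A) :
    R.vpair (u • X) (w • Y) = R.along Y u * R.along X w + w * R.along (R.alongVec X Y) u
      + u * R.along (R.alongVec Y X) w + u * w * R.vpair X Y := by
  have h1 : R.along Y u * R.along X w = ∑ j, ∑ m, (Y j * R.V j u) * (X m * R.V m w) := by
    rw [along_apply, along_apply, Finset.sum_mul_sum]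
  have h2 : w * R.along (R.alongVec X Y) u
      = ∑ j, ∑ m, w * ((X m * R.V m (Y j)) * R.V j u) := by
    simp only [along_apply, alongVec, Finset.mul_sum, Finset.sum_mul]
  have h3 : u * R.along (R.alongVec Y X) w
      = ∑ j, ∑ m, u * ((Y j * R.V j (X m)) * R.V m w) := by
    simp only [along_apply, alongVec, Finset.mul_sum, Finset.sum_mul]
    rw [Finset.sum_comm]
  rw [h1, h2, h3, vpair, vpair, Finset.mul_sum]
  simp only [Finset.mul_sum, ← Finset.sum_add_distrib]
  refine Finset.sum_congr rfl fun j _ => Finset.sum_congr rfl fun m _ => ?_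
  simp only [Pi.smul_apply, smul_eq_mul, Derivation.leibniz]
  ring

/-- Since V commutes with D and with itself, the second-order terms are derivatives of the single
function `vtrace G`. What remains is the divergence in x and the pairing `vpair G G`. -/
lemma ric_eq (G : Fin n → A) :
    R.ric G = 2 * ∑ m, R.D m (G m) - ∑ j, R.y j * R.D j (R.vtrace G)
      + 2 * R.along G (R.vtrace G) - R.vpair G G := by
  have h1 : ∑ j, R.y j * R.D j (R.vtrace G) = ∑ m, ∑ j, R.V m (R.D j (G m)) * R.y j := by
    rw [Finset.sum_comm]
    simp only [vtrace, map_sum, Finset.mul_sum, V_D]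
    exact Finset.sum_congr rfl fun _ _ => Finset.sum_congr rfl fun _ _ => mul_comm _ _
  have h2 : R.along G (R.vtrace G) = ∑ m, ∑ j, G j * R.V m (R.V j (G m)) := by
    rw [Finset.sum_comm, along_apply]
    simp only [vtrace, map_sum, Finset.mul_sum]
    exact Finset.sum_congr rfl fun j _ => Finset.sum_congr rfl fun m _ => by rw [R.V_V j m]
  have h3 : R.vpair G G = ∑ m, ∑ j, R.V j (G m) * R.V m (G j) := by
    rw [vpair, Finset.sum_comm]
  rw [h1, h2, h3, ric]
  simp only [Finset.sum_add_distrib, Finset.sum_sub_distrib, Finset.mul_sum]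

/-- The element `1/2`. -/
def half (A : Type*) [CommRing A] [Algebra ℝ A] : A := algebraMap ℝ A (1 / 2)

lemma two_half : (2 : A) * half A = 1 := by
  rw [half, ← map_ofNat (algebraMap ℝ A) 2, ← map_mul]
  norm_num

@[simp] lemma der_half (d : Derivation ℝ A A) : d (half A) = 0 := d.map_algebraMap _

/-- The algebra need not be a domain; 2 cancels because it has an inverse. -/
lemma half_cancel {u v : A} (h : 2 * u = 2 * v) : u = v := by
  linear_combination half A * h + (v - u) * two_half (A := A)

lemma along_y (T : Fin n → A) (m : Fin n) : R.along T (R.y m) = T m := by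
  simp [along_apply, V_y]

variable (Γ : Fin n → Fin n → Fin n → A)

/-- The nonlinear connection `Γʲₖᵢ yⁱ`. -/
def conn (j k : Fin n) : A := ∑ i, Γ j k i * R.y i

/-- The quadratic spray `½ Γᵐⱼₖ yʲ yᵏ`. -/
def qspray (m : Fin n) : A := half A * ∑ j, ∑ k, Γ m j k * R.y j * R.y k

/-- The horizontal derivation. -/
def hor (k : Fin n) : Derivation ℝ A A := R.D k - R.along fun j => R.conn Γ j k

/-- The horizontal derivative along `T`. -/
def horAlong (T : Fin n → A) : Derivation ℝ A A := ∑ k, T k • R.hor Γ k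

lemma hor_apply (k : Fin n) (f : A) :
    R.hor Γ k f = R.D k f - ∑ j, R.conn Γ j k * R.V j f := by
  rw [hor, Derivation.sub_apply, along_apply]

lemma horAlong_apply (T : Fin n → A) (f : A) :
    R.horAlong Γ T f = ∑ k, T k * R.hor Γ k f := by
  rw [horAlong, sum_smul_derivation_apply]

/-- The horizontal divergence of a vector field. -/
def hdiv (T : Fin n → A) : A := ∑ m, (R.hor Γ m (T m) + ∑ j, Γ m j m * T j)

lemma hdiv_add (T U : Fin n → A) : R.hdiv Γ (T + U) = R.hdiv Γ T + R.hdiv Γ U := by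
  simp only [hdiv, Pi.add_apply, map_add, mul_add, Finset.sum_add_distrib]
  ring

lemma hdiv_smul (u : A) (T : Fin n → A) :
    R.hdiv Γ (u • T) = R.horAlong Γ T u + u * R.hdiv Γ T := by
  simp only [hdiv, horAlong_apply, Pi.smul_apply, smul_eq_mul, Derivation.leibniz,
    Finset.mul_sum, Finset.sum_add_distrib, mul_add]
  have : ∀ m j : Fin n, Γ m j m * (u * T j) = u * (Γ m j m * T j) := fun _ _ => by ring
  simp only [this]
  ring

variable {Γ} (hsymm : ∀ k i j, Γ k i j = Γ k j i) (hV : ∀ l k i j, R.V l (Γ k i j) = 0)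

include hV in
lemma V_conn (m j k : Fin n) : R.V m (R.conn Γ j k) = Γ j k m := by
  simp only [conn, map_sum, Derivation.leibniz, hV, V_y, smul_eq_mul, mul_zero, add_zero]
  simp

lemma two_qspray (m : Fin n) : 2 * R.qspray Γ m = ∑ k, R.conn Γ m k * R.y k := by
  rw [qspray, ← mul_assoc, two_half, one_mul, Finset.sum_congr rfl]
  intro j _
  rw [conn, Finset.sum_mul]
  exact Finset.sum_congr rfl fun _ _ => by ring

include hsymm hV in
lemma V_qspray (j m : Fin n) : R.V j (R.qspray Γ m) = R.conn Γ m j := by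
  apply half_cancel
  rw [show (2 : A) * R.V j (R.qspray Γ m) = R.V j (2 * R.qspray Γ m) by
    rw [two_mul, two_mul, map_add], two_qspray]
  simp only [map_sum, Derivation.leibniz, R.V_conn hV, smul_eq_mul, V_y, Finset.sum_add_distrib]
  rw [two_mul]
  congr 1
  · simp
  · exact Finset.sum_congr rfl fun k _ => by rw [hsymm, mul_comm]

include hsymm hV in
lemma V_vtrace_qspray (j : Fin n) : R.V j (R.vtrace (R.qspray Γ)) = ∑ m, Γ m j m := by
  simp only [vtrace, R.V_qspray hsymm hV, map_sum, R.V_conn hV]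
  exact Finset.sum_congr rfl fun m _ => hsymm _ _ _

lemma horAlong_y (f : A) :
    R.horAlong Γ R.y f = ∑ j, R.y j * R.D j f - 2 * R.along (R.qspray Γ) f := by
  have h : 2 * R.along (R.qspray Γ) f = ∑ k, ∑ j, R.y k * (R.conn Γ j k * R.V j f) := by
    rw [along_apply, Finset.mul_sum, Finset.sum_comm]
    refine Finset.sum_congr rfl fun j _ => ?_
    rw [← mul_assoc, two_qspray, Finset.sum_mul]
    exact Finset.sum_congr rfl fun _ _ => by ring
  rw [h, horAlong_apply]
  simp only [hor_apply, mul_sub, Finset.sum_sub_distrib, Finset.mul_sum]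

include hsymm hV in
/-- Change of the Ricci curvature when a tensor `T` is added to an affine spray. -/
lemma ric_add (T : Fin n → A) :
    R.ric (R.qspray Γ + T) = R.ric (R.qspray Γ) + 2 * R.hdiv Γ T
      - R.horAlong Γ R.y (R.vtrace T) + 2 * R.along T (R.vtrace T) - R.vpair T T := by
  have h1 : R.along T (R.vtrace (R.qspray Γ)) = ∑ m, ∑ j, Γ m j m * T j := by
    rw [along_apply, Finset.sum_comm]
    refine Finset.sum_congr rfl fun j _ => ?_
    rw [R.V_vtrace_qspray hsymm hV, Finset.mul_sum]
    exact Finset.sum_congr rfl fun _ _ => mul_comm _ _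
  have h2 : R.vpair (R.qspray Γ) T = ∑ m, ∑ j, R.conn Γ j m * R.V j (T m) := by
    rw [vpair]
    exact Finset.sum_congr rfl fun m _ => Finset.sum_congr rfl fun j _ => by
      rw [R.V_qspray hsymm hV]
  -- The cross terms between the affine spray and `T` are the connection terms that turn ∂Tᵐ/∂xᵐ
  -- into the horizontal divergence.
  have h3 : R.hdiv Γ T = ∑ m, R.D m (T m) - R.vpair (R.qspray Γ) T
      + R.along T (R.vtrace (R.qspray Γ)) := by
    rw [h1, h2, hdiv]
    simp only [hor_apply, Finset.sum_add_distrib, Finset.sum_sub_distrib]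
  rw [ric_eq, ric_eq, h3, horAlong_y, vtrace_add, vpair_add_left, vpair_add_right,
    vpair_add_right, R.vpair_comm T]
  simp only [map_add, along_add, Pi.add_apply, Finset.sum_add_distrib, mul_add]
  ring

lemma vtrace_y : R.vtrace R.y = n := by
  simp [vtrace, V_y]

lemma alongVec_y (T : Fin n → A) : R.alongVec T R.y = T := by
  funext m
  rw [alongVec, along_y]

lemma vpair_y_y : R.vpair R.y R.y = n := by
  simp [vpair, V_y]

lemma vpair_y (Q : Fin n → A) : R.vpair Q R.y = R.vtrace Q := by
  simp only [vpair, V_y, vtrace]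
  simp

lemma hor_y (k m : Fin n) : R.hor Γ k (R.y m) = - R.conn Γ m k := by
  rw [hor_apply, D_y, zero_sub]
  simp [V_y]

include hsymm in
lemma hdiv_y : R.hdiv Γ R.y = 0 := by
  rw [hdiv]
  refine Finset.sum_eq_zero fun m _ => ?_
  rw [hor_y, conn, neg_add_eq_zero]
  exact Finset.sum_congr rfl fun _ _ => by rw [hsymm]

include hsymm hV in
/-- Projective change of the Ricci curvature. -/
lemma ric_add_projective (Q : Fin n → A) (P : A)
    (hQ : ∀ m, R.along R.y (Q m) = 2 * Q m) (hP : R.along R.y P = P) :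
    R.ric (R.qspray Γ + (Q + P • R.y)) = R.ric (R.qspray Γ + Q)
      + ((n : A) - 1) * (P ^ 2 - R.horAlong Γ R.y P + 2 * R.along Q P) := by
  have hQ' : R.alongVec R.y Q = (2 : A) • Q := by
    funext m
    simp [alongVec, hQ]
  have htQ : R.along R.y (R.vtrace Q) = R.vtrace Q := by
    simp only [vtrace, map_sum]
    refine Finset.sum_congr rfl fun m _ => ?_
    -- A vertical derivative of Euler's identity for degree 2 gives Euler's identity for degree 1.
    have h := congrArg (R.V m) (hQ m)
    rw [along_apply] at h
    simp only [map_sum, Derivation.leibniz, V_y, smul_eq_mul, Finset.sum_add_distrib, mul_ite,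
      mul_one, mul_zero, Finset.sum_ite_eq, Finset.mem_univ, if_true, two_mul, map_add] at h
    rw [along_apply]
    rw [Finset.sum_congr rfl fun j _ => by rw [R.V_V j m]]
    linear_combination h
  have hvP : R.vtrace (P • R.y) = (n + 1) * P := by
    rw [vtrace_smul, hP, vtrace_y]
    ring
  have hvQP : R.vpair Q (P • R.y) = P * R.vtrace Q + 2 * R.along Q P := by
    have := R.vpair_smul_smul 1 P Q R.y
    rw [one_smul, alongVec_y, hQ', along_smul, vpair_y] at this
    rw [this]
    simp
    ring
  have hvPP : R.vpair (P • R.y) (P • R.y) = (n + 3) * P ^ 2 := by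
    rw [vpair_smul_smul, alongVec_y, hP, vpair_y_y]
    ring
  rw [R.ric_add hsymm hV, R.ric_add hsymm hV, hdiv_add, hdiv_smul, R.hdiv_y hsymm,
    vtrace_add, hvP, vpair_add_left, vpair_add_right, vpair_add_right,
    R.vpair_comm (P • R.y) Q, hvQP, hvPP]
  simp only [map_add, along_add, along_smul, htQ, Derivation.leibniz, smul_eq_mul,
    Derivation.map_natCast, Derivation.map_one_eq_zero, hP]
  ring

include hsymm hV in
/-- The equation that determines the geodesic coefficients, in terms of the difference tensor. -/
lemma geodesic_equation_of {T : Fin n → A} {L : A} {i : Fin n}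
    (h : 2 * R.along T (R.V i L) = R.V i (R.horAlong Γ R.y L) - 2 * R.hor Γ i L) :
    2 * ∑ l, R.V l (R.V i L) * (R.qspray Γ + T) l
    = ∑ k, R.V i (R.D k L) * R.y k - R.D i L := by
  have h1 : ∑ l, R.V l (R.V i L) * (R.qspray Γ + T) l
      = R.along (R.qspray Γ + T) (R.V i L) := by
    rw [along_apply]
    exact Finset.sum_congr rfl fun _ _ => mul_comm _ _
  have h2 : R.V i (R.horAlong Γ R.y L) = R.D i L + ∑ k, R.V i (R.D k L) * R.y k
      - 2 * (∑ j, R.conn Γ j i * R.V j L) - 2 * R.along (R.qspray Γ) (R.V i L) := by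
    have h3 : R.V i (2 * R.along (R.qspray Γ) L) = 2 * (∑ j, R.conn Γ j i * R.V j L)
        + 2 * R.along (R.qspray Γ) (R.V i L) := by
      rw [along_apply, along_apply, ← mul_add, ← Finset.sum_add_distrib, two_mul, map_add,
        ← two_mul, map_sum]
      congr 1
      refine Finset.sum_congr rfl fun j _ => ?_
      rw [Derivation.leibniz, R.V_qspray hsymm hV, R.V_V i j]
      simp only [smul_eq_mul]
      ring
    rw [horAlong_y, map_sub, h3, map_sum]
    simp only [Derivation.leibniz, smul_eq_mul, Finset.sum_add_distrib, R.V_y]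
    simp only [mul_ite, mul_one, mul_zero, Finset.sum_ite_eq, Finset.mem_univ, if_true]
    rw [Finset.sum_congr rfl fun k _ => mul_comm (R.y k) _]
    ring
  rw [h1, along_add, mul_add, h, h2, hor_apply]
  ring

end TangentRing

end Kropina

end

/-! ### Tensor calculus of a metric and a one-form inside a `TangentRing`. -/

noncomputable section

namespace Kropina

open Matrix

namespace TangentRing

variable {n : ℕ} {A : Type*} [CommRing A] [Algebra ℝ A] (R : TangentRing n A)

/-- The functions of the position alone. -/
def base : Subalgebra ℝ A where
  carrier := {f | ∀ k, R.V k f = 0}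
  mul_mem' := by
    intro f g hf hg k
    simp [hf k, hg k]
  add_mem' := by
    intro f g hf hg k
    simp [hf k, hg k]
  algebraMap_mem' := by
    intro c k
    simp

variable {R}

lemma V_base {f : A} (hf : f ∈ R.base) (k : Fin n) : R.V k f = 0 := hf k

lemma along_base {f : A} (hf : f ∈ R.base) (T : Fin n → A) : R.along T f = 0 := by
  simp [along_apply, V_base hf]

lemma D_mem_base {f : A} (hf : f ∈ R.base) (k : Fin n) : R.D k f ∈ R.base := fun l => by
  rw [R.V_D, V_base hf, map_zero]

lemma half_mem_base : half A ∈ R.base := R.base.algebraMap_mem _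

lemma dot_mem_base {u v : Fin n → A} (hu : ∀ i, u i ∈ R.base) (hv : ∀ i, v i ∈ R.base) :
    u ⬝ᵥ v ∈ R.base :=
  sum_mem fun i _ => mul_mem (hu i) (hv i)

lemma hor_base {f : A} (hf : f ∈ R.base) (Γ) (k : Fin n) : R.hor Γ k f = R.D k f := by
  simp [hor_apply, V_base hf]

lemma der_dot (d : Derivation ℝ A A) (u v : Fin n → A) :
    d (u ⬝ᵥ v) = (fun i => d (u i)) ⬝ᵥ v + u ⬝ᵥ fun i => d (v i) := by
  simp [dotProduct, Finset.sum_add_distrib, mul_comm, add_comm]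

lemma V_linear {w : Fin n → A} (hw : ∀ i, w i ∈ R.base) (k : Fin n) :
    R.V k (w ⬝ᵥ R.y) = w k := by
  simp [V_base (hw _), R.V_y, dotProduct]

lemma along_linear {w : Fin n → A} (hw : ∀ i, w i ∈ R.base) (T : Fin n → A) :
    R.along T (w ⬝ᵥ R.y) = w ⬝ᵥ T := by
  rw [along_apply]
  exact Finset.sum_congr rfl fun _ _ => by rw [V_linear hw, mul_comm]

lemma V_quadratic {q : Matrix (Fin n) (Fin n) A} (hq : ∀ i j, q i j ∈ R.base)
    (hs : ∀ i j, q i j = q j i) (k : Fin n) :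
    R.V k (R.y ⬝ᵥ q *ᵥ R.y) = 2 * (q *ᵥ R.y) k := by
  have h : ∀ i, R.V k ((q *ᵥ R.y) i) = q i k := fun i => V_linear (hq i) k
  rw [der_dot, two_mul]
  congr 1
  · simp [dotProduct, R.V_y]
  · simp only [h]
    exact Finset.sum_congr rfl fun i _ => by
      change R.y i * q i k = q k i * R.y i
      rw [hs, mul_comm]

lemma along_quadratic {q : Matrix (Fin n) (Fin n) A} (hq : ∀ i j, q i j ∈ R.base)
    (hs : ∀ i j, q i j = q j i) (T : Fin n → A) :
    R.along T (R.y ⬝ᵥ q *ᵥ R.y) = 2 * (T ⬝ᵥ q *ᵥ R.y) := by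
  rw [along_apply, show T ⬝ᵥ q *ᵥ R.y = ∑ j, T j * (q *ᵥ R.y) j from rfl, Finset.mul_sum]
  exact Finset.sum_congr rfl fun _ _ => by rw [V_quadratic hq hs]; ring

end TangentRing

/-- A metric with components `a`, inverse `h`, and a one-form with components `b`, as elements of a
`TangentRing`. -/
structure PairRing {n : ℕ} {A : Type*} [CommRing A] [Algebra ℝ A] (R : TangentRing n A) where
  a : Matrix (Fin n) (Fin n) A
  h : Matrix (Fin n) (Fin n) A
  b : Fin n → A
  a_symm : ∀ i j, a i j = a j i
  h_mul_a : h * a = 1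
  a_mem : ∀ i j, a i j ∈ R.base
  b_mem : ∀ i, b i ∈ R.base

namespace PairRing

variable {n : ℕ} {A : Type*} [CommRing A] [Algebra ℝ A] {R : TangentRing n A} (S : PairRing R)

open TangentRing

def Γ (k i j : Fin n) : A :=
  half A * ∑ l, S.h k l * (R.D i (S.a j l) + R.D j (S.a i l) - R.D l (S.a i j))

def cov (w : Fin n → A) (i j : Fin n) : A := R.D j (w i) - ∑ k, S.Γ k i j * w k

def covVec (u : Fin n → A) (i j : Fin n) : A := R.D j (u i) + ∑ k, S.Γ i j k * u k

def covEndo (T : Fin n → Fin n → A) (i j k : Fin n) : A :=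
  R.D k (T i j) + (∑ m, S.Γ i k m * T m j) - ∑ m, S.Γ m k j * T i m

def r : Matrix (Fin n) (Fin n) A := Matrix.of fun i j =>
  half A * (S.cov S.b i j + S.cov S.b j i)

def s : Matrix (Fin n) (Fin n) A := Matrix.of fun i j =>
  half A * (S.cov S.b i j - S.cov S.b j i)

def bUp : Fin n → A := S.h *ᵥ S.b

def bSq : A := S.b ⬝ᵥ S.bUp

def sMix : Matrix (Fin n) (Fin n) A := S.h * S.s

def s1 (j : Fin n) : A := ∑ i, S.bUp i * S.s i j

def s1Up : Fin n → A := S.h *ᵥ S.s1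

def alphaSq : A := R.y ⬝ᵥ S.a *ᵥ R.y

def beta : A := S.b ⬝ᵥ R.y

def r00 : A := R.y ⬝ᵥ S.r *ᵥ R.y

def s0 : A := S.s1 ⬝ᵥ R.y

/-- The vector `sⁱ₀`. -/
def sVec : Fin n → A := S.sMix *ᵥ R.y

def s0s : A := S.sVec ⬝ᵥ S.s1

def sSq : A := S.s1Up ⬝ᵥ S.s1

def trS : A := ∑ i, ∑ j, S.sMix i j * S.sMix j i

def divS0 : A := ∑ k, ∑ i, S.covEndo S.sMix k i k * R.y i

def s0_0 : A := ∑ i, ∑ j, S.cov S.s1 i j * R.y i * R.y j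

def b_s0 : A := ∑ k, ∑ i, S.bUp k * S.cov S.s1 i k * R.y i

def divs : A := ∑ k, S.covVec S.s1Up k k

/-! Components lying in the base. -/

lemma a_mul_h : S.a * S.h = 1 := mul_eq_one_comm.1 S.h_mul_a

lemma a_transpose : S.aᵀ = S.a := by
  ext i j
  exact S.a_symm j i

lemma h_transpose : S.hᵀ = S.h := by
  have h1 : S.a * S.hᵀ = 1 := by
    rw [← S.a_transpose, ← Matrix.transpose_mul, S.h_mul_a, Matrix.transpose_one]
  calc S.hᵀ = S.h * S.a * S.hᵀ := by rw [S.h_mul_a, Matrix.one_mul]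
    _ = S.h := by rw [Matrix.mul_assoc, h1, Matrix.mul_one]

/-- A vertical derivative of h a = 1 gives (∂h) a = 0, and a is invertible. -/
lemma h_mem (i j : Fin n) : S.h i j ∈ R.base := by
  intro k
  let dh : Matrix (Fin n) (Fin n) A := Matrix.of fun i j => R.V k (S.h i j)
  have h0 : dh * S.a = 0 := by
    ext p q
    have h1 : R.V k ((S.h * S.a) p q) = 0 := by
      rw [S.h_mul_a, Matrix.one_apply]
      split_ifs <;> simp
    rw [Matrix.mul_apply, map_sum] at h1
    rw [Matrix.mul_apply, Matrix.zero_apply, ← h1]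
    exact Finset.sum_congr rfl fun _ _ => by
      rw [Derivation.leibniz, S.a_mem _ _ k, smul_zero, zero_add, smul_eq_mul, mul_comm]; rfl
  have h2 : dh = 0 := by
    rw [← Matrix.mul_one dh, ← S.a_mul_h, ← Matrix.mul_assoc, h0, Matrix.zero_mul]
  exact congrFun (congrFun h2 i) j

lemma Γ_mem (k i j : Fin n) : S.Γ k i j ∈ R.base :=
  mul_mem half_mem_base (sum_mem fun _ _ => mul_mem (S.h_mem _ _)
    (sub_mem (add_mem (D_mem_base (S.a_mem _ _) _) (D_mem_base (S.a_mem _ _) _))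
      (D_mem_base (S.a_mem _ _) _)))

lemma Γ_symm (k i j : Fin n) : S.Γ k i j = S.Γ k j i := by
  unfold Γ
  congr 1
  refine Finset.sum_congr rfl fun l _ => ?_
  rw [S.a_symm i j]
  ring

lemma V_Γ (l k i j : Fin n) : R.V l (S.Γ k i j) = 0 := S.Γ_mem k i j l

lemma cov_mem {w : Fin n → A} (hw : ∀ i, w i ∈ R.base) (i j : Fin n) : S.cov w i j ∈ R.base :=
  sub_mem (D_mem_base (hw i) j) (sum_mem fun _ _ => mul_mem (S.Γ_mem _ _ _) (hw _))

lemma r_mem (i j : Fin n) : S.r i j ∈ R.base :=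
  mul_mem half_mem_base (add_mem (S.cov_mem S.b_mem _ _) (S.cov_mem S.b_mem _ _))

lemma s_mem (i j : Fin n) : S.s i j ∈ R.base :=
  mul_mem half_mem_base (sub_mem (S.cov_mem S.b_mem _ _) (S.cov_mem S.b_mem _ _))

lemma bUp_mem (i : Fin n) : S.bUp i ∈ R.base :=
  dot_mem_base (S.h_mem i) S.b_mem

lemma bSq_mem : S.bSq ∈ R.base := dot_mem_base S.b_mem S.bUp_mem

lemma sMix_mem (i j : Fin n) : S.sMix i j ∈ R.base := by
  rw [sMix, Matrix.mul_apply]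
  exact sum_mem fun _ _ => mul_mem (S.h_mem _ _) (S.s_mem _ _)

lemma s1_mem (i : Fin n) : S.s1 i ∈ R.base :=
  sum_mem fun _ _ => mul_mem (S.bUp_mem _) (S.s_mem _ _)

/-! Symmetries and contractions. -/

lemma r_symm (i j : Fin n) : S.r i j = S.r j i := by
  simp only [r, Matrix.of_apply]
  ring

lemma s_antisymm (i j : Fin n) : S.s i j = - S.s j i := by
  simp only [s, Matrix.of_apply]
  ring

lemma s_transpose : S.sᵀ = -S.s := by
  ext i j
  exact S.s_antisymm j i

lemma cov_b (i j : Fin n) : S.cov S.b i j = S.r i j + S.s i j := by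
  simp only [r, s, Matrix.of_apply]
  linear_combination (-S.cov S.b i j) * two_half (A := A)

lemma dot_a_symm (u v : Fin n → A) : u ⬝ᵥ S.a *ᵥ v = v ⬝ᵥ S.a *ᵥ u := by
  rw [dotProduct_mulVec, ← mulVec_transpose, S.a_transpose, dotProduct_comm]

lemma dot_s_antisymm (u v : Fin n → A) : u ⬝ᵥ S.s *ᵥ v = - (v ⬝ᵥ S.s *ᵥ u) := by
  rw [dotProduct_mulVec, ← mulVec_transpose, S.s_transpose, dotProduct_comm, neg_mulVec,
    dotProduct_neg]

lemma dot_s_self (u : Fin n → A) : u ⬝ᵥ S.s *ᵥ u = 0 := by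
  apply half_cancel
  have := S.dot_s_antisymm u u
  linear_combination this

lemma a_mulVec_bUp : S.a *ᵥ S.bUp = S.b := by
  rw [bUp, mulVec_mulVec, S.a_mul_h, one_mulVec]

lemma a_mulVec_sMix (v : Fin n → A) : S.a *ᵥ (S.sMix *ᵥ v) = S.s *ᵥ v := by
  rw [mulVec_mulVec, sMix, ← Matrix.mul_assoc, S.a_mul_h, Matrix.one_mul]

lemma a_mulVec_sVec : S.a *ᵥ S.sVec = S.s *ᵥ R.y := S.a_mulVec_sMix _

lemma a_mulVec_s1Up : S.a *ᵥ S.s1Up = S.s1 := by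
  rw [s1Up, mulVec_mulVec, S.a_mul_h, one_mulVec]

lemma s_mulVec_bUp : S.s *ᵥ S.bUp = - S.s1 := by
  funext j
  simp only [mulVec, dotProduct, Pi.neg_apply, s1, ← Finset.sum_neg_distrib]
  exact Finset.sum_congr rfl fun i _ => by rw [S.s_antisymm]; ring

lemma sMix_mulVec_bUp : S.sMix *ᵥ S.bUp = - S.s1Up := by
  rw [sMix, ← mulVec_mulVec, S.s_mulVec_bUp, mulVec_neg, s1Up]

/-- `u · S.b` in terms of the metric. -/
lemma b_dot (u : Fin n → A) : S.b ⬝ᵥ u = S.bUp ⬝ᵥ S.a *ᵥ u := by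
  rw [S.dot_a_symm, S.a_mulVec_bUp, dotProduct_comm]

lemma s1_dot (u : Fin n → A) : S.s1 ⬝ᵥ u = S.bUp ⬝ᵥ S.s *ᵥ u := by
  rw [S.dot_s_antisymm, S.s_mulVec_bUp, dotProduct_neg, neg_neg, dotProduct_comm]

lemma b_dot_sVec : S.b ⬝ᵥ S.sVec = S.s0 := by
  rw [S.b_dot, S.a_mulVec_sVec, ← S.s1_dot, s0]

lemma b_dot_s1Up : S.b ⬝ᵥ S.s1Up = 0 := by
  rw [S.b_dot, S.a_mulVec_s1Up, dotProduct_comm, S.s1_dot, S.dot_s_self]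

lemma s1_dot_bUp : S.s1 ⬝ᵥ S.bUp = 0 := by
  rw [S.s1_dot, S.dot_s_self]

lemma y_dot_ay : R.y ⬝ᵥ S.a *ᵥ R.y = S.alphaSq := rfl

lemma b_dot_y : S.b ⬝ᵥ R.y = S.beta := rfl

lemma b_dot_bUp : S.b ⬝ᵥ S.bUp = S.bSq := rfl

lemma bUp_dot_ay : S.bUp ⬝ᵥ S.a *ᵥ R.y = S.beta := by rw [← S.b_dot, beta]

lemma sVec_dot_ay : S.sVec ⬝ᵥ S.a *ᵥ R.y = 0 := by
  rw [S.dot_a_symm, S.a_mulVec_sVec, S.dot_s_self]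

lemma s1Up_dot_ay : S.s1Up ⬝ᵥ S.a *ᵥ R.y = S.s0 := by
  rw [S.dot_a_symm, S.a_mulVec_s1Up, dotProduct_comm, s0]

lemma bUp_dot_sy : S.bUp ⬝ᵥ S.s *ᵥ R.y = S.s0 := by rw [← S.s1_dot, s0]

/-! Vertical derivatives. -/

lemma V_alphaSq (k : Fin n) : R.V k S.alphaSq = 2 * (S.a *ᵥ R.y) k :=
  V_quadratic S.a_mem S.a_symm k

lemma along_alphaSq (T : Fin n → A) : R.along T S.alphaSq = 2 * (T ⬝ᵥ S.a *ᵥ R.y) :=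
  along_quadratic S.a_mem S.a_symm T

lemma V_beta (k : Fin n) : R.V k S.beta = S.b k := V_linear S.b_mem k

lemma along_beta (T : Fin n → A) : R.along T S.beta = S.b ⬝ᵥ T := along_linear S.b_mem T

lemma along_s0 (T : Fin n → A) : R.along T S.s0 = S.s1 ⬝ᵥ T := along_linear S.s1_mem T

lemma V_r00 (k : Fin n) : R.V k S.r00 = 2 * (S.r *ᵥ R.y) k := V_quadratic S.r_mem S.r_symm k

lemma alongVec_sVec (T : Fin n → A) : R.alongVec T S.sVec = S.sMix *ᵥ T := by
  funext m
  exact along_linear (S.sMix_mem m) T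

lemma alongVec_bUp (T : Fin n → A) : R.alongVec T S.bUp = 0 := by
  funext m
  exact along_base (S.bUp_mem m) T

lemma vtrace_bUp : R.vtrace S.bUp = 0 :=
  Finset.sum_eq_zero fun m _ => V_base (S.bUp_mem m) m

lemma V_sVec (k m : Fin n) : R.V k (S.sVec m) = S.sMix m k := V_linear (S.sMix_mem m) k

/-- The matrix h is symmetric and s is skew, so transposition changes the sign of the trace. -/
lemma trace_sMix : S.sMix.trace = 0 := by
  have h : S.sMix.trace = - S.sMix.trace := by
    conv_lhs => rw [sMix, ← Matrix.trace_transpose, Matrix.transpose_mul, S.h_transpose,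
      S.s_transpose, Matrix.trace_mul_comm, Matrix.mul_neg, Matrix.trace_neg]
    rw [sMix]
  apply half_cancel
  linear_combination h

lemma vtrace_sVec : R.vtrace S.sVec = 0 := by
  simp only [vtrace, V_sVec]
  exact S.trace_sMix

lemma vpair_sVec_sVec : R.vpair S.sVec S.sVec = S.trS := by
  simp only [vpair, V_sVec, trS]
  rw [Finset.sum_comm]

lemma vpair_bUp_right (X : Fin n → A) : R.vpair X S.bUp = 0 := by
  simp [vpair, V_base (S.bUp_mem _)]

/-! Horizontal derivatives. -/

lemma a_Γ (m i j : Fin n) : ∑ k, S.a m k * S.Γ k i j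
    = half A * (R.D i (S.a j m) + R.D j (S.a i m) - R.D m (S.a i j)) := by
  let u : Fin n → A := fun l => R.D i (S.a j l) + R.D j (S.a i l) - R.D l (S.a i j)
  have h1 : ∀ k, S.Γ k i j = half A * (S.h *ᵥ u) k := fun k => rfl
  have h2 : ∑ k, S.a m k * S.Γ k i j = half A * (S.a *ᵥ S.h *ᵥ u) m := by
    simp only [h1]
    rw [mulVec, dotProduct, Finset.mul_sum]
    exact Finset.sum_congr rfl fun _ _ => by ring
  rw [h2, mulVec_mulVec, S.a_mul_h, one_mulVec]

/-- Compatibility of the connection with the metric: in the sum of the two Christoffel expressions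
the other derivatives cancel in pairs. -/
lemma D_a (k i j : Fin n) : R.D k (S.a i j)
    = ∑ l, S.a j l * S.Γ l k i + ∑ l, S.a i l * S.Γ l k j := by
  rw [S.a_Γ, S.a_Γ, S.a_symm j i]
  linear_combination (-R.D k (S.a i j)) * two_half (A := A)

lemma hor_linear {w : Fin n → A} (hw : ∀ i, w i ∈ R.base) (k : Fin n) :
    R.hor S.Γ k (w ⬝ᵥ R.y) = ∑ i, S.cov w i k * R.y i := by
  rw [der_dot]
  simp only [hor_base (hw _), R.hor_y, dotProduct, cov, sub_mul, Finset.sum_sub_distrib,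
    conn, mul_neg, Finset.sum_neg_distrib, ← sub_eq_add_neg, Finset.mul_sum, Finset.sum_mul]
  congr 1
  rw [Finset.sum_comm]
  exact Finset.sum_congr rfl fun i _ => Finset.sum_congr rfl fun j _ => by
    rw [S.Γ_symm j k i]; ring

lemma hor_beta (k : Fin n) :
    R.hor S.Γ k S.beta = (S.r *ᵥ R.y) k - (S.s *ᵥ R.y) k := by
  rw [beta, S.hor_linear S.b_mem, mulVec, mulVec, dotProduct, dotProduct,
    ← Finset.sum_sub_distrib]
  exact Finset.sum_congr rfl fun i _ => by
    rw [S.cov_b, S.r_symm k i, S.s_antisymm k i]; ring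

/-- Metric compatibility read on the fibres. As a consequence horizontal derivatives of F only see
β. -/
lemma hor_alphaSq (k : Fin n) : R.hor S.Γ k S.alphaSq = 0 := by
  rw [hor_apply, Finset.sum_congr rfl fun j _ => by rw [S.V_alphaSq]]
  have h1 : R.D k S.alphaSq = ∑ i, ∑ j, R.D k (S.a i j) * R.y i * R.y j := by
    simp only [alphaSq, mulVec, dotProduct, map_sum, Derivation.leibniz, R.D_y, smul_eq_mul,
      mul_zero, add_zero, zero_add, Finset.mul_sum]
    exact Finset.sum_congr rfl fun i _ => Finset.sum_congr rfl fun j _ => by ring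
  have h2 : ∑ j, R.conn S.Γ j k * (2 * (S.a *ᵥ R.y) j)
      = 2 * ∑ i, ∑ j, ∑ l, S.a j l * S.Γ l k i * R.y i * R.y j := by
    have h3 : ∀ l, R.conn S.Γ l k * (2 * (S.a *ᵥ R.y) l)
        = ∑ i, ∑ j, (S.Γ l k i * R.y i) * (2 * (S.a l j * R.y j)) := fun l => by
      rw [conn, mulVec, dotProduct, Finset.mul_sum, Finset.sum_mul_sum]
    simp only [h3]
    rw [Finset.sum_comm, Finset.mul_sum]
    refine Finset.sum_congr rfl fun i _ => ?_
    rw [Finset.sum_comm, Finset.mul_sum]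
    refine Finset.sum_congr rfl fun j _ => ?_
    rw [Finset.mul_sum]
    refine Finset.sum_congr rfl fun l _ => ?_
    rw [S.a_symm l j]
    ring
  rw [h1, h2, two_mul]
  simp only [D_a, add_mul, Finset.sum_add_distrib, Finset.sum_mul]
  rw [sub_eq_zero]
  congr 1
  rw [Finset.sum_comm]
  exact Finset.sum_congr rfl fun i _ => Finset.sum_congr rfl fun j _ =>
    Finset.sum_congr rfl fun l _ => by ring

lemma hdiv_base {u : Fin n → A} (hu : ∀ i, u i ∈ R.base) :
    R.hdiv S.Γ u = ∑ k, S.covVec u k k := by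
  simp only [hdiv, hor_base (hu _), covVec]
  exact Finset.sum_congr rfl fun m _ => by
    rw [Finset.sum_congr rfl fun j _ => by rw [S.Γ_symm]]

lemma hdiv_endo {T : Matrix (Fin n) (Fin n) A} (hT : ∀ i j, T i j ∈ R.base) :
    R.hdiv S.Γ (T *ᵥ R.y) = ∑ k, ∑ i, S.covEndo T k i k * R.y i := by
  refine Finset.sum_congr rfl fun m _ => ?_
  have h1 : R.hor S.Γ m ((T *ᵥ R.y) m)
      = ∑ i, R.D m (T m i) * R.y i - ∑ i, (∑ l, S.Γ l m i * T m l) * R.y i := by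
    rw [mulVec, der_dot]
    simp only [hor_base (hT _ _), R.hor_y, dotProduct, mul_neg, Finset.sum_neg_distrib,
      ← sub_eq_add_neg, conn, Finset.mul_sum, Finset.sum_mul]
    congr 1
    rw [Finset.sum_comm]
    exact Finset.sum_congr rfl fun i _ => Finset.sum_congr rfl fun j _ => by ring
  have h2 : ∑ j, S.Γ m j m * (T *ᵥ R.y) j = ∑ i, (∑ l, S.Γ m m l * T l i) * R.y i := by
    simp only [mulVec, dotProduct, Finset.mul_sum, Finset.sum_mul]
    rw [Finset.sum_comm]
    exact Finset.sum_congr rfl fun i _ => Finset.sum_congr rfl fun j _ => by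
      rw [S.Γ_symm m j m]; ring
  rw [h1, h2]
  simp only [covEndo, add_mul, sub_mul, Finset.sum_add_distrib, Finset.sum_sub_distrib]
  ring

lemma hdiv_sVec : R.hdiv S.Γ S.sVec = S.divS0 := S.hdiv_endo S.sMix_mem

end PairRing

end Kropina

end

/-! ### The spray of the Kropina metric. -/

noncomputable section

namespace Kropina

open Matrix TangentRing

/-- The data of a Kropina metric, as elements of a `TangentRing` in which `b²`, `β` and `α²` are
invertible. -/
structure KropinaRing {n : ℕ} {A : Type*} [CommRing A] [Algebra ℝ A] (R : TangentRing n A) extends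
    PairRing R where
  om : A
  bi : A
  ai : A
  bSq_om : toPairRing.bSq * om = 1
  beta_bi : toPairRing.beta * bi = 1
  alphaSq_ai : toPairRing.alphaSq * ai = 1

namespace KropinaRing

variable {n : ℕ} {A : Type*} [CommRing A] [Algebra ℝ A] {R : TangentRing n A} (S : KropinaRing R)

/-- The Kropina metric `α²/β`. -/
def F : A := S.alphaSq * S.bi

/-- The coefficient of `bⁱ` in the spray. -/
def u : A := half A * S.om * (S.F * S.s0 + S.r00)

/-- The part of the spray that is regular at `α² = 0`. -/
def Q : Fin n → A := (-(half A * S.F)) • S.sVec + S.u • S.bUp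

/-- The projective factor of the spray. -/
def P : A := -S.om * (S.s0 + S.r00 * S.beta * S.ai)

/-- The difference of the sprays of `F` and `α`. -/
def T : Fin n → A := S.Q + S.P • R.y

/-- The spray coefficients of `F`. -/
def G : Fin n → A := R.qspray S.Γ + S.T

lemma om_mem : S.om ∈ R.base := by
  intro k
  have h := congrArg (R.V k) S.bSq_om
  rw [Derivation.leibniz, V_base S.bSq_mem, smul_zero, add_zero, smul_eq_mul,
    Derivation.map_one_eq_zero] at h
  linear_combination S.om * h - R.V k S.om * S.bSq_om

lemma der_bi (d : Derivation ℝ A A) : d S.bi = - S.bi ^ 2 * d S.beta := by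
  have h := congrArg d S.beta_bi
  rw [Derivation.leibniz, smul_eq_mul, smul_eq_mul, Derivation.map_one_eq_zero] at h
  linear_combination S.bi * h - d S.bi * S.beta_bi

lemma der_om (d : Derivation ℝ A A) : d S.om = - S.om ^ 2 * d S.bSq := by
  have h := congrArg d S.bSq_om
  rw [Derivation.leibniz, smul_eq_mul, smul_eq_mul, Derivation.map_one_eq_zero] at h
  linear_combination S.om * h - d S.om * S.bSq_om

lemma der_F (d : Derivation ℝ A A) : d S.F = S.bi * (d S.alphaSq - S.F * d S.beta) := by
  rw [F, Derivation.leibniz, S.der_bi]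
  simp only [smul_eq_mul]
  ring

lemma a_mulVec_Q (i : Fin n) :
    (S.a *ᵥ S.Q) i = -(half A * S.F) * (S.s *ᵥ R.y) i + S.u * S.b i := by
  rw [Q, mulVec_add, mulVec_smul, mulVec_smul, S.a_mulVec_sVec, S.a_mulVec_bUp]
  rfl

lemma Q_dot_ay : S.Q ⬝ᵥ S.a *ᵥ R.y = S.u * S.beta := by
  rw [Q, add_dotProduct, smul_dotProduct, smul_dotProduct, S.sVec_dot_ay, S.bUp_dot_ay]
  simp

lemma b_dot_Q : S.b ⬝ᵥ S.Q = half A * S.r00 := by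
  rw [Q, dotProduct_add, dotProduct_smul, dotProduct_smul, S.b_dot_sVec, smul_eq_mul,
    smul_eq_mul, ← PairRing.bSq, u]
  linear_combination half A * (S.F * S.s0 + S.r00) * S.bSq_om

lemma along_Q_F : R.along S.Q S.F = S.bi * (2 * S.u * S.beta - half A * S.F * S.r00) := by
  rw [S.der_F, S.along_alphaSq, S.along_beta, S.Q_dot_ay, S.b_dot_Q]
  ring

/-- Clears the only denominator α² of the spray, so that identities involving `P` become polynomial.
-/
lemma alphaSq_P : S.alphaSq * S.P = -S.om * (S.alphaSq * S.s0 + S.r00 * S.beta) := by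
  rw [P]
  linear_combination -S.om * S.r00 * S.beta * S.alphaSq_ai

lemma T_dot_ay : S.T ⬝ᵥ S.a *ᵥ R.y = half A * (S.alphaSq * S.P) := by
  have h2 := two_half (A := A)
  rw [T, add_dotProduct, smul_dotProduct, S.Q_dot_ay, smul_eq_mul, ← PairRing.alphaSq, u, F,
    mul_comm S.P, S.alphaSq_P]
  linear_combination half A * S.om * S.alphaSq * S.s0 * S.beta_bi
    + S.om * (S.alphaSq * S.s0 + S.r00 * S.beta) * h2

lemma b_dot_T : S.b ⬝ᵥ S.T = half A * S.r00 + S.P * S.beta := by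
  rw [T, dotProduct_add, dotProduct_smul, S.b_dot_Q, smul_eq_mul, ← PairRing.beta]

lemma a_mulVec_T (i : Fin n) : (S.a *ᵥ S.T) i =
    -(half A * S.F) * (S.s *ᵥ R.y) i + S.u * S.b i + S.P * (S.a *ᵥ R.y) i := by
  rw [T, mulVec_add, mulVec_smul, Pi.add_apply, S.a_mulVec_Q]
  rfl

/-- `F²`. -/
def L : A := S.F ^ 2

lemma der_L (d : Derivation ℝ A A) : d S.L = 2 * S.F * d S.F := by
  rw [L, pow_two, Derivation.leibniz, smul_eq_mul]
  ring

lemma V_L (i : Fin n) :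
    R.V i S.L = 2 * S.F * S.bi * (2 * (S.a *ᵥ R.y) i - S.F * S.b i) := by
  rw [der_L, der_F, S.V_alphaSq, S.V_beta]
  ring

lemma hor_L (k : Fin n) : R.hor S.Γ k S.L
    = -(2 * S.L * S.bi * ((S.r *ᵥ R.y) k - (S.s *ᵥ R.y) k)) := by
  rw [der_L, der_F, S.hor_alphaSq, S.hor_beta, L]
  ring

lemma horAlong_y_beta : R.horAlong S.Γ R.y S.beta = S.r00 := by
  have h := S.dot_s_self R.y
  rw [horAlong_apply, PairRing.r00]
  simp only [S.hor_beta, mul_sub, Finset.sum_sub_distrib]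
  rw [show ∑ k, R.y k * (S.s *ᵥ R.y) k = 0 from h, sub_zero]
  rfl

lemma horAlong_alphaSq (T : Fin n → A) : R.horAlong S.Γ T S.alphaSq = 0 := by
  simp [horAlong_apply, S.hor_alphaSq]

lemma horAlong_y_L : R.horAlong S.Γ R.y S.L = -(2 * S.L * S.bi * S.r00) := by
  rw [der_L, der_F, S.horAlong_alphaSq, S.horAlong_y_beta, L]
  ring

/-- The covariant form of the geodesic equation for F², as `geodesic_equation_of` requires it. This
verification is what justifies the formulas for `Q` and `P`. -/
lemma along_V_L (i : Fin n) : 2 * R.along S.T (R.V i S.L)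
    = R.V i (R.horAlong S.Γ R.y S.L) - 2 * R.hor S.Γ i S.L := by
  have hay : R.along S.T ((S.a *ᵥ R.y) i) = (S.a *ᵥ S.T) i := along_linear (S.a_mem i) _
  have hF : R.along S.T S.F
      = S.bi * (S.alphaSq * S.P - S.F * (half A * S.r00 + S.P * S.beta)) := by
    rw [S.der_F, S.along_alphaSq, S.along_beta, S.T_dot_ay, S.b_dot_T]
    linear_combination S.bi * S.alphaSq * S.P * two_half (A := A)
  have hbi : R.along S.T S.bi = - S.bi ^ 2 * (half A * S.r00 + S.P * S.beta) := by
    rw [S.der_bi, S.along_beta, S.b_dot_T]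
  have h2 : R.along S.T (2 : A) = 0 := by
    simpa using (R.along S.T).map_natCast 2
  have h2' : R.V i (2 : A) = 0 := by
    simpa using (R.V i).map_natCast 2
  rw [S.V_L, S.horAlong_y_L, S.hor_L]
  simp only [Derivation.leibniz, map_sub, map_neg, smul_eq_mul, hay, hF, hbi, h2, h2',
    along_base (S.b_mem i), S.V_L, S.der_bi (R.V i), S.V_beta, S.V_r00, S.a_mulVec_T]
  have e1 := two_half (A := A)
  have e2 := S.beta_bi
  have e3 := S.bSq_om
  have e4 := S.alphaSq_P
  have e5 : S.F * S.beta = S.alphaSq := by rw [F]; linear_combination S.alphaSq * e2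
  rw [L, u]
  generalize (S.a *ᵥ R.y) i = ay
  generalize (S.s *ᵥ R.y) i = sy
  generalize (S.r *ᵥ R.y) i = ry
  generalize S.b i = b at *
  -- Replacing α² by F β leaves an identity in independent symbols modulo 2 · ½ = 1, β · (1/β) = 1
  -- and `alphaSq_P`.
  rw [← e5] at e4 ⊢
  generalize S.F = F at *
  generalize S.P = P at *
  generalize S.om = om at *
  generalize S.beta = β at *
  generalize S.bi = bi at *
  generalize S.s0 = s0 at *
  generalize S.r00 = r00 at *
  generalize half A = hf at *
  clear hay hF hbi h2 h2' e3 e5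
  grind

lemma geodesic_equation (i : Fin n) : 2 * ∑ l, R.V l (R.V i S.L) * S.G l
    = ∑ k, R.V i (R.D k S.L) * R.y k - R.D i S.L :=
  R.geodesic_equation_of S.Γ_symm S.V_Γ (S.along_V_L i)

/-- Twice the fundamental tensor, displayed as a multiple of a_ij plus products of the covectors
a_ij yʲ and b_i; the proof that g_ij is invertible uses this form. -/
lemma V_V_L (i j : Fin n) : R.V j (R.V i S.L) = 2 * (2 * S.alphaSq * S.bi ^ 2 * S.a i j
    + 4 * S.bi ^ 2 * (S.a *ᵥ R.y) i * (S.a *ᵥ R.y) j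
    - 4 * S.alphaSq * S.bi ^ 3 * ((S.a *ᵥ R.y) i * S.b j + S.b i * (S.a *ᵥ R.y) j)
    + 3 * S.alphaSq ^ 2 * S.bi ^ 4 * S.b i * S.b j) := by
  have hay : R.V j ((S.a *ᵥ R.y) i) = S.a i j := V_linear (S.a_mem i) j
  have h2 : R.V j (2 : A) = 0 := by
    simpa using (R.V j).map_natCast 2
  rw [S.V_L]
  simp only [Derivation.leibniz, map_sub, smul_eq_mul, hay, h2, V_base (S.b_mem i), S.der_F,
    S.der_bi (R.V j), S.V_beta, S.V_alphaSq]
  rw [F]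
  ring

end KropinaRing

end Kropina

end

/-! ### The Ricci curvature of F when r_ij = c a_ij. -/

noncomputable section

namespace Kropina

open Matrix TangentRing

namespace PairRing

variable {n : ℕ} {A : Type*} [CommRing A] [Algebra ℝ A] {R : TangentRing n A} (S : PairRing R)

/-- Leibniz rule for the contraction of a covector with a vector. -/
lemma D_dot (w u : Fin n → A) (k : Fin n) :
    R.D k (w ⬝ᵥ u) = (fun i => S.cov w i k) ⬝ᵥ u + w ⬝ᵥ fun i => S.covVec u i k := by
  have h : ∑ i, (∑ l, S.Γ l i k * w l) * u i = ∑ i, w i * ∑ l, S.Γ i k l * u l := by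
    simp only [Finset.mul_sum, Finset.sum_mul]
    rw [Finset.sum_comm]
    exact Finset.sum_congr rfl fun i _ => Finset.sum_congr rfl fun j _ => by
      rw [S.Γ_symm i j k]; ring
  rw [der_dot]
  simp only [dotProduct, cov, covVec, sub_mul, mul_add, Finset.sum_sub_distrib,
    Finset.sum_add_distrib, h]
  ring

/-- Lowering an index commutes with covariant differentiation, by metric compatibility `D_a`. -/
lemma cov_lower (u : Fin n → A) (i k : Fin n) :
    S.cov (S.a *ᵥ u) i k = (S.a *ᵥ fun j => S.covVec u j k) i := by
  have h1 : ∑ j, (∑ l, S.a j l * S.Γ l k i) * u j = ∑ l, S.Γ l i k * (S.a *ᵥ u) l := by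
    simp only [mulVec, dotProduct, Finset.mul_sum, Finset.sum_mul]
    rw [Finset.sum_comm]
    exact Finset.sum_congr rfl fun l _ => Finset.sum_congr rfl fun j _ => by
      rw [S.Γ_symm l k i, S.a_symm j l]; ring
  have h2 : ∑ j, (∑ l, S.a i l * S.Γ l k j) * u j
      = ∑ l, S.a i l * ∑ j, S.Γ l k j * u j := by
    simp only [Finset.mul_sum, Finset.sum_mul]
    rw [Finset.sum_comm]
    exact Finset.sum_congr rfl fun l _ => Finset.sum_congr rfl fun j _ => by ring
  have h3 : R.D k ((S.a *ᵥ u) i) = ∑ j, R.D k (S.a i j) * u j + ∑ j, S.a i j * R.D k (u j) := by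
    rw [mulVec, der_dot]
    rfl
  rw [cov, h3]
  simp only [S.D_a, add_mul, Finset.sum_add_distrib]
  rw [h1, h2, mulVec, dotProduct]
  simp only [covVec, mul_add, Finset.sum_add_distrib]
  ring

lemma covVec_bUp (j k : Fin n) :
    S.covVec S.bUp j k = (S.h *ᵥ fun i => S.r i k + S.s i k) j := by
  have h1 : (fun i => S.r i k + S.s i k) = S.a *ᵥ fun j => S.covVec S.bUp j k := by
    funext i
    rw [← S.cov_b, ← S.cov_lower, S.a_mulVec_bUp]
  rw [h1, mulVec_mulVec, S.h_mul_a, one_mulVec]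

lemma hor_s0 (k : Fin n) : R.hor S.Γ k S.s0 = ∑ i, S.cov S.s1 i k * R.y i :=
  S.hor_linear S.s1_mem k

lemma horAlong_y_s0 : R.horAlong S.Γ R.y S.s0 = S.s0_0 := by
  simp only [horAlong_apply, hor_s0, s0_0, Finset.mul_sum]
  rw [Finset.sum_comm]
  exact Finset.sum_congr rfl fun _ _ => Finset.sum_congr rfl fun _ _ => by ring

lemma horAlong_bUp_s0 : R.horAlong S.Γ S.bUp S.s0 = S.b_s0 := by
  simp only [horAlong_apply, hor_s0, b_s0, Finset.mul_sum]
  exact Finset.sum_congr rfl fun _ _ => Finset.sum_congr rfl fun _ _ => by ring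

lemma horAlong_beta (X : Fin n → A) :
    R.horAlong S.Γ X S.beta = X ⬝ᵥ S.r *ᵥ R.y - X ⬝ᵥ S.s *ᵥ R.y := by
  rw [horAlong_apply, ← dotProduct_sub]
  exact Finset.sum_congr rfl fun k _ => by rw [S.hor_beta, Pi.sub_apply]

/-! The case in which `β` is a conformal form: `r_ij = c a_ij`. -/

section Conformal

variable {c : A} (hr : ∀ i j, S.r i j = c * S.a i j)

include hr

lemma r_mulVec (v : Fin n → A) : S.r *ᵥ v = c • (S.a *ᵥ v) := by
  rw [show S.r = c • S.a by ext i j; exact hr i j, smul_mulVec]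

lemma r00_conformal : S.r00 = c * S.alphaSq := by
  rw [r00, S.r_mulVec hr, dotProduct_smul, smul_eq_mul, alphaSq]

/-- The divergence of bⁱ, the gradient of b² and the contractions with b below are all read off from
this formula. -/
lemma covVec_bUp_conformal (j k : Fin n) :
    S.covVec S.bUp j k = (if j = k then c else 0) + S.sMix j k := by
  have h : (S.h *ᵥ fun i => c * S.a i k) j = c * (S.h * S.a) j k := by
    rw [mulVec, dotProduct, Matrix.mul_apply, Finset.mul_sum]
    exact Finset.sum_congr rfl fun _ _ => by ring
  rw [S.covVec_bUp]
  simp only [hr]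
  rw [show (fun i => c * S.a i k + S.s i k) = (fun i => c * S.a i k) + fun i => S.s i k from rfl,
    mulVec_add, Pi.add_apply, h, S.h_mul_a, Matrix.one_apply]
  congr 1
  split_ifs <;> simp

lemma hdiv_bUp : R.hdiv S.Γ S.bUp = n * c := by
  rw [S.hdiv_base S.bUp_mem]
  simp only [S.covVec_bUp_conformal hr, if_true, Finset.sum_add_distrib]
  rw [show ∑ k, S.sMix k k = 0 from S.trace_sMix]
  simp

lemma D_bSq (k : Fin n) : R.D k S.bSq = 2 * (c * S.b k + S.s1 k) := by
  have h1 : ((fun i => c * S.a i k) ⬝ᵥ S.bUp) = c * S.b k := by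
    rw [← S.a_mulVec_bUp, mulVec, dotProduct, dotProduct, Finset.mul_sum]
    exact Finset.sum_congr rfl fun i _ => by rw [S.a_symm i k]; ring
  have h2 : ((fun i => S.s i k) ⬝ᵥ S.bUp) = S.s1 k :=
    Finset.sum_congr rfl fun i _ => mul_comm _ _
  have h3 : (S.b ⬝ᵥ fun i => S.sMix i k) = S.s1 k := by
    have : (fun i => S.sMix i k) = S.h *ᵥ fun i => S.s i k := by
      funext i
      rw [sMix, Matrix.mul_apply]; rfl
    rw [this, dotProduct_mulVec, ← mulVec_transpose, S.h_transpose, dotProduct_comm, ← bUp, h2]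
  have h4 : (S.b ⬝ᵥ fun i => if i = k then c else 0) = c * S.b k := by
    simp [dotProduct, mul_comm]
  rw [bSq, S.D_dot]
  simp only [S.cov_b, hr, S.covVec_bUp_conformal hr]
  change ((fun i => c * S.a i k) + fun i => S.s i k) ⬝ᵥ S.bUp
    + S.b ⬝ᵥ ((fun i => if i = k then c else 0) + fun i => S.sMix i k) = _
  rw [add_dotProduct, dotProduct_add, h1, h2, h3, h4]
  ring

lemma horAlong_bSq (X : Fin n → A) :
    R.horAlong S.Γ X S.bSq = 2 * (c * (S.b ⬝ᵥ X) + S.s1 ⬝ᵥ X) := by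
  simp only [horAlong_apply, hor_base S.bSq_mem, S.D_bSq hr, dotProduct, Finset.mul_sum,
    ← Finset.sum_add_distrib]
  exact Finset.sum_congr rfl fun _ _ => by ring

/-- The contraction with `b` of the mixed terms of the Einstein equation. -/
lemma bUp_contraction : (∑ k, ∑ i, S.bUp k * S.cov S.s1 i k * S.bUp i) = S.sSq ∧
    (∑ k, ∑ i, S.covEndo S.sMix k i k * S.bUp i) = -S.divs - S.trS := by
  constructor
  · have h : ∀ k, ∑ i, S.cov S.s1 i k * S.bUp i
        = -(c * S.s1 k + ∑ i, S.s1 i * S.sMix i k) := by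
      intro k
      have h1 := S.D_dot S.s1 S.bUp k
      rw [S.s1_dot_bUp, map_zero] at h1
      have h2 : (S.s1 ⬝ᵥ fun i => S.covVec S.bUp i k) = c * S.s1 k + ∑ i, S.s1 i * S.sMix i k := by
        simp only [S.covVec_bUp_conformal hr, dotProduct, mul_add, Finset.sum_add_distrib]
        simp [mul_comm]
      rw [← h2]
      exact eq_neg_of_add_eq_zero_left h1.symm
    have h3 : ∑ k, S.bUp k * ∑ i, S.s1 i * S.sMix i k = -S.sSq := by
      have : S.s1 ⬝ᵥ S.sMix *ᵥ S.bUp = -S.sSq := by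
        rw [S.sMix_mulVec_bUp, dotProduct_neg, dotProduct_comm, sSq]
      rw [← this]
      simp only [mulVec, dotProduct, Finset.mul_sum]
      rw [Finset.sum_comm]
      exact Finset.sum_congr rfl fun _ _ => Finset.sum_congr rfl fun _ _ => by ring
    have h4 : ∑ k, S.bUp k * (c * S.s1 k) = 0 := by
      have := S.s1_dot_bUp
      rw [dotProduct] at this
      calc ∑ k, S.bUp k * (c * S.s1 k) = c * ∑ k, S.s1 k * S.bUp k := by
            rw [Finset.mul_sum]
            exact Finset.sum_congr rfl fun _ _ => by ring
        _ = 0 := by rw [this, mul_zero]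
    calc ∑ k, ∑ i, S.bUp k * S.cov S.s1 i k * S.bUp i
        = ∑ k, S.bUp k * ∑ i, S.cov S.s1 i k * S.bUp i := by
          simp only [Finset.mul_sum, mul_assoc]
      _ = S.sSq := by
          simp only [h, mul_neg, mul_add, Finset.sum_neg_distrib, Finset.sum_add_distrib, h3, h4]
          ring
  -- Take the divergence of sᵏ_i bⁱ = -sᵏ. The derivative of bⁱ contributes c sᵏ_k + sᵏ_i sⁱ_k, and
  -- the trace sᵏ_k is zero.
  · have h1 : ∀ k, R.D k ((S.sMix *ᵥ S.bUp) k) = ∑ i, R.D k (S.sMix k i) * S.bUp i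
        + ∑ i, S.sMix k i * R.D k (S.bUp i) := by
      intro k
      rw [mulVec, der_dot]
      rfl
    have h2 : S.divs = -∑ k, R.D k ((S.sMix *ᵥ S.bUp) k)
        - ∑ k, ∑ l, S.Γ k k l * (S.sMix *ᵥ S.bUp) l := by
      simp only [S.sMix_mulVec_bUp, Pi.neg_apply, map_neg, mul_neg, Finset.sum_neg_distrib, divs,
        covVec, Finset.sum_add_distrib]
      ring
    have h3 : ∑ k, ∑ l, S.Γ k k l * (S.sMix *ᵥ S.bUp) l
        = ∑ k, ∑ i, (∑ m, S.Γ k k m * S.sMix m i) * S.bUp i := by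
      refine Finset.sum_congr rfl fun k _ => ?_
      simp only [mulVec, dotProduct, Finset.mul_sum, Finset.sum_mul]
      rw [Finset.sum_comm]
      exact Finset.sum_congr rfl fun _ _ => Finset.sum_congr rfl fun _ _ => by ring
    have h4 : ∀ k, ∑ i, S.sMix k i * R.D k (S.bUp i) = c * S.sMix k k
        + ∑ i, S.sMix k i * S.sMix i k - ∑ i, (∑ m, S.Γ m k i * S.sMix k m) * S.bUp i := by
      intro k
      have h5 : ∀ i, R.D k (S.bUp i) = (if i = k then c else 0) + S.sMix i k
          - ∑ m, S.Γ i k m * S.bUp m := by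
        intro i
        rw [← S.covVec_bUp_conformal hr, covVec]
        ring
      have h6 : ∑ i, S.sMix k i * ∑ m, S.Γ i k m * S.bUp m
          = ∑ i, (∑ m, S.Γ m k i * S.sMix k m) * S.bUp i := by
        simp only [Finset.mul_sum, Finset.sum_mul]
        rw [Finset.sum_comm]
        exact Finset.sum_congr rfl fun _ _ => Finset.sum_congr rfl fun _ _ => by ring
      simp only [h5, mul_add, mul_sub, Finset.sum_add_distrib, Finset.sum_sub_distrib, h6]
      simp [mul_comm]
    have h7 : ∑ k, c * S.sMix k k = 0 := by
      rw [← Finset.mul_sum, show ∑ k, S.sMix k k = 0 from S.trace_sMix, mul_zero]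
    rw [h2, h3]
    simp only [h1, h4, covEndo, add_mul, sub_mul, Finset.sum_add_distrib, Finset.sum_sub_distrib,
      h7, trS]
    ring

end Conformal

end PairRing

namespace KropinaRing

variable {n : ℕ} {A : Type*} [CommRing A] [Algebra ℝ A] {R : TangentRing n A} (S : KropinaRing R)

lemma der_ai (d : Derivation ℝ A A) : d S.ai = - S.ai ^ 2 * d S.alphaSq := by
  have h := congrArg d S.alphaSq_ai
  rw [Derivation.leibniz, smul_eq_mul, smul_eq_mul, Derivation.map_one_eq_zero] at h
  linear_combination S.ai * h - d S.ai * S.alphaSq_ai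

lemma along_y_F : R.along R.y S.F = S.F := by
  rw [S.der_F, S.along_alphaSq, S.along_beta, S.y_dot_ay, S.b_dot_y, F]
  linear_combination -S.alphaSq * S.bi * S.beta_bi

lemma along_y_s0 : R.along R.y S.s0 = S.s0 := by rw [S.along_s0, PairRing.s0]

lemma along_y_r00 : R.along R.y S.r00 = 2 * S.r00 := along_quadratic S.r_mem S.r_symm R.y

lemma along_y_u : R.along R.y S.u = 2 * S.u := by
  rw [u]
  simp only [Derivation.leibniz, map_add, smul_eq_mul, S.along_y_F, S.along_y_s0, S.along_y_r00,
    der_half, along_base S.om_mem]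
  ring

lemma along_y_Q (m : Fin n) : R.along R.y (S.Q m) = 2 * S.Q m := by
  have h : R.along R.y (S.sVec m) = S.sVec m := along_linear (S.sMix_mem m) _
  simp only [Q, Pi.add_apply, Pi.smul_apply, map_add, Derivation.leibniz, smul_eq_mul, h,
    along_base (S.bUp_mem m), S.along_y_u, map_neg, S.along_y_F, der_half]
  ring

lemma along_y_P : R.along R.y S.P = S.P := by
  have h : R.along R.y S.beta = S.beta := by rw [S.along_beta, PairRing.beta]
  rw [P]
  simp only [Derivation.leibniz, map_add, map_neg, smul_eq_mul, S.along_y_s0, S.along_y_r00, h,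
    along_base S.om_mem, S.der_ai, S.along_alphaSq, S.y_dot_ay]
  linear_combination 2 * S.om * S.r00 * S.beta * S.ai * S.alphaSq_ai

lemma ric_G : R.ric S.G = R.ric (R.qspray S.Γ + S.Q)
    + ((n : A) - 1) * (S.P ^ 2 - R.horAlong S.Γ R.y S.P + 2 * R.along S.Q S.P) :=
  R.ric_add_projective S.Γ_symm S.V_Γ S.Q S.P S.along_y_Q S.along_y_P

lemma along_F (X : Fin n → A) :
    R.along X S.F = S.bi * (2 * (X ⬝ᵥ S.a *ᵥ R.y) - S.F * (S.b ⬝ᵥ X)) := by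
  rw [S.der_F, S.along_alphaSq, S.along_beta]

section Conformal

variable {c : A} (hc : c ∈ R.base) (hr : ∀ i j, S.r i j = c * S.a i j)

include hr

lemma horAlong_F (X : Fin n → A) : R.horAlong S.Γ X S.F
    = -(S.bi * S.F * (c * (X ⬝ᵥ S.a *ᵥ R.y) - X ⬝ᵥ S.s *ᵥ R.y)) := by
  rw [S.der_F, S.horAlong_alphaSq, S.horAlong_beta, S.r_mulVec hr, dotProduct_smul, smul_eq_mul]
  ring

/-- The factor α² of r₀₀ cancels the denominator of `P`, so nothing singular along α² = 0 is left.
-/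
lemma P_conformal : S.P = -S.om * (S.s0 + c * S.beta) := by
  rw [P, S.r00_conformal hr]
  linear_combination -S.om * c * S.beta * S.alphaSq_ai

lemma u_conformal : S.u = half A * S.om * (S.F * S.s0 + c * S.alphaSq) := by
  rw [u, S.r00_conformal hr]

include hc

lemma along_u (X : Fin n → A) : R.along X S.u = half A * S.om * (R.along X S.F * S.s0
    + S.F * (S.s1 ⬝ᵥ X) + 2 * c * (X ⬝ᵥ S.a *ᵥ R.y)) := by
  rw [S.u_conformal hr]
  simp only [Derivation.leibniz, map_add, smul_eq_mul, der_half, along_base S.om_mem,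
    along_base hc, S.along_s0, S.along_alphaSq]
  ring

/-- The trace terms of `ric_add` for `Q` thus become ∇₀P - 2Q(P) and cancel one of the n - 1 copies
in the projective term. This is the origin of the factor n - 2. -/
lemma vtrace_Q : R.vtrace S.Q = -S.P := by
  rw [Q, vtrace_add, vtrace_smul, vtrace_smul, S.vtrace_sVec, S.vtrace_bUp, map_neg,
    Derivation.leibniz, der_half, S.along_u hc hr, S.along_F, S.along_F, S.sVec_dot_ay,
    S.b_dot_sVec, S.bUp_dot_ay, S.b_dot_bUp, S.s1_dot_bUp, S.P_conformal hr]
  simp only [smul_eq_mul]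
  linear_combination (S.om * c * S.beta + S.om * S.s0) * two_half (A := A)
    + 2 * half A * S.om * S.s0 * S.beta_bi - half A * S.bi * S.F * S.s0 * S.bSq_om

omit hc in
lemma hdiv_Q : 2 * R.hdiv S.Γ S.Q = -(S.bi * S.F * (S.sVec ⬝ᵥ S.s *ᵥ R.y)) - S.F * S.divS0
    - 2 * S.om * c * (S.F * S.s0 + c * S.alphaSq)
    + S.om * (S.F * S.b_s0 - S.bi * S.F * (c * S.beta - S.s0) * S.s0
      + R.horAlong S.Γ S.bUp c * S.alphaSq)
    + S.om * (n * c) * (S.F * S.s0 + c * S.alphaSq) := by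
  rw [Q, hdiv_add, hdiv_smul, hdiv_smul, S.hdiv_sVec, S.hdiv_bUp hr, S.u_conformal hr]
  simp only [Derivation.leibniz, map_add, map_neg, smul_eq_mul, der_half, S.horAlong_F hr,
    S.horAlong_bUp_s0, S.der_om, S.horAlong_bSq hr, S.horAlong_alphaSq, S.sVec_dot_ay,
    S.bUp_dot_ay, S.bUp_dot_sy, S.b_dot_bUp, S.s1_dot_bUp]
  have e1 := two_half (A := A)
  have e3 := S.bSq_om
  grind

/-- The summands ¼ F² sⁱ_j sʲ_i and ½ F² sᵏs_k/b² are the source of the Einstein scalar. The term in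
`sVec` and `s` cancels against the same one in `hdiv_Q`. -/
lemma vpair_Q : R.vpair S.Q S.Q = half A * half A * S.F ^ 2 * S.trS
    + (half A * S.bi * S.F * S.s0) ^ 2
    + (S.om * S.s0 + S.om * c * S.beta - half A * S.bi * S.F * S.s0) ^ 2
    - S.bi * S.F * (S.sVec ⬝ᵥ S.s *ᵥ R.y) - half A * S.bi * S.F ^ 2 * S.s0s
    + S.F * S.om * (S.bi * S.s0 ^ 2 + half A * S.F * S.sSq + c * S.s0)
    - half A * (2 - S.bi * S.F * S.bSq) * S.om * (S.F * S.s0s - S.bi * S.F * S.s0 ^ 2) := by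
  have h1 : (S.sMix *ᵥ S.sVec) ⬝ᵥ S.a *ᵥ R.y = -(S.sVec ⬝ᵥ S.s *ᵥ R.y) := by
    rw [S.dot_a_symm, S.a_mulVec_sMix, S.dot_s_antisymm]
  have h2 : S.b ⬝ᵥ (S.sMix *ᵥ S.sVec) = S.s0s := by
    rw [S.b_dot, S.a_mulVec_sMix, ← S.s1_dot, dotProduct_comm, PairRing.s0s]
  have h3 : S.s1 ⬝ᵥ S.sVec = S.s0s := dotProduct_comm _ _
  have h4 : S.s1 ⬝ᵥ S.s1Up = S.sSq := dotProduct_comm _ _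
  rw [Q, vpair_add_left, vpair_add_right, vpair_add_right, R.vpair_comm (S.u • S.bUp) (_ • _)]
  simp only [vpair_smul_smul, S.alongVec_sVec, S.alongVec_bUp, S.vpair_sVec_sVec,
    S.vpair_bUp_right, S.along_u hc hr, S.sMix_mulVec_bUp, neg_dotProduct, dotProduct_neg,
    zero_dotProduct, dotProduct_zero, map_neg, Derivation.leibniz,
    der_half, S.along_F, S.sVec_dot_ay, S.bUp_dot_ay, S.s1Up_dot_ay, S.b_dot_sVec, S.b_dot_s1Up,
    S.b_dot_bUp, S.s1_dot_bUp, h1, h2, h3, h4, smul_eq_mul]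
  have e1 := two_half (A := A)
  have e2 := S.beta_bi
  have e3 := S.bSq_om
  grind

/-- The Ricci curvature of a Kropina metric with conformal `β`. -/
lemma ric_G_conformal :
    S.bSq ^ 2 * (R.ric S.G + (half A * S.om * S.sSq + half A * half A * S.trS) * S.F ^ 2)
    = R.ric (R.qspray S.Γ) * S.bSq ^ 2
      + (n - 2) * (S.bSq * S.s0_0 + S.bSq * R.horAlong S.Γ R.y c * S.beta
        - (S.s0 + c * S.beta) ^ 2)
      + S.alphaSq * ((n - 2) * S.bSq * c ^ 2 + S.bSq * R.horAlong S.Γ S.bUp c)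
      + S.F * ((n - 3) * S.bSq * c * S.s0 + S.bSq * S.b_s0 - S.bSq ^ 2 * S.divS0
        + (n - 1) * S.bSq * S.s0s) := by
  have h1 : R.along S.Q S.P = half A * S.om * (S.F * S.s0s - c ^ 2 * S.alphaSq) := by
    have h : S.s1 ⬝ᵥ S.sVec = S.s0s := dotProduct_comm _ _
    rw [S.P_conformal hr]
    simp only [Derivation.leibniz, map_add, map_neg, smul_eq_mul, along_base S.om_mem,
      along_base hc, S.along_s0, S.along_beta, S.b_dot_Q, S.r00_conformal hr]
    rw [Q, dotProduct_add, dotProduct_smul, dotProduct_smul, S.s1_dot_bUp, h]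
    simp only [smul_eq_mul]
    ring
  have h2 : R.horAlong S.Γ R.y S.P = 2 * S.om ^ 2 * (c * S.beta + S.s0) ^ 2
      - S.om * (S.s0_0 + R.horAlong S.Γ R.y c * S.beta + c ^ 2 * S.alphaSq) := by
    rw [S.P_conformal hr]
    simp only [Derivation.leibniz, map_add, map_neg, smul_eq_mul, S.der_om, S.horAlong_bSq hr,
      S.b_dot_y, S.horAlong_y_s0, S.horAlong_y_beta, S.r00_conformal hr]
    rw [← PairRing.s0]
    ring
  have h3 := S.hdiv_Q hr
  have h4 := S.vpair_Q hc hr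
  have e2 := S.beta_bi
  have e3 := S.bSq_om
  -- With α² eliminated, the claim is a polynomial identity modulo the relations for ½, 1/β and 1/b²
  -- alone.
  have e4 : S.alphaSq = S.F * S.beta := by rw [F]; linear_combination -S.alphaSq * e2
  have e1 := two_half (A := A)
  rw [S.ric_G, R.ric_add S.Γ_symm S.V_Γ, S.vtrace_Q hc hr, h3, h4]
  simp only [map_neg, h1, h2]
  rw [S.P_conformal hr, e4]
  generalize R.ric (R.qspray S.Γ) = w0
  generalize R.horAlong S.Γ R.y c = w1
  generalize R.horAlong S.Γ S.bUp c = w2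
  generalize S.sVec ⬝ᵥ S.s *ᵥ R.y = w3
  generalize S.F = F at *
  generalize S.om = om at *
  generalize S.beta = β at *
  generalize S.bi = bi at *
  generalize S.bSq = bb at *
  generalize S.s0 = s0 at *
  generalize S.trS = w4
  generalize S.sSq = w5
  generalize S.s0s = w6
  generalize S.s0_0 = w7
  generalize S.b_s0 = w8
  generalize S.divS0 = w9
  generalize half A = hf at *
  generalize (n : A) = N
  clear h1 h2 h3 h4 e4 hr hc
  grind

end Conformal

end KropinaRing

end Kropina

end

/-! ### The polar part of the Ricci curvature along α² = 0. -/

noncomputable section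

namespace Kropina

open Matrix TangentRing

namespace KropinaRing

variable {n : ℕ} {A : Type*} [CommRing A] [Algebra ℝ A] {R : TangentRing n A} (S : KropinaRing R)

/-- The elements that are polynomial in the fibre coordinates and in `1/β`. -/
def regular : Subalgebra ℝ A :=
  Algebra.adjoin ℝ ((R.base : Set A) ∪ Set.range R.y ∪ {S.bi})

lemma base_le_regular {f : A} (hf : f ∈ R.base) : f ∈ S.regular :=
  Algebra.subset_adjoin (Or.inl (Or.inl hf))

lemma y_mem_regular (i : Fin n) : R.y i ∈ S.regular :=
  Algebra.subset_adjoin (Or.inl (Or.inr ⟨i, rfl⟩))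

lemma bi_mem_regular : S.bi ∈ S.regular := Algebra.subset_adjoin (Or.inr rfl)

lemma regular_of_linear {w : Fin n → A} (hw : ∀ i, w i ∈ R.base) : w ⬝ᵥ R.y ∈ S.regular :=
  sum_mem fun i _ => mul_mem (S.base_le_regular (hw i)) (S.y_mem_regular i)

lemma regular_of_quadratic {q : Matrix (Fin n) (Fin n) A} (hq : ∀ i j, q i j ∈ R.base) :
    R.y ⬝ᵥ q *ᵥ R.y ∈ S.regular :=
  sum_mem fun i _ => mul_mem (S.y_mem_regular i) (S.regular_of_linear (hq i))

/-- Only the generator 1/β needs an argument: its derivative is -(1/β)² dβ, again a polynomial in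
the generators. -/
lemma der_regular (d : Derivation ℝ A A) (h1 : ∀ f ∈ R.base, d f ∈ S.regular)
    (h2 : ∀ i, d (R.y i) ∈ S.regular) {f : A} (hf : f ∈ S.regular) : d f ∈ S.regular := by
  induction hf using Algebra.adjoin_induction with
  | mem x hx =>
    rcases hx with (hx | ⟨i, rfl⟩) | hx
    · exact h1 x hx
    · exact h2 i
    · rw [Set.mem_singleton_iff.1 hx, S.der_bi]
      refine mul_mem (neg_mem (pow_mem S.bi_mem_regular 2)) ?_
      rw [PairRing.beta, der_dot]
      exact add_mem (sum_mem fun i _ => mul_mem (h1 _ (S.b_mem i)) (S.y_mem_regular i))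
        (sum_mem fun i _ => mul_mem (S.base_le_regular (S.b_mem i)) (h2 i))
  | algebraMap c => simp
  | add x y hx hy hx' hy' => rw [map_add]; exact add_mem hx' hy'
  | mul x y hx hy hx' hy' =>
    rw [Derivation.leibniz, smul_eq_mul, smul_eq_mul]
    exact add_mem (mul_mem hx hy') (mul_mem hy hx')

lemma V_regular (k : Fin n) {f : A} (hf : f ∈ S.regular) : R.V k f ∈ S.regular :=
  S.der_regular _ (fun f hf => by rw [V_base hf]; exact zero_mem _)
    (fun i => by rw [R.V_y]; split_ifs; exacts [one_mem _, zero_mem _]) hf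

lemma D_regular (k : Fin n) {f : A} (hf : f ∈ S.regular) : R.D k f ∈ S.regular :=
  S.der_regular _ (fun f hf => S.base_le_regular (D_mem_base hf k))
    (fun i => by rw [R.D_y]; exact zero_mem _) hf

lemma two_mem_regular : (2 : A) ∈ S.regular := by
  rw [← one_add_one_eq_two]
  exact add_mem (one_mem _) (one_mem _)

lemma ric_regular {G : Fin n → A} (hG : ∀ i, G i ∈ S.regular) : R.ric G ∈ S.regular := by
  refine sum_mem fun m _ => sub_mem (add_mem (sub_mem (mul_mem S.two_mem_regular ?_)
    (sum_mem fun j _ => ?_)) (mul_mem S.two_mem_regular (sum_mem fun j _ => ?_)))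
    (sum_mem fun j _ => ?_)
  · exact S.D_regular _ (hG m)
  · exact mul_mem (S.V_regular _ (S.D_regular _ (hG m))) (S.y_mem_regular j)
  · exact mul_mem (hG j) (S.V_regular _ (S.V_regular _ (hG m)))
  · exact mul_mem (S.V_regular _ (hG m)) (S.V_regular _ (hG j))

lemma along_regular {T : Fin n → A} (hT : ∀ i, T i ∈ S.regular) {f : A} (hf : f ∈ S.regular) :
    R.along T f ∈ S.regular := by
  rw [along_apply]
  exact sum_mem fun j _ => mul_mem (hT j) (S.V_regular j hf)

lemma qspray_regular (m : Fin n) : R.qspray S.Γ m ∈ S.regular :=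
  mul_mem (S.base_le_regular half_mem_base) (sum_mem fun i _ => sum_mem fun j _ =>
    mul_mem (mul_mem (S.base_le_regular (S.Γ_mem _ _ _)) (S.y_mem_regular i)) (S.y_mem_regular j))

lemma horAlong_y_regular {f : A} (hf : f ∈ S.regular) :
    R.horAlong S.Γ R.y f ∈ S.regular := by
  rw [horAlong_y]
  exact sub_mem (sum_mem fun j _ => mul_mem (S.y_mem_regular j) (S.D_regular j hf))
    (mul_mem S.two_mem_regular (S.along_regular S.qspray_regular hf))

lemma alphaSq_regular : S.alphaSq ∈ S.regular := S.regular_of_quadratic S.a_mem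

lemma F_regular : S.F ∈ S.regular := mul_mem S.alphaSq_regular S.bi_mem_regular

lemma s0_regular : S.s0 ∈ S.regular := S.regular_of_linear S.s1_mem

lemma r00_regular : S.r00 ∈ S.regular := S.regular_of_quadratic S.r_mem

lemma half_regular : half A ∈ S.regular := S.base_le_regular half_mem_base

lemma om_regular : S.om ∈ S.regular := S.base_le_regular S.om_mem

lemma u_regular : S.u ∈ S.regular :=
  mul_mem (mul_mem S.half_regular S.om_regular)
    (add_mem (mul_mem S.F_regular S.s0_regular) S.r00_regular)

lemma Q_regular (m : Fin n) : S.Q m ∈ S.regular :=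
  add_mem (mul_mem (neg_mem (mul_mem S.half_regular S.F_regular))
    (S.regular_of_linear (S.sMix_mem m)))
    (mul_mem S.u_regular (S.base_le_regular (S.bUp_mem m)))

/-- The product `F P`. -/
def FP : A := -S.om * (S.F * S.s0 + S.r00)

/-- The factor α² of F cancels the denominator of `P`, so the product is regular. -/
lemma FP_eq : S.FP = S.F * S.P := by
  rw [FP, F, P]
  linear_combination -S.om * S.r00 * (-S.bi * S.beta * S.alphaSq_ai - S.beta_bi)

lemma FP_regular : S.FP ∈ S.regular :=
  mul_mem (neg_mem S.om_regular) (add_mem (mul_mem S.F_regular S.s0_regular) S.r00_regular)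

/-- The polar part of the Ricci curvature along `α² = 0`. -/
lemma exists_ric_G_polar : ∃ q ∈ S.regular,
    S.F ^ 2 * R.ric S.G = 3 * (n - 1) * (S.om * S.r00) ^ 2 + S.F * q := by
  -- With this d the projective term is (n-1)(P² - dP), and F²(P² - dP) = (FP)² - F d(FP) + (FP) dF.
  -- Modulo F times regular elements, FP is -r₀₀/b² and dF is -2 r₀₀/b², which gives (1 +
  -- 2)(r₀₀/b²)².
  let d : Derivation ℝ A A := R.horAlong S.Γ R.y - (2 : A) • R.along S.Q
  have hd : ∀ f, d f = R.horAlong S.Γ R.y f - 2 * R.along S.Q f := fun f => by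
    simp only [d, Derivation.sub_apply, Derivation.smul_apply, smul_eq_mul]
  have hreg : ∀ f ∈ S.regular, d f ∈ S.regular := fun f hf => by
    rw [hd]
    exact sub_mem (S.horAlong_y_regular hf)
      (mul_mem S.two_mem_regular (S.along_regular S.Q_regular hf))
  have hdF : d S.F = -2 * (S.om * S.r00) - S.F * (2 * S.om * S.s0) := by
    rw [hd, S.along_Q_F, S.der_F, S.horAlong_alphaSq, S.horAlong_y_beta, u]
    linear_combination S.bi * S.F * S.r00 * two_half (A := A)
      - 2 * S.bi * S.beta * S.om * (S.F * S.s0 + S.r00) * two_half (A := A)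
      - 2 * S.om * (S.F * S.s0 + S.r00) * S.beta_bi
  have hdFP : d S.FP = S.F * d S.P + S.P * d S.F := by
    rw [S.FP_eq, Derivation.leibniz, smul_eq_mul, smul_eq_mul]
  have hN : ((n : A) - 1) ∈ S.regular := sub_mem (by
    rw [← map_natCast (algebraMap ℝ A)]
    exact Subalgebra.algebraMap_mem _ _) (one_mem _)
  have hos : S.om * S.s0 ∈ S.regular := mul_mem S.om_regular S.s0_regular
  have hor : S.om * S.r00 ∈ S.regular := mul_mem S.om_regular S.r00_regular
  have h2 := S.two_mem_regular
  have h3 : (3 : A) ∈ S.regular := by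
    rw [← two_add_one_eq_three]
    exact add_mem h2 (one_mem _)
  refine ⟨S.F * R.ric (R.qspray S.Γ + S.Q) + (n - 1) * (3 * S.F * (S.om * S.s0) ^ 2
    + 3 * (2 * (S.om * S.s0) * (S.om * S.r00)) - d S.FP), ?_, ?_⟩
  · exact add_mem (mul_mem S.F_regular (S.ric_regular fun m =>
      add_mem (S.qspray_regular m) (S.Q_regular m))) (mul_mem hN (sub_mem (add_mem
      (mul_mem (mul_mem h3 S.F_regular) (pow_mem hos 2)) (mul_mem h3 (mul_mem (mul_mem h2 hos) hor)))
      (hreg _ S.FP_regular)))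
  · have hdP : R.horAlong S.Γ R.y S.P = d S.P + 2 * R.along S.Q S.P := by
      rw [hd]; ring
    have hfp := S.FP_eq
    rw [FP] at hfp
    rw [S.ric_G, hdP, hdFP, hdF]
    linear_combination (-(n - 1) * (S.F * S.P - 3 * (S.F * (S.om * S.s0) + S.om * S.r00))) * hfp

end KropinaRing

end Kropina

end

/-! ### The spray and the Ricci tensor of the Riemannian metric. -/

noncomputable section

namespace Kropina

open Matrix TangentRing

namespace PairRing

variable {n : ℕ} {A : Type*} [CommRing A] [Algebra ℝ A] {R : TangentRing n A} (S : PairRing R)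

/-- The criterion `geodesic_equation_of` with T = 0; both of its sides vanish because α² is
horizontally constant. -/
lemma alphaSq_geodesic (i : Fin n) :
    2 * ∑ l, R.V l (R.V i S.alphaSq) * R.qspray S.Γ l
    = ∑ k, R.V i (R.D k S.alphaSq) * R.y k - R.D i S.alphaSq := by
  have h := R.geodesic_equation_of S.Γ_symm S.V_Γ (T := 0) (L := S.alphaSq) (i := i) (by
    simp [along_zero, horAlong_apply, S.hor_alphaSq])
  rwa [add_zero] at h

lemma V_V_alphaSq (i j : Fin n) : R.V j (R.V i S.alphaSq) = 2 * S.a i j := by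
  have hay : R.V j ((S.a *ᵥ R.y) i) = S.a i j := V_linear (S.a_mem i) j
  rw [S.V_alphaSq, two_mul, two_mul, map_add, hay]

/-- The Ricci tensor of the metric. -/
def ricMat (i j : Fin n) : A :=
  ∑ m, R.D m (S.Γ m i j) - ∑ m, R.D j (S.Γ m m i) + ∑ l, ∑ m, S.Γ l i j * S.Γ m l m
    - ∑ l, ∑ m, S.Γ m l i * S.Γ l m j

/-- As an explicit quadratic form, the Ricci curvature is visibly continuous and even in y, and its
value does not depend on the open set underlying the ring. -/
lemma ric_qspray : R.ric (R.qspray S.Γ) = ∑ i, ∑ j, S.ricMat i j * R.y i * R.y j := by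
  have h1 : 2 * ∑ m, R.D m (R.qspray S.Γ m)
      = ∑ i, ∑ j, (∑ m, R.D m (S.Γ m i j)) * R.y i * R.y j := by
    have h2 : ∀ m, 2 * R.D m (R.qspray S.Γ m) = ∑ i, ∑ j, R.D m (S.Γ m i j) * R.y i * R.y j := by
      intro m
      rw [qspray, Derivation.leibniz, der_half, smul_zero, add_zero, smul_eq_mul, ← mul_assoc,
        two_half, one_mul]
      simp only [map_sum, Derivation.leibniz, R.D_y, smul_eq_mul]
      exact Finset.sum_congr rfl fun _ _ => Finset.sum_congr rfl fun _ _ => by ring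
    rw [Finset.mul_sum, Finset.sum_congr rfl fun m _ => h2 m, Finset.sum_comm]
    refine Finset.sum_congr rfl fun i _ => ?_
    rw [Finset.sum_comm]
    exact Finset.sum_congr rfl fun j _ => by simp only [Finset.sum_mul]
  have h2 : ∑ j, R.y j * R.D j (R.vtrace (R.qspray S.Γ))
      = ∑ i, ∑ j, (∑ m, R.D j (S.Γ m m i)) * R.y i * R.y j := by
    rw [Finset.sum_comm]
    refine Finset.sum_congr rfl fun j _ => ?_
    simp only [vtrace, R.V_qspray S.Γ_symm S.V_Γ, conn, map_sum, Derivation.leibniz, R.D_y,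
      smul_eq_mul, Finset.mul_sum, Finset.sum_mul]
    rw [Finset.sum_comm]
    exact Finset.sum_congr rfl fun i _ => Finset.sum_congr rfl fun m _ => by ring
  have h3 : 2 * R.along (R.qspray S.Γ) (R.vtrace (R.qspray S.Γ))
      = ∑ i, ∑ j, (∑ l, ∑ m, S.Γ l i j * S.Γ m l m) * R.y i * R.y j := by
    have h4 : ∀ l, 2 * (R.qspray S.Γ l * ∑ m, S.Γ m l m)
        = ∑ i, ∑ j, (∑ m, S.Γ l i j * S.Γ m l m) * R.y i * R.y j := by
      intro l
      rw [qspray, ← mul_assoc, ← mul_assoc, two_half, one_mul]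
      simp only [Finset.sum_mul, ← Finset.mul_sum]
      exact Finset.sum_congr rfl fun _ _ => Finset.sum_congr rfl fun _ _ => by ring
    rw [along_apply, Finset.mul_sum, Finset.sum_congr rfl fun l _ => by
      rw [R.V_vtrace_qspray S.Γ_symm S.V_Γ, h4], Finset.sum_comm]
    refine Finset.sum_congr rfl fun i _ => ?_
    rw [Finset.sum_comm]
    exact Finset.sum_congr rfl fun j _ => by simp only [Finset.sum_mul]
  have h5 : R.vpair (R.qspray S.Γ) (R.qspray S.Γ)
      = ∑ i, ∑ j, (∑ l, ∑ m, S.Γ m l i * S.Γ l m j) * R.y i * R.y j := by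
    have h6 : ∀ l m, R.conn S.Γ m l * R.conn S.Γ l m
        = ∑ i, ∑ j, S.Γ m l i * S.Γ l m j * R.y i * R.y j := by
      intro l m
      rw [conn, conn, Finset.sum_mul_sum]
      exact Finset.sum_congr rfl fun _ _ => Finset.sum_congr rfl fun _ _ => by ring
    simp only [vpair, R.V_qspray S.Γ_symm S.V_Γ, h6]
    have h7 : ∀ l, ∑ m, ∑ i, ∑ j, S.Γ m l i * S.Γ l m j * R.y i * R.y j
        = ∑ i, ∑ j, (∑ m, S.Γ m l i * S.Γ l m j) * R.y i * R.y j := by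
      intro l
      rw [Finset.sum_comm]
      refine Finset.sum_congr rfl fun i _ => ?_
      rw [Finset.sum_comm]
      exact Finset.sum_congr rfl fun j _ => by simp only [Finset.sum_mul]
    simp only [h7]
    rw [Finset.sum_comm]
    refine Finset.sum_congr rfl fun i _ => ?_
    rw [Finset.sum_comm]
    exact Finset.sum_congr rfl fun j _ => by simp only [Finset.sum_mul]
  rw [ric_eq, h1, h2, h3, h5]
  simp only [ricMat, add_mul, sub_mul, Finset.sum_add_distrib, Finset.sum_sub_distrib]

end PairRing

/-! ### Functions on open sets of the coordinate tangent bundle -/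

section Concrete

variable {n : ℕ} {Ω : Set (Coord n × Coord n)} (hΩ : IsOpen Ω)

/-- The smooth functions on an open set of the coordinate tangent bundle. -/
def tangentRing : TangentRing n (smoothAlg Ω) where
  D k := dirDeriv hΩ (EuclideanSpace.single k 1, 0)
  V k := dirDeriv hΩ (0, EuclideanSpace.single k 1)
  y k := smoothMk (fun w => w.2 k)
    ((EuclideanSpace.proj (𝕜 := ℝ) k).contDiff.comp contDiff_snd).contDiffOn
  V_V _ _ f := dirDeriv_comm hΩ _ _ f
  V_D _ _ f := dirDeriv_comm hΩ _ _ f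
  V_y i j := by
    refine smoothAlg_ext fun w => ?_
    rw [evalAt_dirDeriv hΩ _ _ (fun w => w.2 j) (fun _ => rfl)]
    change fderiv ℝ ((EuclideanSpace.proj (𝕜 := ℝ) j).comp (ContinuousLinearMap.snd ℝ (Coord n)
      (Coord n))) w.1 _ = _
    rw [ContinuousLinearMap.fderiv]
    split_ifs with hij
    · subst hij
      simp
    · simp [Ne.symm hij]
  D_y i j := by
    refine smoothAlg_ext fun w => ?_
    rw [evalAt_dirDeriv hΩ _ _ (fun w => w.2 j) (fun _ => rfl)]
    change fderiv ℝ ((EuclideanSpace.proj (𝕜 := ℝ) j).comp (ContinuousLinearMap.snd ℝ (Coord n)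
      (Coord n))) w.1 _ = _
    rw [ContinuousLinearMap.fderiv]
    simp

@[simp] lemma evalAt_y (w : Ω) (k : Fin n) : evalAt w ((tangentRing hΩ).y k) = w.1.2 k := rfl

/-- The function `H(x, y)` represents the element `f` of the algebra of smooth functions. -/
def Rep (H : Coord n → Coord n → ℝ) (f : smoothAlg Ω) : Prop :=
  ∀ w : Ω, H w.1.1 w.1.2 = evalAt w f

variable {hΩ} {H : Coord n → Coord n → ℝ} {f : smoothAlg Ω}

lemma Rep.dx (h : Rep H f) (k : Fin n) : Rep (dx k H) ((tangentRing hΩ).D k f) := by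
  intro w
  have hd := (smoothAlg_differentiableAt_of_rep hΩ f (fun w => H w.1 w.2) h w).hasFDerivAt
  have he : HasFDerivAt (fun z : Coord n => (z, w.1.2)) (ContinuousLinearMap.inl ℝ (Coord n) (Coord n)) w.1.1 :=
    hasFDerivAt_prodMk_left w.1.1 w.1.2
  have hc : HasFDerivAt (fun z => H z w.1.2) _ w.1.1 := HasFDerivAt.comp (g := fun w : Coord n × Coord n => H w.1 w.2) w.1.1
    (show HasFDerivAt _ _ (w.1.1, w.1.2) from hd) he
  rw [show evalAt w ((tangentRing hΩ).D k f) = _ from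
    evalAt_dirDeriv hΩ _ f (fun w => H w.1 w.2) h w, Kropina.dx, pd, hc.fderiv]
  simp

lemma Rep.dy (h : Rep H f) (k : Fin n) : Rep (dy k H) ((tangentRing hΩ).V k f) := by
  intro w
  have hd := (smoothAlg_differentiableAt_of_rep hΩ f (fun w => H w.1 w.2) h w).hasFDerivAt
  have he : HasFDerivAt (fun z : Coord n => (w.1.1, z)) (ContinuousLinearMap.inr ℝ (Coord n) (Coord n)) w.1.2 :=
    hasFDerivAt_prodMk_right w.1.1 w.1.2
  have hc : HasFDerivAt (H w.1.1) _ w.1.2 := HasFDerivAt.comp (g := fun w : Coord n × Coord n => H w.1 w.2) w.1.2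
    (show HasFDerivAt _ _ (w.1.1, w.1.2) from hd) he
  rw [show evalAt w ((tangentRing hΩ).V k f) = _ from
    evalAt_dirDeriv hΩ _ f (fun w => H w.1 w.2) h w, Kropina.dy, pd, hc.fderiv]
  simp

lemma Rep.pd {g : Coord n → ℝ} (h : Rep (fun z _ => g z) f) (k : Fin n) :
    Rep (fun z _ => pd k g z) ((tangentRing hΩ).D k f) := h.dx k

lemma Rep.mem_base {g : Coord n → ℝ} (h : Rep (fun z _ => g z) f) :
    f ∈ (tangentRing hΩ).base := by
  intro k
  refine smoothAlg_ext fun w => ?_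
  rw [← (h.dy (hΩ := hΩ) k) w, Kropina.dy, Kropina.pd]
  simp

/-- A spray is determined by the geodesic equation. -/
lemma Rep.geodesicCoeff {F : Coord n → Coord n → ℝ} {L : smoothAlg Ω}
    {G : Fin n → smoothAlg Ω} (hL : Rep (fun x y => F x y ^ 2) L)
    (hdet : ∀ w : Ω, IsUnit (fundTensor F w.1.1 w.1.2).det)
    (hG : ∀ i, 2 * ∑ l, (tangentRing hΩ).V l ((tangentRing hΩ).V i L) * G l
      = ∑ k, (tangentRing hΩ).V i ((tangentRing hΩ).D k L) * (tangentRing hΩ).y k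
        - (tangentRing hΩ).D i L) (i : Fin n) : Rep (geodesicCoeff F i) (G i) := by
  intro w
  let rhs : Fin n → ℝ := fun l =>
    (∑ k, Kropina.dy l (Kropina.dx k fun x y => F x y ^ 2) w.1.1 w.1.2 * w.1.2 k)
      - Kropina.dx l (fun x y => F x y ^ 2) w.1.1 w.1.2
  -- Since g_il is half the vertical Hessian of F², the geodesic equation says that g applied to 4G
  -- is the right side.
  have h1 : fundTensor F w.1.1 w.1.2 *ᵥ (fun l => 4 * evalAt w (G l)) = rhs := by
    funext i
    have h2 := congrArg (evalAt w) (hG i)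
    simp only [map_mul, map_sum, map_sub, map_ofNat, evalAt_y] at h2
    simp only [rhs]
    rw [((hL.dx (hΩ := hΩ) i)) w]
    rw [Finset.sum_congr rfl fun k _ => by rw [((hL.dx (hΩ := hΩ) k).dy (hΩ := hΩ) i) w], ← h2,
      mulVec, dotProduct, Finset.mul_sum]
    refine Finset.sum_congr rfl fun l _ => ?_
    rw [fundTensor, Matrix.of_apply, ((hL.dy (hΩ := hΩ) i).dy (hΩ := hΩ) l) w]
    ring
  have h2 : (fundTensor F w.1.1 w.1.2)⁻¹ *ᵥ rhs = fun l => 4 * evalAt w (G l) := by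
    rw [← h1, mulVec_mulVec, Matrix.nonsing_inv_mul _ (hdet w), one_mulVec]
  have h3 : Kropina.geodesicCoeff F i w.1.1 w.1.2
      = 1 / 4 * ((fundTensor F w.1.1 w.1.2)⁻¹ *ᵥ rhs) i := rfl
  rw [h3, h2]
  ring

lemma Rep.ricci {F : Coord n → Coord n → ℝ} {G : Fin n → smoothAlg Ω}
    (hG : ∀ i, Rep (Kropina.geodesicCoeff F i) (G i)) :
    Rep (ricci F) ((tangentRing hΩ).ric G) := by
  intro w
  simp only [Kropina.ricci, riemann, ric, map_sum, map_sub, map_add, map_mul, map_ofNat]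
  refine Finset.sum_congr rfl fun m _ => ?_
  refine congrArg₂ (· - ·) (congrArg₂ (· + ·) (congrArg₂ (· - ·) ?_ (Finset.sum_congr rfl fun k _ => ?_))
    (congrArg (2 * ·) (Finset.sum_congr rfl fun k _ => ?_))) (Finset.sum_congr rfl fun k _ => ?_)
  · rw [((hG m).dx (hΩ := hΩ) m) w]
  · rw [(((hG m).dx (hΩ := hΩ) k).dy (hΩ := hΩ) m) w]
    rfl
  · rw [(((hG m).dy (hΩ := hΩ) k).dy (hΩ := hΩ) m) w, hG k w]
  · rw [((hG m).dy (hΩ := hΩ) k) w, ((hG k).dy (hΩ := hΩ) m) w]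

end Concrete

end Kropina

end

/-! ### Coordinate data as ring elements, and their values at points. -/

noncomputable section

namespace Kropina

open Matrix TangentRing

namespace LocalPair

variable {n : ℕ} (S : LocalPair n)

/-- `α²` in coordinates. -/
def alphaSq (x y : Coord n) : ℝ := ∑ i, y i * ∑ j, S.a x i j * y j

/-- `β` in coordinates. -/
def beta (x y : Coord n) : ℝ := ∑ i, S.b x i * y i

/-- The Kropina metric in coordinates. -/
def kropina (x y : Coord n) : ℝ := S.alphaSq x y / S.beta x y

/-- The Ricci tensor of the metric. -/
def ricMat (x : Coord n) (i j : Fin n) : ℝ :=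
  ∑ m, pd m (S.christoffel m i j) x - ∑ m, pd j (S.christoffel m m i) x
    + ∑ l, ∑ m, S.christoffel l i j x * S.christoffel m l m x
    - ∑ l, ∑ m, S.christoffel m l i x * S.christoffel l m j x

/-- The Ricci curvature of the metric as a quadratic form. -/
def ricQuad (x y : Coord n) : ℝ := ∑ i, ∑ j, S.ricMat x i j * y i * y j

/-- Smoothness and non-degeneracy of the metric and the one-form on an open set. -/
structure Regular (U : Set (Coord n)) : Prop where
  isOpen : IsOpen U
  a_smooth : ∀ i j, ContDiffOn ℝ ∞ (fun z => S.a z i j) U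
  b_smooth : ∀ i, ContDiffOn ℝ ∞ (fun z => S.b z i) U
  posDef : ∀ z ∈ U, (S.a z).PosDef
  b_ne : ∀ z ∈ U, S.b z ≠ 0

variable {S} {U : Set (Coord n)} (hS : S.Regular U) {Ω : Set (Coord n × Coord n)}
  (hΩ : IsOpen Ω) (hU : ∀ w ∈ Ω, w.1 ∈ U)

include hU in
lemma contDiffOn_comp_fst {f : Coord n → ℝ} (hf : ContDiffOn ℝ ∞ f U) :
    ContDiffOn ℝ ∞ (fun w : Coord n × Coord n => f w.1) Ω :=
  hf.comp contDiff_fst.contDiffOn fun w hw => hU w hw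

namespace Regular

include hS hU in
-- The determinant is a smooth function without zeros, hence a unit of the algebra.
lemma exists_inverse : ∃ h : Matrix (Fin n) (Fin n) (smoothAlg Ω),
    h * Matrix.of (fun i j => smoothMk (fun w => S.a w.1 i j)
      (contDiffOn_comp_fst hU (hS.a_smooth i j))) = 1 := by
  set a : Matrix (Fin n) (Fin n) (smoothAlg Ω) := Matrix.of fun i j =>
    smoothMk (fun w => S.a w.1 i j) (contDiffOn_comp_fst hU (hS.a_smooth i j)) with ha
  obtain ⟨g, hg⟩ := smoothAlg_exists_inv a.det (by
    intro w
    rw [RingHom.map_det]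
    exact (hS.posDef w.1.1 (hU w w.2)).det_pos.ne')
  exact ⟨a⁻¹, Matrix.nonsing_inv_mul _ (IsUnit.of_mul_eq_one g hg)⟩

/-- The metric and the one-form as elements of the algebra of smooth functions. -/
def pairRing : PairRing (tangentRing hΩ) where
  a := Matrix.of fun i j => smoothMk (fun w => S.a w.1 i j)
    (contDiffOn_comp_fst hU (hS.a_smooth i j))
  h := (hS.exists_inverse hU).choose
  b i := smoothMk (fun w => S.b w.1 i) (contDiffOn_comp_fst hU (hS.b_smooth i))
  a_symm i j := smoothAlg_ext fun w => by
    simpa using ((hS.posDef w.1.1 (hU w w.2)).1.apply i j).symm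
  h_mul_a := (hS.exists_inverse hU).choose_spec
  a_mem i j := Rep.mem_base (g := fun z => S.a z i j) fun _ => rfl
  b_mem i := Rep.mem_base (g := fun z => S.b z i) fun _ => rfl

section Eval

variable (w : Ω)

lemma eval_a (i j : Fin n) : evalAt w ((hS.pairRing hΩ hU).a i j) = S.a w.1.1 i j := rfl

lemma eval_b (i : Fin n) : evalAt w ((hS.pairRing hΩ hU).b i) = S.b w.1.1 i := rfl

/-- `h` comes from a choice; uniqueness of left inverses identifies its values. -/
lemma eval_h (i j : Fin n) : evalAt w ((hS.pairRing hΩ hU).h i j) = S.aInv w.1.1 i j := by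
  have h1 : (evalAt w).mapMatrix (hS.pairRing hΩ hU).h * S.a w.1.1 = 1 := by
    have := congrArg (evalAt w).mapMatrix (hS.pairRing hΩ hU).h_mul_a
    rwa [map_mul, map_one] at this
  have h2 := Matrix.inv_eq_left_inv h1
  rw [aInv, h2]
  rfl

lemma eval_half : evalAt w (half (smoothAlg Ω)) = 1 / 2 := rfl

lemma eval_D (g : Coord n → ℝ) {f : smoothAlg Ω} (h : ∀ w : Ω, evalAt w f = g w.1.1)
    (k : Fin n) : evalAt w ((tangentRing hΩ).D k f) = pd k g w.1.1 :=
  (Rep.pd (hΩ := hΩ) (g := g) (fun w => (h w).symm) k w).symm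

lemma eval_Γ (k i j : Fin n) :
    evalAt w ((hS.pairRing hΩ hU).Γ k i j) = S.christoffel k i j w.1.1 := by
  simp only [PairRing.Γ, map_mul, map_sum, map_sub, map_add, hS.eval_h hΩ hU, eval_half]
  have hD : ∀ i j k, evalAt w ((tangentRing hΩ).D k ((hS.pairRing hΩ hU).a i j))
      = pd k (fun z => S.a z i j) w.1.1 := fun i j k =>
    eval_D hΩ w (fun z => S.a z i j) (fun w => hS.eval_a hΩ hU w i j) k
  simp only [hD]
  rfl

lemma eval_cov {W : Coord n → Fin n → ℝ} {f : Fin n → smoothAlg Ω}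
    (h : ∀ (w : Ω) i, evalAt w (f i) = W w.1.1 i) (i j : Fin n) :
    evalAt w ((hS.pairRing hΩ hU).cov f i j) = S.covCovector W i j w.1.1 := by
  simp only [PairRing.cov, map_sub, map_sum, map_mul, hS.eval_Γ hΩ hU, h,
    eval_D hΩ w (fun z => W z i) fun w => h w i]
  rfl

lemma eval_covVec {W : Coord n → Fin n → ℝ} {f : Fin n → smoothAlg Ω}
    (h : ∀ (w : Ω) i, evalAt w (f i) = W w.1.1 i) (i j : Fin n) :
    evalAt w ((hS.pairRing hΩ hU).covVec f i j) = S.covVector W i j w.1.1 := by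
  simp only [PairRing.covVec, map_add, map_sum, map_mul, hS.eval_Γ hΩ hU, h,
    eval_D hΩ w (fun z => W z i) fun w => h w i]
  rfl

lemma eval_covEndo {W : Coord n → Fin n → Fin n → ℝ} {f : Fin n → Fin n → smoothAlg Ω}
    (h : ∀ (w : Ω) i j, evalAt w (f i j) = W w.1.1 i j) (i j k : Fin n) :
    evalAt w ((hS.pairRing hΩ hU).covEndo f i j k) = S.covEndo W i j k w.1.1 := by
  simp only [PairRing.covEndo, map_add, map_sub, map_sum, map_mul, hS.eval_Γ hΩ hU, h,
    eval_D hΩ w (fun z => W z i j) fun w => h w i j]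
  rfl

lemma eval_r (i j : Fin n) : evalAt w ((hS.pairRing hΩ hU).r i j) = S.r w.1.1 i j := by
  simp only [PairRing.r, Matrix.of_apply, map_mul, map_add, eval_half,
    hS.eval_cov hΩ hU w fun w i => hS.eval_b hΩ hU w i]
  rfl

lemma eval_s (i j : Fin n) : evalAt w ((hS.pairRing hΩ hU).s i j) = S.s w.1.1 i j := by
  simp only [PairRing.s, Matrix.of_apply, map_mul, map_sub, eval_half,
    hS.eval_cov hΩ hU w fun w i => hS.eval_b hΩ hU w i]
  rfl

lemma eval_bUp (i : Fin n) : evalAt w ((hS.pairRing hΩ hU).bUp i) = S.bUp w.1.1 i := by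
  simp only [PairRing.bUp, mulVec, dotProduct, map_sum, map_mul, hS.eval_h hΩ hU,
    hS.eval_b hΩ hU]
  rfl

lemma eval_bSq : evalAt w (hS.pairRing hΩ hU).bSq = S.bSq w.1.1 := by
  simp only [PairRing.bSq, dotProduct, map_sum, map_mul, hS.eval_bUp hΩ hU, hS.eval_b hΩ hU]
  rfl

lemma eval_sMix (i j : Fin n) :
    evalAt w ((hS.pairRing hΩ hU).sMix i j) = S.sMix w.1.1 i j := by
  simp only [PairRing.sMix, Matrix.mul_apply, map_sum, map_mul, hS.eval_h hΩ hU,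
    hS.eval_s hΩ hU]
  rfl

lemma eval_s1 (j : Fin n) : evalAt w ((hS.pairRing hΩ hU).s1 j) = S.s1 w.1.1 j := by
  simp only [PairRing.s1, map_sum, map_mul, hS.eval_bUp hΩ hU, hS.eval_s hΩ hU]
  rfl

lemma eval_s1Up (i : Fin n) : evalAt w ((hS.pairRing hΩ hU).s1Up i) = S.s1Up w.1.1 i := by
  simp only [PairRing.s1Up, mulVec, dotProduct, map_sum, map_mul, hS.eval_h hΩ hU,
    hS.eval_s1 hΩ hU]
  rfl

lemma eval_alphaSq : evalAt w (hS.pairRing hΩ hU).alphaSq = S.alphaSq w.1.1 w.1.2 := by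
  simp only [PairRing.alphaSq, mulVec, dotProduct, map_sum, map_mul, hS.eval_a hΩ hU, evalAt_y]
  rfl

lemma eval_beta : evalAt w (hS.pairRing hΩ hU).beta = S.beta w.1.1 w.1.2 := by
  simp only [PairRing.beta, dotProduct, map_sum, map_mul, hS.eval_b hΩ hU, evalAt_y]
  rfl

lemma eval_r00 : evalAt w (hS.pairRing hΩ hU).r00 = S.r00 w.1.1 w.1.2 := by
  simp only [PairRing.r00, mulVec, dotProduct, map_sum, map_mul, hS.eval_r hΩ hU, evalAt_y,
    LocalPair.r00, Finset.mul_sum]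
  exact Finset.sum_congr rfl fun _ _ => Finset.sum_congr rfl fun _ _ => by ring

lemma eval_s0 : evalAt w (hS.pairRing hΩ hU).s0 = S.s0 w.1.1 w.1.2 := by
  simp only [PairRing.s0, dotProduct, map_sum, map_mul, hS.eval_s1 hΩ hU, evalAt_y]
  rfl

lemma eval_s0s : evalAt w (hS.pairRing hΩ hU).s0s = S.s0s w.1.1 w.1.2 := by
  simp only [PairRing.s0s, PairRing.sVec, mulVec, dotProduct, map_sum, map_mul,
    hS.eval_s1 hΩ hU, hS.eval_sMix hΩ hU, evalAt_y, Finset.sum_mul]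
  rfl

lemma eval_sSq : evalAt w (hS.pairRing hΩ hU).sSq = S.sSq w.1.1 := by
  simp only [PairRing.sSq, dotProduct, map_sum, map_mul, hS.eval_s1 hΩ hU, hS.eval_s1Up hΩ hU]
  rfl

lemma eval_trS : evalAt w (hS.pairRing hΩ hU).trS = S.trS w.1.1 := by
  simp only [PairRing.trS, map_sum, map_mul, hS.eval_sMix hΩ hU]
  rfl

lemma eval_divS0 : evalAt w (hS.pairRing hΩ hU).divS0 = S.divS0 w.1.1 w.1.2 := by
  simp only [PairRing.divS0, map_sum, map_mul, evalAt_y,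
    hS.eval_covEndo hΩ hU w fun w i j => hS.eval_sMix hΩ hU w i j]
  rfl

lemma eval_s0_0 : evalAt w (hS.pairRing hΩ hU).s0_0 = S.s0_0 w.1.1 w.1.2 := by
  simp only [PairRing.s0_0, map_sum, map_mul, evalAt_y,
    hS.eval_cov hΩ hU w fun w i => hS.eval_s1 hΩ hU w i]
  rfl

lemma eval_b_s0 : evalAt w (hS.pairRing hΩ hU).b_s0 = S.b_s0 w.1.1 w.1.2 := by
  simp only [PairRing.b_s0, map_sum, map_mul, evalAt_y, hS.eval_bUp hΩ hU,
    hS.eval_cov hΩ hU w fun w i => hS.eval_s1 hΩ hU w i]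
  rfl

lemma eval_divs : evalAt w (hS.pairRing hΩ hU).divs = S.divs w.1.1 := by
  simp only [PairRing.divs, map_sum, hS.eval_covVec hΩ hU w fun w i => hS.eval_s1Up hΩ hU w i]
  rfl

lemma eval_ric_qspray : evalAt w ((tangentRing hΩ).ric ((tangentRing hΩ).qspray
    (hS.pairRing hΩ hU).Γ)) = S.ricQuad w.1.1 w.1.2 := by
  have hD : ∀ i j k l, evalAt w ((tangentRing hΩ).D l ((hS.pairRing hΩ hU).Γ k i j))
      = pd l (S.christoffel k i j) w.1.1 := fun i j k l =>
    eval_D hΩ w (S.christoffel k i j) (fun w => hS.eval_Γ hΩ hU w k i j) l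
  simp only [PairRing.ric_qspray, PairRing.ricMat, map_sum, map_mul, map_add, map_sub, evalAt_y,
    hS.eval_Γ hΩ hU, hD]
  rfl

end Eval

/-! Positivity. -/

lemma alphaSq_eq_dot (x y : Coord n) : S.alphaSq x y = y.ofLp ⬝ᵥ S.a x *ᵥ y.ofLp := rfl

include hS

lemma alphaSq_pos {x y : Coord n} (hx : x ∈ U) (hy : y ≠ 0) : 0 < S.alphaSq x y := by
  have h := (hS.posDef x hx).dotProduct_mulVec_pos (x := y.ofLp) (by
    intro h
    exact hy (by ext i; exact congrFun h i))
  simpa [alphaSq_eq_dot] using h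

lemma a_mul_aInv {x : Coord n} (hx : x ∈ U) : S.a x * S.aInv x = 1 :=
  Matrix.mul_nonsing_inv _ (hS.posDef x hx).det_pos.ne'.isUnit

lemma a_mulVec_bUp {x : Coord n} (hx : x ∈ U) : S.a x *ᵥ S.bUp x = S.b x := by
  rw [show S.bUp x = S.aInv x *ᵥ S.b x from rfl, mulVec_mulVec, hS.a_mul_aInv hx, one_mulVec]

lemma bUp_ne_zero {x : Coord n} (hx : x ∈ U) : S.bUp x ≠ 0 := by
  intro h
  apply hS.b_ne x hx
  rw [← hS.a_mulVec_bUp hx, h, mulVec_zero]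

lemma alphaSq_bUp {x : Coord n} (hx : x ∈ U) :
    S.alphaSq x (WithLp.toLp 2 (S.bUp x)) = S.bSq x := by
  rw [alphaSq_eq_dot]
  change S.bUp x ⬝ᵥ S.a x *ᵥ S.bUp x = _
  rw [hS.a_mulVec_bUp hx, dotProduct_comm]
  rfl

lemma bSq_pos {x : Coord n} (hx : x ∈ U) : 0 < S.bSq x := by
  rw [← hS.alphaSq_bUp hx]
  refine hS.alphaSq_pos hx fun h => hS.bUp_ne_zero hx ?_
  have := congrArg WithLp.ofLp h
  simpa using this

end Regular

end LocalPair

end Kropina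

end

/-! ### Non-degeneracy of F, and its Ricci curvature in coordinates. -/

noncomputable section

namespace Kropina

open Matrix TangentRing

namespace LocalPair

variable {n : ℕ} {S : LocalPair n}

lemma dot_rank_two_mulVec (a : Matrix (Fin n) (Fin n) ℝ) (l b v : Fin n → ℝ) (A B C E : ℝ) :
    v ⬝ᵥ (Matrix.of fun i j => A * a i j + B * l i * l j - C * (l i * b j + b i * l j)
      + E * b i * b j) *ᵥ v
    = A * (v ⬝ᵥ a *ᵥ v) + B * (l ⬝ᵥ v) ^ 2 - 2 * C * (l ⬝ᵥ v) * (b ⬝ᵥ v) + E * (b ⬝ᵥ v) ^ 2 := by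
  have h : (Matrix.of fun i j => A * a i j + B * l i * l j - C * (l i * b j + b i * l j)
      + E * b i * b j) *ᵥ v = A • (a *ᵥ v) + (B * (l ⬝ᵥ v)) • l
      - C • ((b ⬝ᵥ v) • l + (l ⬝ᵥ v) • b) + (E * (b ⬝ᵥ v)) • b := by
    funext i
    simp only [mulVec, dotProduct, Matrix.of_apply, Pi.add_apply, Pi.sub_apply, Pi.smul_apply,
      smul_eq_mul, Finset.mul_sum, Finset.sum_mul, ← Finset.sum_add_distrib,
      ← Finset.sum_sub_distrib]
    exact Finset.sum_congr rfl fun _ _ => by ring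
  rw [h]
  simp only [dotProduct_add, dotProduct_sub, dotProduct_smul, smul_eq_mul, dotProduct_comm v l,
    dotProduct_comm v b]
  ring

lemma isUnit_det_of_quadratic {g : Matrix (Fin n) (Fin n) ℝ}
    (h : ∀ v, v ⬝ᵥ g *ᵥ v = 0 → v = 0) : IsUnit g.det := by
  rw [isUnit_iff_ne_zero]
  intro h0
  obtain ⟨v, hv, hgv⟩ := Matrix.exists_mulVec_eq_zero_iff.2 h0
  exact hv (h v (by rw [hgv, dotProduct_zero]))

lemma cauchy_schwarz {a : Matrix (Fin n) (Fin n) ℝ} (ha : a.PosDef) (y v : Fin n → ℝ) :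
    ((a *ᵥ y) ⬝ᵥ v) ^ 2 ≤ (y ⬝ᵥ a *ᵥ y) * (v ⬝ᵥ a *ᵥ v) := by
  have hs : aᵀ = a := by simpa using ha.1.eq
  have hsym : ∀ u v : Fin n → ℝ, u ⬝ᵥ a *ᵥ v = v ⬝ᵥ a *ᵥ u := fun u v => by
    rw [dotProduct_mulVec, ← mulVec_transpose, hs, dotProduct_comm]
  have hnn : ∀ u : Fin n → ℝ, 0 ≤ u ⬝ᵥ a *ᵥ u := fun u => by
    simpa using ha.posSemidef.dotProduct_mulVec_nonneg u
  rcases eq_or_ne y 0 with rfl | hy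
  · simp
  have hpos : 0 < y ⬝ᵥ a *ᵥ y := by simpa using ha.dotProduct_mulVec_pos hy
  -- The value of the form at this vector is (y ⬝ a y) times the difference of the two sides of the
  -- claim.
  have h := hnn ((y ⬝ᵥ a *ᵥ y) • v - ((a *ᵥ y) ⬝ᵥ v) • y)
  simp only [mulVec_sub, mulVec_smul, dotProduct_sub, sub_dotProduct, dotProduct_smul,
    smul_dotProduct, smul_eq_mul] at h
  rw [hsym y v, dotProduct_comm v (a *ᵥ y)] at h
  nlinarith

variable {U : Set (Coord n)} (hS : S.Regular U)

namespace Regular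

section Ring

variable {Ω : Set (Coord n × Coord n)} (hΩ : IsOpen Ω) (hU : ∀ w ∈ Ω, w.1 ∈ U)
  (hβ : ∀ w ∈ Ω, 0 < S.beta w.1 w.2)

include hS hU hβ in
lemma alphaSq_pos_of_beta_pos (w : Ω) : 0 < S.alphaSq w.1.1 w.1.2 := by
  refine hS.alphaSq_pos (hU w w.2) fun h => ?_
  have := hβ w w.2
  rw [beta, h] at this
  simp at this

include hS hU in
lemma eval_bSq_ne (w : Ω) : evalAt w (hS.pairRing hΩ hU).bSq ≠ 0 := by
  rw [hS.eval_bSq hΩ hU]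
  exact (hS.bSq_pos (hU w w.2)).ne'

include hS hU hβ in
lemma eval_beta_ne (w : Ω) : evalAt w (hS.pairRing hΩ hU).beta ≠ 0 := by
  rw [hS.eval_beta hΩ hU]
  exact (hβ w w.2).ne'

include hS hU hβ in
lemma eval_alphaSq_ne (w : Ω) : evalAt w (hS.pairRing hΩ hU).alphaSq ≠ 0 := by
  rw [hS.eval_alphaSq hΩ hU]
  exact (hS.alphaSq_pos_of_beta_pos hU hβ w).ne'

/-- The Kropina metric as an element of the algebra of smooth functions. -/
def kropinaRing : KropinaRing (tangentRing hΩ) where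
  toPairRing := hS.pairRing hΩ hU
  om := (smoothAlg_exists_inv _ (hS.eval_bSq_ne hΩ hU)).choose
  bi := (smoothAlg_exists_inv _ (hS.eval_beta_ne hΩ hU hβ)).choose
  ai := (smoothAlg_exists_inv _ (hS.eval_alphaSq_ne hΩ hU hβ)).choose
  bSq_om := (smoothAlg_exists_inv _ (hS.eval_bSq_ne hΩ hU)).choose_spec
  beta_bi := (smoothAlg_exists_inv _ (hS.eval_beta_ne hΩ hU hβ)).choose_spec
  alphaSq_ai := (smoothAlg_exists_inv _ (hS.eval_alphaSq_ne hΩ hU hβ)).choose_spec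

lemma kropinaRing_toPairRing :
    (hS.kropinaRing hΩ hU hβ).toPairRing = hS.pairRing hΩ hU := rfl

variable (w : Ω)

lemma eval_om : evalAt w (hS.kropinaRing hΩ hU hβ).om = (S.bSq w.1.1)⁻¹ := by
  have h := congrArg (evalAt w) (hS.kropinaRing hΩ hU hβ).bSq_om
  rw [map_mul, map_one, kropinaRing_toPairRing, hS.eval_bSq hΩ hU] at h
  exact eq_inv_of_mul_eq_one_right h

lemma eval_bi : evalAt w (hS.kropinaRing hΩ hU hβ).bi = (S.beta w.1.1 w.1.2)⁻¹ := by
  have h := congrArg (evalAt w) (hS.kropinaRing hΩ hU hβ).beta_bi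
  rw [map_mul, map_one, kropinaRing_toPairRing, hS.eval_beta hΩ hU] at h
  exact eq_inv_of_mul_eq_one_right h

lemma eval_F : evalAt w (hS.kropinaRing hΩ hU hβ).F = S.kropina w.1.1 w.1.2 := by
  rw [KropinaRing.F, map_mul, kropinaRing_toPairRing, hS.eval_alphaSq hΩ hU, hS.eval_bi, kropina,
    div_eq_mul_inv]

lemma rep_L : Rep (fun x y => S.kropina x y ^ 2) (hS.kropinaRing hΩ hU hβ).L := fun w => by
  rw [KropinaRing.L, map_pow, hS.eval_F]

lemma eval_ay (i : Fin n) :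
    evalAt w (((hS.pairRing hΩ hU).a *ᵥ (tangentRing hΩ).y) i) = (S.a w.1.1 *ᵥ w.1.2.ofLp) i := by
  simp only [mulVec, dotProduct, map_sum, map_mul, hS.eval_a hΩ hU, evalAt_y]

include hS hΩ hU hβ in
-- With p = (a y) ⬝ v, e = v ⬝ a v and z = α² β(v)/β(y), the form g(v, v) is β⁻² times 2α²e + 4p² -
-- 8pz + 3z², that is, 2α²e - (4/3)p² + (1/3)(3z - 4p)². By Cauchy–Schwarz p² ≤ α²e, so this is
-- positive for v ≠ 0.
lemma isUnit_det_kropina : IsUnit (fundTensor S.kropina w.1.1 w.1.2).det := by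
  have hx := hU w w.2
  have hb := hβ w w.2
  have ha := hS.alphaSq_pos_of_beta_pos hU hβ w
  set bi := (S.beta w.1.1 w.1.2)⁻¹ with hbi
  set al := S.alphaSq w.1.1 w.1.2 with hal
  have hbi0 : 0 < bi := inv_pos.2 hb
  have hg : fundTensor S.kropina w.1.1 w.1.2 = Matrix.of fun i j =>
      (2 * al * bi ^ 2) * S.a w.1.1 i j
      + (4 * bi ^ 2) * (S.a w.1.1 *ᵥ w.1.2.ofLp) i * (S.a w.1.1 *ᵥ w.1.2.ofLp) j
      - (4 * al * bi ^ 3) * ((S.a w.1.1 *ᵥ w.1.2.ofLp) i * S.b w.1.1 j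
        + S.b w.1.1 i * (S.a w.1.1 *ᵥ w.1.2.ofLp) j)
      + (3 * al ^ 2 * bi ^ 4) * S.b w.1.1 i * S.b w.1.1 j := by
    ext i j
    rw [fundTensor, Matrix.of_apply, (((hS.rep_L hΩ hU hβ).dy (hΩ := hΩ) i).dy (hΩ := hΩ) j) w,
      KropinaRing.V_V_L]
    simp only [map_mul, map_add, map_sub, map_pow, map_ofNat, hS.eval_bi, kropinaRing_toPairRing,
      hS.eval_ay, hS.eval_alphaSq hΩ hU, hS.eval_b hΩ hU, hS.eval_a hΩ hU, Matrix.of_apply]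
    ring
  rw [hg]
  refine isUnit_det_of_quadratic fun v hv => ?_
  rw [dot_rank_two_mulVec] at hv
  have hcs := cauchy_schwarz (hS.posDef _ hx) w.1.2.ofLp v
  rw [← alphaSq_eq_dot, ← hal] at hcs
  by_contra hv0
  have hpos : 0 < v ⬝ᵥ S.a w.1.1 *ᵥ v := by
    simpa using (hS.posDef _ hx).dotProduct_mulVec_pos hv0
  set p := (S.a w.1.1 *ᵥ w.1.2.ofLp) ⬝ᵥ v
  set q := S.b w.1.1 ⬝ᵥ v
  set e := v ⬝ᵥ S.a w.1.1 *ᵥ v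
  have h1 : 0 < al * e - p ^ 2 ∨ p ≠ 0 := by
    rcases eq_or_ne p 0 with h | h
    · left; rw [h]; have := mul_pos ha hpos; linarith
    · right; exact h
  have h2 : 2 * (al * e) + 4 * p ^ 2 - 8 * p * (al * bi * q) + 3 * (al * bi * q) ^ 2 = 0 := by
    have h3 : bi ^ 2 * (2 * (al * e) + 4 * p ^ 2 - 8 * p * (al * bi * q)
        + 3 * (al * bi * q) ^ 2) = 0 := by
      rw [← hv]; ring
    exact (mul_eq_zero.1 h3).resolve_left (by positivity)
  rcases h1 with h1 | h1
  · nlinarith [sq_nonneg (3 * (al * bi * q) - 4 * p), sq_nonneg p]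
  · have : 0 < p ^ 2 := by positivity
    nlinarith [sq_nonneg (3 * (al * bi * q) - 4 * p)]

lemma rep_ricci_kropina :
    Rep (ricci S.kropina) ((tangentRing hΩ).ric (hS.kropinaRing hΩ hU hβ).G) :=
  Rep.ricci fun i => Rep.geodesicCoeff (hS.rep_L hΩ hU hβ)
    (fun w => hS.isUnit_det_kropina hΩ hU hβ w)
    (fun i => (hS.kropinaRing hΩ hU hβ).geodesic_equation i) i

end Ring

section Points

include hS

lemma isOpen_beta_pos : IsOpen {w : Coord n × Coord n | w.1 ∈ U ∧ 0 < S.beta w.1 w.2} := by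
  have h1 : ContinuousOn (fun w : Coord n × Coord n => S.beta w.1 w.2) (U ×ˢ Set.univ) := by
    unfold beta
    refine continuousOn_finsetSum _ fun i _ => ContinuousOn.mul ?_ ?_
    · exact (hS.b_smooth i).continuousOn.comp continuousOn_fst fun w hw => hw.1
    · exact ((EuclideanSpace.proj (𝕜 := ℝ) i).continuous.comp continuous_snd).continuousOn
  have h2 := h1.isOpen_inter_preimage (hS.isOpen.prod isOpen_univ) (isOpen_Ioi (a := (0 : ℝ)))
  convert h2 using 1
  ext w
  simp

/-- The Ricci curvature of the Riemannian metric. -/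
lemma ricci_alpha {x : Coord n} (hx : x ∈ U) (y : Coord n) :
    ricci (fun x y => √(S.alphaSq x y)) x y = S.ricQuad x y := by
  -- The zero section may be included: only the square of √(α²) enters, and it is smooth there.
  let Ω : Set (Coord n × Coord n) := U ×ˢ Set.univ
  have hΩ : IsOpen Ω := hS.isOpen.prod isOpen_univ
  have hU : ∀ w ∈ Ω, w.1 ∈ U := fun w hw => hw.1
  have hrep : Rep (fun x y => √(S.alphaSq x y) ^ 2) (hS.pairRing hΩ hU).alphaSq := fun w => by
    rw [hS.eval_alphaSq hΩ hU]
    refine Real.sq_sqrt ?_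
    rcases eq_or_ne w.1.2 0 with h | h
    · simp [h, alphaSq]
    · exact (hS.alphaSq_pos (hU w w.2) h).le
  have hdet : ∀ w : Ω, IsUnit (fundTensor (fun x y => √(S.alphaSq x y)) w.1.1 w.1.2).det := by
    intro w
    have hg : fundTensor (fun x y => √(S.alphaSq x y)) w.1.1 w.1.2 = S.a w.1.1 := by
      ext i j
      rw [fundTensor, Matrix.of_apply, ((hrep.dy (hΩ := hΩ) i).dy (hΩ := hΩ) j) w,
        PairRing.V_V_alphaSq, map_mul, map_ofNat, hS.eval_a hΩ hU]
      ring
    rw [hg]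
    exact (hS.posDef _ (hU w w.2)).det_pos.ne'.isUnit
  have h := Rep.ricci (hΩ := hΩ) fun i => Rep.geodesicCoeff hrep hdet
    (hS.pairRing hΩ hU).alphaSq_geodesic i
  rw [h ⟨(x, y), hx, trivial⟩, hS.eval_ric_qspray hΩ hU]

/-- The Ricci curvature of a Kropina metric with conformal `β`. -/
lemma ricci_kropina {c : Coord n → ℝ} (hc : ContDiffOn ℝ ∞ c U)
    (hr : ∀ z ∈ U, ∀ i j, S.r z i j = c z * S.a z i j) {x y : Coord n} (hx : x ∈ U)
    (hy : 0 < S.beta x y) :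
    S.bSq x ^ 2 * (ricci S.kropina x y
      - (-(1 / (2 * S.bSq x)) * S.sSq x - (1 / 4) * S.trS x) * S.kropina x y ^ 2)
    = S.ricQuad x y * S.bSq x ^ 2
      + (n - 2) * (S.bSq x * S.s0_0 x y + S.bSq x * dc0 c x y * S.beta x y
        - (S.s0 x y + c x * S.beta x y) ^ 2)
      + S.alphaSq x y * ((n - 2) * S.bSq x * c x ^ 2 + S.bSq x * S.b_dc c x)
      + S.kropina x y * ((n - 3) * S.bSq x * c x * S.s0 x y + S.bSq x * S.b_s0 x y
        - S.bSq x ^ 2 * S.divS0 x y + (n - 1) * S.bSq x * S.s0s x y) := by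
  let Ω : Set (Coord n × Coord n) := {w | w.1 ∈ U ∧ 0 < S.beta w.1 w.2}
  have hΩ : IsOpen Ω := hS.isOpen_beta_pos
  have hU : ∀ w ∈ Ω, w.1 ∈ U := fun w hw => hw.1
  have hβ : ∀ w ∈ Ω, 0 < S.beta w.1 w.2 := fun w hw => hw.2
  let w : Ω := ⟨(x, y), hx, hy⟩
  let C : smoothAlg Ω := smoothMk (fun w => c w.1) (contDiffOn_comp_fst hU hc)
  have hC : ∀ w : Ω, evalAt w C = c w.1.1 := fun _ => rfl
  have hCb : C ∈ (tangentRing hΩ).base := Rep.mem_base (g := c) fun _ => rfl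
  have hrC : ∀ i j, (hS.kropinaRing hΩ hU hβ).r i j = C * (hS.kropinaRing hΩ hU hβ).a i j := by
    intro i j
    refine smoothAlg_ext fun w => ?_
    rw [kropinaRing_toPairRing, hS.eval_r hΩ hU, map_mul, hS.eval_a hΩ hU, hC]
    exact hr _ (hU w w.2) i j
  have h := congrArg (evalAt w) ((hS.kropinaRing hΩ hU hβ).ric_G_conformal hCb hrC)
  have hD : ∀ k, evalAt w ((tangentRing hΩ).D k C) = pd k c x := fun k =>
    eval_D hΩ w c hC k
  have h1 : evalAt w ((tangentRing hΩ).horAlong (hS.pairRing hΩ hU).Γ (tangentRing hΩ).y C)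
      = dc0 c x y := by
    simp only [horAlong_apply, hor_base hCb, map_sum, map_mul, hD, evalAt_y, dc0]
    exact Finset.sum_congr rfl fun _ _ => mul_comm _ _
  have h2 : evalAt w ((tangentRing hΩ).horAlong (hS.pairRing hΩ hU).Γ
      (hS.pairRing hΩ hU).bUp C) = S.b_dc c x := by
    simp only [horAlong_apply, hor_base hCb, map_sum, map_mul, hD, hS.eval_bUp hΩ hU, b_dc]
    rfl
  have h3 : evalAt w ((tangentRing hΩ).ric (hS.kropinaRing hΩ hU hβ).G)
      = ricci S.kropina x y := (hS.rep_ricci_kropina hΩ hU hβ w).symm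
  simp only [map_mul, map_add, map_sub, map_pow, map_ofNat, map_natCast, map_one, h3,
    kropinaRing_toPairRing, hS.eval_bSq hΩ hU, hS.eval_om, hS.eval_sSq hΩ hU, hS.eval_trS hΩ hU,
    hS.eval_F, hS.eval_ric_qspray hΩ hU, hS.eval_s0_0 hΩ hU, hS.eval_beta hΩ hU,
    hS.eval_s0 hΩ hU, hS.eval_alphaSq hΩ hU, hS.eval_b_s0 hΩ hU, hS.eval_divS0 hΩ hU,
    hS.eval_s0s hΩ hU, h1, h2, hC, eval_half] at h
  refine Eq.trans ?_ h
  have hb := (hS.bSq_pos hx).ne'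
  change _ = S.bSq x ^ 2 * (ricci S.kropina x y + (1 / 2 * (S.bSq x)⁻¹ * S.sSq x
    + 1 / 2 * (1 / 2) * S.trS x) * S.kropina x y ^ 2)
  field_simp
  ring

/-- The contraction with `b` of the mixed terms of the Einstein equation. -/
lemma contraction {c : Coord n → ℝ} (hc : ContDiffOn ℝ ∞ c U)
    (hr : ∀ z ∈ U, ∀ i j, S.r z i j = c z * S.a z i j) {x : Coord n} (hx : x ∈ U) :
    S.b_s0 x (WithLp.toLp 2 (S.bUp x)) = S.sSq x ∧
    S.divS0 x (WithLp.toLp 2 (S.bUp x)) = -S.divs x - S.trS x ∧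
    S.s0 x (WithLp.toLp 2 (S.bUp x)) = 0 ∧
    S.s0s x (WithLp.toLp 2 (S.bUp x)) = -S.sSq x ∧
    S.beta x (WithLp.toLp 2 (S.bUp x)) = S.bSq x := by
  let Ω : Set (Coord n × Coord n) := U ×ˢ Set.univ
  have hΩ : IsOpen Ω := hS.isOpen.prod isOpen_univ
  have hU : ∀ w ∈ Ω, w.1 ∈ U := fun w hw => hw.1
  -- The identities concern functions of the position alone, so the fibre coordinate 0 is an
  -- arbitrary choice.
  let w : Ω := ⟨(x, 0), hx, trivial⟩
  let C : smoothAlg Ω := smoothMk (fun w => c w.1) (contDiffOn_comp_fst hU hc)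
  have hrC : ∀ i j, (hS.pairRing hΩ hU).r i j = C * (hS.pairRing hΩ hU).a i j := by
    intro i j
    refine smoothAlg_ext fun w => ?_
    rw [hS.eval_r hΩ hU, map_mul, hS.eval_a hΩ hU]
    exact hr _ (hU w w.2) i j
  obtain ⟨h1, h2⟩ := (hS.pairRing hΩ hU).bUp_contraction hrC
  have h3 := congrArg (evalAt w) (hS.pairRing hΩ hU).s1_dot_bUp
  have h4 : evalAt w (∑ k, ((hS.pairRing hΩ hU).sMix *ᵥ (hS.pairRing hΩ hU).bUp) k
      * (hS.pairRing hΩ hU).s1 k) = evalAt w (-(hS.pairRing hΩ hU).sSq) := by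
    rw [PairRing.sMix_mulVec_bUp, PairRing.sSq, ← neg_dotProduct]
    rfl
  replace h1 := congrArg (evalAt w) h1
  replace h2 := congrArg (evalAt w) h2
  simp only [map_sum, map_mul, map_sub, map_neg, mulVec, dotProduct, map_zero,
    hS.eval_bUp hΩ hU, hS.eval_cov hΩ hU w fun w i => hS.eval_s1 hΩ hU w i,
    hS.eval_covEndo hΩ hU w fun w i j => hS.eval_sMix hΩ hU w i j, hS.eval_sSq hΩ hU,
    hS.eval_divs hΩ hU, hS.eval_trS hΩ hU, hS.eval_s1 hΩ hU, hS.eval_sMix hΩ hU] at h1 h2 h3 h4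
  refine ⟨h1, h2, h3, ?_, rfl⟩
  refine Eq.trans ?_ h4
  simp only [Finset.sum_mul]
  rfl

end Points

end Regular

end LocalPair

end Kropina

end

/-! ### An Einstein Kropina metric has r₀₀ proportional to α². -/

noncomputable section

namespace Kropina

open Matrix TangentRing

section Line

variable {n : ℕ} {Ω : Set (Coord n × Coord n)} {hΩ : IsOpen Ω} {x e w : Coord n}
  (hl : ∀ t : ℝ, (x, e + t • w) ∈ Ω)

include hl in
-- The whole line lies in one fibre of Ω, and the derivative along it is a combination of vertical
-- derivatives, which vanish on the base. No connectedness of the fibre is needed.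
lemma evalAt_base_line {f : smoothAlg Ω} (hf : f ∈ (tangentRing hΩ).base) (t : ℝ) :
    evalAt ⟨_, hl t⟩ f = evalAt ⟨_, hl 0⟩ f := by
  let g : ℝ → ℝ := fun t => extendZero f.1 (x, e + t • w)
  have hg : ∀ t, HasDerivAt g 0 t := by
    intro t
    let p : Ω := ⟨_, hl t⟩
    have h1 := (smoothAlg_differentiableAt hΩ f p).hasFDerivAt
    have h2 : HasDerivAt (fun t : ℝ => (x, e + t • w)) ((0 : Coord n), w) t := by
      refine (hasDerivAt_const t x).prodMk ?_
      simpa using ((hasDerivAt_id t).smul_const w).const_add e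
    have h3 := h1.comp_hasDerivAt t h2
    have h4 : ((0 : Coord n), w) = ∑ k, w k • ((0 : Coord n), EuclideanSpace.single k (1 : ℝ)) := by
      rw [Prod.ext_iff]
      constructor
      · simp [Prod.fst_sum]
      · rw [Prod.snd_sum]
        ext i
        simp [Pi.single_apply]
    have h5 : fderiv ℝ (extendZero f.1) p ((0 : Coord n), w) = 0 := by
      rw [h4, map_sum]
      refine Finset.sum_eq_zero fun k _ => ?_
      rw [map_smul]
      have h6 := congrArg (evalAt p) (hf k)
      rw [map_zero] at h6
      rw [show fderiv ℝ (extendZero f.1) p ((0 : Coord n), EuclideanSpace.single k (1 : ℝ)) = 0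
        from h6, smul_zero]
    rw [h5] at h3
    exact h3
  have h := is_const_of_deriv_eq_zero (fun t => (hg t).differentiableAt)
    (fun t => (hg t).deriv) t 0
  simp only [g] at h
  rw [evalAt_apply, evalAt_apply]
  exact (extendZero_apply f.1 ⟨_, hl t⟩).symm.trans
    (h.trans (extendZero_apply f.1 ⟨_, hl 0⟩))

/-- Along the line the base elements and 1/β are constant and the fibre coordinates are affine in t,
so the generators of the regular elements become polynomials. -/
lemma exists_polynomial_line (S : KropinaRing (tangentRing hΩ))
    (hbi : ∀ t, evalAt ⟨_, hl t⟩ S.bi = evalAt ⟨_, hl 0⟩ S.bi) {f : smoothAlg Ω}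
    (hf : f ∈ S.regular) : ∃ p : Polynomial ℝ, ∀ t, evalAt ⟨_, hl t⟩ f = p.eval t := by
  induction hf using Algebra.adjoin_induction with
  | mem f hf =>
    rcases hf with (hf | ⟨i, rfl⟩) | hf
    · exact ⟨Polynomial.C (evalAt ⟨_, hl 0⟩ f), fun t => by
        rw [Polynomial.eval_C, evalAt_base_line hl hf]⟩
    · exact ⟨Polynomial.C (e i) + Polynomial.X * Polynomial.C (w i), fun t => by
        simp only [evalAt_y, PiLp.add_apply, PiLp.smul_apply, smul_eq_mul, Polynomial.eval_add,
          Polynomial.eval_mul, Polynomial.eval_C, Polynomial.eval_X]⟩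
    · rw [Set.mem_singleton_iff.1 hf]
      exact ⟨Polynomial.C (evalAt ⟨_, hl 0⟩ S.bi), fun t => by rw [Polynomial.eval_C, hbi]⟩
  | algebraMap c => exact ⟨Polynomial.C c, fun t => by rw [evalAt_algebraMap, Polynomial.eval_C]⟩
  | add f g _ _ hf hg =>
    obtain ⟨p, hp⟩ := hf
    obtain ⟨q, hq⟩ := hg
    exact ⟨p + q, fun t => by rw [map_add, Polynomial.eval_add, hp, hq]⟩
  | mul f g _ _ hf hg =>
    obtain ⟨p, hp⟩ := hf
    obtain ⟨q, hq⟩ := hg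
    exact ⟨p * q, fun t => by rw [map_mul, Polynomial.eval_mul, hp, hq]⟩

end Line

/-- A real quadratic polynomial whose square is divisible by `B + W t²` is a multiple of it. -/
lemma quadratic_of_dvd_sq {B W r₀ r₁ r₂ k : ℝ} (hB : 0 < B) (hW : 0 < W) (hk : k ≠ 0)
    (p : Polynomial ℝ)
    (h : ∀ t : ℝ, k * (r₀ + 2 * t * r₁ + t ^ 2 * r₂) ^ 2 = (B + t ^ 2 * W) * p.eval t) :
    r₁ = 0 ∧ r₀ * W = r₂ * B := by
  have hp : Polynomial.C k * (Polynomial.C r₀ + 2 * Polynomial.X * Polynomial.C r₁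
      + Polynomial.X ^ 2 * Polynomial.C r₂) ^ 2
      = (Polynomial.C B + Polynomial.X ^ 2 * Polynomial.C W) * p := by
    refine Polynomial.funext fun t => ?_
    simp only [Polynomial.eval_add, Polynomial.eval_mul, Polynomial.eval_pow, Polynomial.eval_C,
      Polynomial.eval_X, Polynomial.eval_ofNat]
    linear_combination h t
  -- The number iτ is a root of B + W t². The square on the left vanishes there, hence so does the
  -- quadratic, whose imaginary and real parts give the two claims.
  set τ : ℝ := √(B / W) with hτ
  have hτ2 : τ ^ 2 * W = B := by
    rw [hτ, Real.sq_sqrt (by positivity)]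
    field_simp
  have hτ0 : 0 < τ := Real.sqrt_pos.2 (by positivity)
  have hz := congrArg (Polynomial.aeval (Complex.I * (τ : ℂ))) hp
  simp only [map_mul, map_add, map_pow, Polynomial.aeval_C, Polynomial.aeval_X,
    Complex.coe_algebraMap, map_ofNat, mul_pow, Complex.I_sq] at hz
  have h0 : (B : ℂ) + -1 * (τ : ℂ) ^ 2 * (W : ℂ) = 0 := by
    have : ((τ ^ 2 * W : ℝ) : ℂ) = (B : ℂ) := by rw [hτ2]
    push_cast at this
    linear_combination -this
  rw [h0, zero_mul] at hz
  have h1 := (mul_eq_zero.1 hz).resolve_left (by exact_mod_cast hk)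
  have h2 := pow_eq_zero_iff (two_ne_zero) |>.1 h1
  have hre := congrArg Complex.re h2
  have him := congrArg Complex.im h2
  simp [pow_two] at hre him
  constructor
  · rcases him with h | h
    · exact absurd h hτ0.ne'
    · exact h
  · rw [← hτ2]
    linear_combination W * hre

namespace LocalPair

variable {n : ℕ} {S : LocalPair n}

lemma r_symm (x : Coord n) (i j : Fin n) : S.r x i j = S.r x j i := by
  unfold r
  ring

lemma r00_eq_dot (x y : Coord n) : S.r00 x y = y.ofLp ⬝ᵥ Matrix.of (S.r x) *ᵥ y.ofLp := by
  simp only [r00, dotProduct, mulVec, Finset.mul_sum, Matrix.of_apply]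
  exact Finset.sum_congr rfl fun _ _ => Finset.sum_congr rfl fun _ _ => by ring

lemma quadratic_line {M : Matrix (Fin n) (Fin n) ℝ} (hM : ∀ i j, M i j = M j i)
    (u v : Fin n → ℝ) (t : ℝ) : (u + t • v) ⬝ᵥ M *ᵥ (u + t • v)
    = u ⬝ᵥ M *ᵥ u + 2 * t * (u ⬝ᵥ M *ᵥ v) + t ^ 2 * (v ⬝ᵥ M *ᵥ v) := by
  have hMt : Mᵀ = M := by ext i j; exact hM j i
  have hsym : v ⬝ᵥ M *ᵥ u = u ⬝ᵥ M *ᵥ v := by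
    rw [dotProduct_mulVec, ← mulVec_transpose, hMt, dotProduct_comm]
  simp only [mulVec_add, mulVec_smul, dotProduct_add, add_dotProduct, dotProduct_smul,
    smul_dotProduct, smul_eq_mul, hsym]
  ring

lemma eq_of_quadratic_eq {M N : Matrix (Fin n) (Fin n) ℝ} (hM : ∀ i j, M i j = M j i)
    (hN : ∀ i j, N i j = N j i) (h : ∀ v : Fin n → ℝ, v ⬝ᵥ M *ᵥ v = v ⬝ᵥ N *ᵥ v) (i j : Fin n) :
    M i j = N i j := by
  have h1 := h (Pi.single i 1 + (1 : ℝ) • Pi.single j 1)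
  rw [quadratic_line hM, quadratic_line hN, h (Pi.single i 1), h (Pi.single j 1)] at h1
  have h2 : ∀ L : Matrix (Fin n) (Fin n) ℝ,
      (Pi.single i (1 : ℝ)) ⬝ᵥ L *ᵥ (Pi.single j (1 : ℝ)) = L i j := fun L => by simp
  rw [h2, h2] at h1
  linarith

lemma beta_eq_dot (x y : Coord n) : S.beta x y = S.b x ⬝ᵥ y.ofLp := rfl

namespace Regular

variable {U : Set (Coord n)} (hS : S.Regular U)

include hS

lemma a_symm {x : Coord n} (hx : x ∈ U) (i j : Fin n) : S.a x i j = S.a x j i := by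
  simpa using ((hS.posDef x hx).1.apply i j).symm

/-- If a Kropina metric is Einstein, then `r_ij` is a multiple of `a_ij`. -/
lemma exists_conformal (hn : 2 ≤ n) {x : Coord n} (hx : x ∈ U) {σ : ℝ}
    (hE : ∀ y, 0 < S.beta x y → ricci S.kropina x y = σ * S.kropina x y ^ 2) :
    ∃ c : ℝ, ∀ i j, S.r x i j = c * S.a x i j := by
  set e : Coord n := WithLp.toLp 2 (S.bUp x) with he
  have hB := hS.bSq_pos hx
  set B := S.bSq x with hBdef
  have hea : S.a x *ᵥ e.ofLp = S.b x := hS.a_mulVec_bUp hx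
  have hae : S.alphaSq x e = B := hS.alphaSq_bUp hx
  have hbe : S.beta x e = B := rfl
  have hr : ∀ i j, Matrix.of (S.r x) i j = Matrix.of (S.r x) j i := S.r_symm x
  have ha := hS.a_symm hx
  let Ω : Set (Coord n × Coord n) := {w | w.1 ∈ U ∧ 0 < S.beta w.1 w.2}
  have hΩ : IsOpen Ω := hS.isOpen_beta_pos
  have hU : ∀ w ∈ Ω, w.1 ∈ U := fun w hw => hw.1
  have hβ : ∀ w ∈ Ω, 0 < S.beta w.1 w.2 := fun w hw => hw.2
  set K := hS.kropinaRing hΩ hU hβ with hK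
  -- The vector e is b^♯, which is α-orthogonal to ker β. On e + t w the function β is therefore the
  -- constant B and α² has no linear term in t.
  have key : ∀ w : Coord n, S.beta x w = 0 → w ≠ 0 →
      e.ofLp ⬝ᵥ Matrix.of (S.r x) *ᵥ w.ofLp = 0 ∧ S.r00 x e * S.alphaSq x w = S.r00 x w * B := by
    intro w hw hw0
    have hbl : ∀ t : ℝ, S.beta x (e + t • w) = B := fun t => by
      rw [beta_eq_dot, WithLp.ofLp_add, WithLp.ofLp_smul, dotProduct_add, dotProduct_smul,
        ← beta_eq_dot, ← beta_eq_dot, hw, hbe, smul_zero, add_zero]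
    have hl : ∀ t : ℝ, (x, e + t • w) ∈ Ω := fun t => ⟨hx, by
      change 0 < S.beta x (e + t • w)
      rw [hbl]; exact hB⟩
    have hal : ∀ t : ℝ, S.alphaSq x (e + t • w) = B + t ^ 2 * S.alphaSq x w := fun t => by
      rw [alphaSq_eq_dot, WithLp.ofLp_add, WithLp.ofLp_smul, quadratic_line ha, ← alphaSq_eq_dot,
        ← alphaSq_eq_dot, hae]
      have : e.ofLp ⬝ᵥ S.a x *ᵥ w.ofLp = 0 := by
        have hat : (S.a x)ᵀ = S.a x := by ext i j; exact ha j i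
        rw [dotProduct_mulVec, ← mulVec_transpose, hat, hea, ← beta_eq_dot, hw]
      rw [this]
      ring
    have hr00 : ∀ t : ℝ, S.r00 x (e + t • w) = S.r00 x e
        + 2 * t * (e.ofLp ⬝ᵥ Matrix.of (S.r x) *ᵥ w.ofLp) + t ^ 2 * S.r00 x w := fun t => by
      rw [r00_eq_dot, WithLp.ofLp_add, WithLp.ofLp_smul, quadratic_line hr, ← r00_eq_dot,
        ← r00_eq_dot]
    obtain ⟨q, hq, hpol⟩ := K.exists_ric_G_polar
    obtain ⟨p, hp⟩ := exists_polynomial_line hl K (fun t => by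
      rw [hS.eval_bi, hS.eval_bi]
      change (S.beta x (e + t • w))⁻¹ = (S.beta x (e + (0 : ℝ) • w))⁻¹
      rw [hbl, hbl]) hq
    have hn1 : ((n : ℝ) - 1) ≠ 0 := by
      have : (2 : ℝ) ≤ n := by exact_mod_cast hn
      linarith
    -- With φ = α² on the line and F = φ/B, the polar formula and the Einstein equation give 3(n-1)
    -- r₀₀² = φ (σφ³/B² - B p); the last factor is the polynomial supplied here.
    refine quadratic_of_dvd_sq (k := 3 * (n - 1)) hB (hS.alphaSq_pos hx hw0)
      (mul_ne_zero three_ne_zero hn1) (Polynomial.C (σ / B ^ 2) * (Polynomial.C B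
        + Polynomial.X ^ 2 * Polynomial.C (S.alphaSq x w)) ^ 3 - Polynomial.C B * p) fun t => ?_
    have h1 := congrArg (evalAt ⟨_, hl t⟩) hpol
    have h2 : evalAt ⟨_, hl t⟩ ((tangentRing hΩ).ric K.G) = ricci S.kropina x (e + t • w) :=
      (hS.rep_ricci_kropina hΩ hU hβ ⟨_, hl t⟩).symm
    have h3 : evalAt ⟨_, hl t⟩ K.F = (B + t ^ 2 * S.alphaSq x w) / B := by
      rw [hS.eval_F]
      change S.alphaSq x (e + t • w) / S.beta x (e + t • w) = _
      rw [hal, hbl]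
    have h4 : S.kropina x (e + t • w) = (B + t ^ 2 * S.alphaSq x w) / B := by
      rw [← h3, hS.eval_F]
    have h5 : evalAt ⟨_, hl t⟩ K.r00 = S.r00 x e
        + 2 * t * (e.ofLp ⬝ᵥ Matrix.of (S.r x) *ᵥ w.ofLp) + t ^ 2 * S.r00 x w := by
      rw [← hr00]
      exact hS.eval_r00 hΩ hU ⟨_, hl t⟩
    have h6 : evalAt ⟨_, hl t⟩ K.om = B⁻¹ := hS.eval_om hΩ hU hβ ⟨_, hl t⟩
    simp only [map_mul, map_add, map_sub, map_pow, map_ofNat, map_natCast, map_one, h2, h3, h5,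
      h6, hp] at h1
    rw [hE _ (by rw [hbl]; exact hB), h4] at h1
    simp only [Polynomial.eval_sub, Polynomial.eval_mul, Polynomial.eval_C, Polynomial.eval_pow,
      Polynomial.eval_add, Polynomial.eval_X]
    generalize S.r00 x e + 2 * t * (e.ofLp ⬝ᵥ Matrix.of (S.r x) *ᵥ w.ofLp)
      + t ^ 2 * S.r00 x w = ρ at h1 ⊢
    generalize B + t ^ 2 * S.alphaSq x w = φ at h1 ⊢
    have hB0 := hB.ne'
    field_simp at h1 ⊢
    linear_combination -h1
  refine ⟨S.r00 x e / B, fun i j => ?_⟩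
  have hN : ∀ i j, ((S.r00 x e / B) • S.a x) i j = ((S.r00 x e / B) • S.a x) j i := fun i j => by
    simp only [Matrix.smul_apply, ha i j]
  refine eq_of_quadratic_eq (M := Matrix.of (S.r x)) (N := (S.r00 x e / B) • S.a x) hr hN
    (fun v => ?_) i j
  rw [smul_mulVec, dotProduct_smul, smul_eq_mul]
  let y : Coord n := WithLp.toLp 2 v
  set τ : ℝ := S.beta x y / B with hτ
  -- The part of y in ker β. Both quadratic forms lose their mixed term on w + τ e, so comparing
  -- them on w and on e suffices.
  let w : Coord n := y - τ • e
  have hw : S.beta x w = 0 := by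
    simp only [w, beta_eq_dot, WithLp.ofLp_sub, WithLp.ofLp_smul, dotProduct_sub, dotProduct_smul]
    rw [← beta_eq_dot, ← beta_eq_dot, hbe, smul_eq_mul, hτ]
    field_simp
    ring
  have hv : v = w.ofLp + τ • e.ofLp := by
    simp [w, y]
  have hew : e.ofLp ⬝ᵥ S.a x *ᵥ w.ofLp = 0 := by
    have hat : (S.a x)ᵀ = S.a x := by ext i j; exact ha j i
    rw [dotProduct_mulVec, ← mulVec_transpose, hat, hea, ← beta_eq_dot, hw]
  have hwe : ∀ M : Matrix (Fin n) (Fin n) ℝ, (∀ i j, M i j = M j i) →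
      w.ofLp ⬝ᵥ M *ᵥ e.ofLp = e.ofLp ⬝ᵥ M *ᵥ w.ofLp := fun M hM => by
    have hMt : Mᵀ = M := by ext i j; exact hM j i
    rw [dotProduct_mulVec, ← mulVec_transpose, hMt, dotProduct_comm]
  rw [hv, quadratic_line hr, quadratic_line ha, hwe _ hr, hwe _ ha, hew, ← r00_eq_dot,
    ← r00_eq_dot, ← alphaSq_eq_dot, ← alphaSq_eq_dot, hae]
  rcases eq_or_ne w 0 with h0 | h0
  · simp [h0, r00, alphaSq]
    field_simp
  · obtain ⟨h1, h2⟩ := key w hw h0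
    rw [h1]
    field_simp
    linear_combination -h2

end Regular

end LocalPair

/-! ### Separation of the Einstein equation into its homogeneous parts -/

section Separation

variable {E : Type*} [NormedAddCommGroup E] [NormedSpace ℝ E]

/-- For t > 0 the point y + t e lies in the open half space; let t tend to 0. -/
lemma eq_of_eq_on_pos {β : E →ₗ[ℝ] ℝ} {e : E} (he : 0 < β e) {u v : E → ℝ}
    (hu : Continuous u) (hv : Continuous v) (h : ∀ y, 0 < β y → u y = v y) {y : E}
    (hy : 0 ≤ β y) : u y = v y := by
  have hline : Continuous fun t : ℝ => y + t • e := by fun_prop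
  have h1 : Filter.Tendsto (fun t : ℝ => u (y + t • e)) (nhdsWithin 0 (Set.Ioi 0)) (nhds (u y)) := by
    have := ((hu.comp hline).tendsto 0).mono_left (nhdsWithin_le_nhds (s := Set.Ioi 0))
    simpa [Function.comp_def] using this
  have h2 : Filter.Tendsto (fun t : ℝ => v (y + t • e)) (nhdsWithin 0 (Set.Ioi 0)) (nhds (v y)) := by
    have := ((hv.comp hline).tendsto 0).mono_left (nhdsWithin_le_nhds (s := Set.Ioi 0))
    simpa [Function.comp_def] using this
  refine tendsto_nhds_unique (h1.congr' ?_) h2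
  filter_upwards [self_mem_nhdsWithin] with t ht
  refine h _ ?_
  rw [map_add, map_smul, smul_eq_mul]
  exact add_pos_of_nonneg_of_pos hy (mul_pos ht he)

/-- Separation of an identity in `α²/β` into its homogeneous parts. -/
lemma separation [FiniteDimensional ℝ E] (hE : 2 ≤ Module.finrank ℝ E) {β B : E →ₗ[ℝ] ℝ} {e : E}
    (he : 0 < β e) {al C : E → ℝ} (hal : Continuous al) (hC : Continuous C)
    (hpos : ∀ y, y ≠ 0 → 0 < al y) (hal_even : ∀ y, al (-y) = al y) (hC_even : ∀ y, C (-y) = C y)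
    {κ g : ℝ} (h : ∀ y, 0 < β y → κ * (al y / β y) ^ 2 = C y + al y * g + al y / β y * B y) :
    κ = 0 ∧ ∃ f, ∀ y, C y = f * al y ∧ (f + g) * β y + B y = 0 := by
  have hβc : Continuous β := β.continuous_of_finiteDimensional
  have hBc : Continuous B := B.continuous_of_finiteDimensional
  -- Here the dimension has to be at least 2: the kernel of β contains a nonzero vector, and α² is
  -- positive on it.
  obtain ⟨y₀, hy₀, hβ₀⟩ : ∃ y₀, y₀ ≠ 0 ∧ β y₀ = 0 := by
    have hk : LinearMap.ker β ≠ ⊥ := LinearMap.ker_ne_bot_of_finrank_lt (by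
      rw [Module.finrank_self]; omega)
    obtain ⟨y, hy, hy0⟩ := (Submodule.ne_bot_iff _).1 hk
    exact ⟨y, hy0, hy⟩
  have h1 : ∀ y, 0 < β y →
      κ * al y ^ 2 = β y * (C y * β y + al y * g * β y + al y * B y) := fun y hy => by
    have := h y hy
    field_simp at this
    linear_combination this
  have hκ : κ = 0 := by
    have h2 := eq_of_eq_on_pos he (u := fun y => κ * al y ^ 2)
      (v := fun y => β y * (C y * β y + al y * g * β y + al y * B y)) (by fun_prop) (by fun_prop)
      h1 hβ₀.ge
    simp only [hβ₀, zero_mul] at h2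
    exact (mul_eq_zero.1 h2).resolve_right (pow_ne_zero _ (hpos y₀ hy₀).ne')
  have h2 : ∀ y, 0 < β y → C y * β y + al y * g * β y + al y * B y = 0 := fun y hy => by
    have := h1 y hy
    rw [hκ, zero_mul] at this
    exact (mul_eq_zero.1 this.symm).resolve_left hy.ne'
  have h3 : ∀ y, β y = 0 → B y = 0 := fun y hy => by
    rcases eq_or_ne y 0 with rfl | hy0
    · exact map_zero B
    have h4 := eq_of_eq_on_pos he (u := fun y => C y * β y + al y * g * β y + al y * B y)
      (v := fun _ => 0) (by fun_prop) (by fun_prop) h2 hy.ge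
    simp only [hy, mul_zero, zero_add] at h4
    exact (mul_eq_zero.1 h4).resolve_left (hpos y hy0).ne'
  -- B vanishes on ker β, hence is a multiple of β.
  have h4 : ∀ y, B y = B e / β e * β y := fun y => by
    have h5 := h3 (y - (β y / β e) • e) (by
      rw [map_sub, map_smul, smul_eq_mul]
      field_simp
      ring)
    rw [map_sub, map_smul, smul_eq_mul] at h5
    linear_combination h5
  refine ⟨hκ, -(g + B e / β e), ?_⟩
  have h5 : ∀ y, 0 < β y → C y = -(g + B e / β e) * al y := fun y hy => by
    have h6 := h2 y hy
    rw [h4 y] at h6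
    have h7 : β y * (C y + (g + B e / β e) * al y) = 0 := by linear_combination h6
    linear_combination (mul_eq_zero.1 h7).resolve_left hy.ne'
  have h6 : ∀ y, 0 ≤ β y → C y = -(g + B e / β e) * al y := fun y hy =>
    eq_of_eq_on_pos he (u := C) (v := fun y => -(g + B e / β e) * al y) hC (by fun_prop) h5 hy
  intro y
  constructor
  · rcases le_total 0 (β y) with hy | hy
    · exact h6 y hy
    -- C and α² are even, so the half space β ≤ 0 follows from the opposite one.
    · rw [← hC_even, ← hal_even]
      exact h6 (-y) (by rw [map_neg]; linarith)
  · rw [h4 y]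
    ring

end Separation

end Kropina

end

/-! ### The Einstein equation at a point, in coordinates. -/

noncomputable section

namespace Kropina

open Matrix TangentRing

namespace LocalPair

variable {n : ℕ} (S : LocalPair n)

/-- The terms of the Einstein equation that are quadratic in `y` and carry no factor `α²`. -/
def bracket (c : Coord n → ℝ) (x y : Coord n) : ℝ :=
  S.ricQuad x y * S.bSq x ^ 2
    + (n - 2) * (S.bSq x * S.s0_0 x y + S.bSq x * dc0 c x y * S.beta x y
      - (S.s0 x y + c x * S.beta x y) ^ 2)

/-- The coefficient of `α²/β` in the Einstein equation. -/
def mixed (c : Coord n → ℝ) (x y : Coord n) : ℝ :=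
  (n - 3) * S.bSq x * c x * S.s0 x y + S.bSq x * S.b_s0 x y
    - S.bSq x ^ 2 * S.divS0 x y + (n - 1) * S.bSq x * S.s0s x y

/-- The coefficient of `α²` in the Einstein equation. -/
def isotropic (c : Coord n → ℝ) (x : Coord n) : ℝ :=
  (n - 2) * S.bSq x * c x ^ 2 + S.bSq x * S.b_dc c x

/-- The Einstein scalar. -/
def einsteinScalar (x : Coord n) : ℝ :=
  -(1 / (2 * S.bSq x)) * S.sSq x - (1 / 4) * S.trS x

variable {S}

lemma isLinearMap_beta (x : Coord n) : IsLinearMap ℝ (S.beta x) where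
  map_add y z := by simp [beta, mul_add, Finset.sum_add_distrib]
  map_smul t y := by
    simp only [beta, PiLp.smul_apply, smul_eq_mul, Finset.mul_sum]
    exact Finset.sum_congr rfl fun _ _ => by ring

lemma isLinearMap_s0 (x : Coord n) : IsLinearMap ℝ (S.s0 x) where
  map_add y z := by simp [s0, mul_add, Finset.sum_add_distrib]
  map_smul t y := by
    simp only [s0, PiLp.smul_apply, smul_eq_mul, Finset.mul_sum]
    exact Finset.sum_congr rfl fun _ _ => by ring

lemma isLinearMap_b_s0 (x : Coord n) : IsLinearMap ℝ (S.b_s0 x) where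
  map_add y z := by simp [b_s0, mul_add, Finset.sum_add_distrib]
  map_smul t y := by
    simp only [b_s0, PiLp.smul_apply, smul_eq_mul, Finset.mul_sum]
    exact Finset.sum_congr rfl fun _ _ => Finset.sum_congr rfl fun _ _ => by ring

lemma isLinearMap_divS0 (x : Coord n) : IsLinearMap ℝ (S.divS0 x) where
  map_add y z := by simp [divS0, mul_add, Finset.sum_add_distrib]
  map_smul t y := by
    simp only [divS0, PiLp.smul_apply, smul_eq_mul, Finset.mul_sum]
    exact Finset.sum_congr rfl fun _ _ => Finset.sum_congr rfl fun _ _ => by ring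

lemma isLinearMap_s0s (x : Coord n) : IsLinearMap ℝ (S.s0s x) where
  map_add y z := by simp [s0s, mul_add, add_mul, Finset.sum_add_distrib]
  map_smul t y := by
    simp only [s0s, PiLp.smul_apply, smul_eq_mul, Finset.mul_sum]
    exact Finset.sum_congr rfl fun _ _ => Finset.sum_congr rfl fun _ _ => by ring

lemma isLinearMap_dc0 (c : Coord n → ℝ) (x : Coord n) : IsLinearMap ℝ (dc0 c x) where
  map_add y z := by simp [dc0, mul_add, Finset.sum_add_distrib]
  map_smul t y := by
    simp only [dc0, PiLp.smul_apply, smul_eq_mul, Finset.mul_sum]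
    exact Finset.sum_congr rfl fun _ _ => by ring

lemma isLinearMap_mixed (c : Coord n → ℝ) (x : Coord n) : IsLinearMap ℝ (S.mixed c x) where
  map_add y z := by
    simp only [mixed, (isLinearMap_s0 x).map_add, (isLinearMap_b_s0 x).map_add,
      (isLinearMap_divS0 x).map_add, (isLinearMap_s0s x).map_add]
    ring
  map_smul t y := by
    simp only [mixed, (isLinearMap_s0 x).map_smul, (isLinearMap_b_s0 x).map_smul,
      (isLinearMap_divS0 x).map_smul, (isLinearMap_s0s x).map_smul, smul_eq_mul]
    ring

lemma continuous_coord (i : Fin n) : Continuous fun y : Coord n => y i :=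
  (EuclideanSpace.proj (𝕜 := ℝ) i).continuous

lemma continuous_alphaSq (x : Coord n) : Continuous (S.alphaSq x) := by
  unfold alphaSq
  exact continuous_finsetSum _ fun i _ => (continuous_coord i).mul
    (continuous_finsetSum _ fun j _ => continuous_const.mul (continuous_coord j))

lemma continuous_ricQuad (x : Coord n) : Continuous (S.ricQuad x) := by
  unfold ricQuad
  exact continuous_finsetSum _ fun i _ => continuous_finsetSum _ fun j _ =>
    (continuous_const.mul (continuous_coord i)).mul (continuous_coord j)

lemma continuous_s0_0 (x : Coord n) : Continuous (S.s0_0 x) := by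
  unfold s0_0
  exact continuous_finsetSum _ fun i _ => continuous_finsetSum _ fun j _ =>
    (continuous_const.mul (continuous_coord i)).mul (continuous_coord j)

lemma continuous_of_isLinearMap {f : Coord n → ℝ} (hf : IsLinearMap ℝ f) : Continuous f :=
  (hf.mk' f).continuous_of_finiteDimensional

lemma continuous_bracket (c : Coord n → ℝ) (x : Coord n) : Continuous (S.bracket c x) := by
  have h1 := continuous_ricQuad (S := S) x
  have h2 := continuous_s0_0 (S := S) x
  have h3 := continuous_of_isLinearMap (isLinearMap_beta (S := S) x)
  have h4 := continuous_of_isLinearMap (isLinearMap_s0 (S := S) x)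
  have h5 := continuous_of_isLinearMap (isLinearMap_dc0 c x)
  unfold bracket
  fun_prop

lemma alphaSq_neg (x y : Coord n) : S.alphaSq x (-y) = S.alphaSq x y := by
  simp [alphaSq]

lemma bracket_neg (c : Coord n → ℝ) (x y : Coord n) : S.bracket c x (-y) = S.bracket c x y := by
  have h1 : S.ricQuad x (-y) = S.ricQuad x y := by simp [ricQuad]
  have h2 : S.s0_0 x (-y) = S.s0_0 x y := by simp [s0_0]
  rw [bracket, bracket, h1, h2, (isLinearMap_beta x).map_neg, (isLinearMap_s0 x).map_neg,
    (isLinearMap_dc0 c x).map_neg]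
  ring

namespace Regular

variable {U : Set (Coord n)} (hS : S.Regular U) {c : Coord n → ℝ} (hc : ContDiffOn ℝ ∞ c U)
  (hr : ∀ z ∈ U, ∀ i j, S.r z i j = c z * S.a z i j) {x : Coord n} (hx : x ∈ U)

include hS

lemma beta_bUp_pos (hx : x ∈ U) : 0 < S.beta x (WithLp.toLp 2 (S.bUp x)) :=
  hS.bSq_pos hx

include hc hr hx

lemma ricci_kropina_eq {y : Coord n} (hy : 0 < S.beta x y) :
    S.bSq x ^ 2 * (ricci S.kropina x y - S.einsteinScalar x * S.kropina x y ^ 2)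
      = S.bracket c x y + S.alphaSq x y * S.isotropic c x
        + S.alphaSq x y / S.beta x y * S.mixed c x y :=
  hS.ricci_kropina hc hr hx hy

/-- The consequences of the Einstein equation at a point. -/
lemma einstein_consequences (hn : 2 ≤ n) {σ : ℝ}
    (hE : ∀ y, 0 < S.beta x y → ricci S.kropina x y = σ * S.kropina x y ^ 2) :
    σ = S.einsteinScalar x ∧ ∃ f, ∀ y, S.bracket c x y = f * S.alphaSq x y ∧
      (f + S.isotropic c x) * S.beta x y + S.mixed c x y = 0 := by
  have hb := hS.bSq_pos hx
  obtain ⟨h1, h2⟩ := separation (β := (isLinearMap_beta (S := S) x).mk' _)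
    (B := (isLinearMap_mixed (S := S) c x).mk' _) (by simpa using hn) (hS.beta_bUp_pos hx)
    (continuous_alphaSq x) (continuous_bracket c x) (fun y hy => hS.alphaSq_pos hx hy)
    (alphaSq_neg x) (bracket_neg c x) (κ := S.bSq x ^ 2 * (σ - S.einsteinScalar x))
    (g := S.isotropic c x) (fun y hy => by
      have h := hS.ricci_kropina_eq hc hr hx hy
      rw [hE y hy] at h
      refine Eq.trans ?_ h
      change _ * (S.kropina x y) ^ 2 = _
      ring)
  refine ⟨?_, h2⟩
  have := (mul_eq_zero.1 h1).resolve_left (pow_ne_zero _ hb.ne')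
  linarith

lemma einstein_of_equations {f : ℝ} (h : ∀ y, S.bracket c x y = f * S.alphaSq x y ∧
      (f + S.isotropic c x) * S.beta x y + S.mixed c x y = 0) {y : Coord n}
    (hy : 0 < S.beta x y) : ricci S.kropina x y = S.einsteinScalar x * S.kropina x y ^ 2 := by
  have h1 := hS.ricci_kropina_eq hc hr hx hy
  obtain ⟨h2, h3⟩ := h y
  have h4 : S.bSq x ^ 2 * (ricci S.kropina x y - S.einsteinScalar x * S.kropina x y ^ 2) = 0 := by
    rw [h1, h2]
    field_simp
    linear_combination S.alphaSq x y * h3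
  have h5 := (mul_eq_zero.1 h4).resolve_left (pow_ne_zero _ (hS.bSq_pos hx).ne')
  linarith

/-- Evaluate at y = b^♯, where s₀ vanishes and β = b²; the other contractions are given by
`contraction`, and the common factor b² cancels. -/
lemma scalar_eq {f : ℝ} (h : ∀ y, (f + S.isotropic c x) * S.beta x y + S.mixed c x y = 0) :
    f = -((n : ℝ) - 2) * S.bSq x * c x ^ 2 - S.bSq x * S.b_dc c x
      + ((n : ℝ) - 2) * S.sSq x - S.bSq x * S.divs x - S.bSq x * S.trS x := by
  obtain ⟨h1, h2, h3, h4, h5⟩ := hS.contraction hc hr hx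
  have h6 := h (WithLp.toLp 2 (S.bUp x))
  rw [mixed, isotropic, h1, h2, h3, h4, h5] at h6
  have hb := (hS.bSq_pos hx).ne'
  refine mul_left_cancel₀ hb ?_
  linear_combination h6

end Regular

end LocalPair

end Kropina

end

/-! ### Invariance of r₀₀ under changes of coordinates. -/

noncomputable section

namespace Kropina

open Matrix Topology Filter

section Invariance

variable {E : Type*} [NormedAddCommGroup E] [NormedSpace ℝ E]

/-- The expression `y (B y) - y (A (y, X)) + ½ X (A (y, y))` for constant fields `X`, `y`. If `X` is
the vector dual to `B` at `x`, it is the symmetrized covariant derivative of `B`. -/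
def symmDeriv (A : E → E →L[ℝ] E →L[ℝ] ℝ) (B : E → E →L[ℝ] ℝ) (x X y : E) : ℝ :=
  fderiv ℝ B x y y - fderiv ℝ A x y y X + (1 / 2) * fderiv ℝ A x X y y

/-- Differentiating the pulled back forms produces terms in the second derivative H of ψ. Those in
H(y, y) cancel because J X is dual to B', and those in H(X, y) and H(y, X) cancel by the symmetry of
H and of A'. -/
lemma symmDeriv_pullback {A A' : E → E →L[ℝ] E →L[ℝ] ℝ} {B B' : E → E →L[ℝ] ℝ} {ψ : E → E}
    {J : E → E →L[ℝ] E} {H : E →L[ℝ] E →L[ℝ] E} {x X y : E}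
    (hψ : HasFDerivAt ψ (J x) x) (hJ : HasFDerivAt J H x) (hH : ∀ u v, H u v = H v u)
    (hA' : DifferentiableAt ℝ A' (ψ x)) (hB' : DifferentiableAt ℝ B' (ψ x))
    (hA : ∀ᶠ z in 𝓝 x, ∀ u v, A z u v = A' (ψ z) (J z u) (J z v))
    (hB : ∀ᶠ z in 𝓝 x, ∀ u, B z u = B' (ψ z) (J z u))
    (hdA : DifferentiableAt ℝ A x) (hdB : DifferentiableAt ℝ B x)
    (hsymm : ∀ u v, A' (ψ x) u v = A' (ψ x) v u)
    (hX : ∀ u, A' (ψ x) (J x X) u = B' (ψ x) u) :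
    symmDeriv A B x X y = symmDeriv A' B' (ψ x) (J x X) (J x y) := by
  have hJu : ∀ u, HasFDerivAt (fun z => J z u) (H.flip u) x := fun u => by
    have := hJ.clm_apply (hasFDerivAt_const u x)
    refine this.congr_fderiv ?_
    ext w
    simp
  have hAc : HasFDerivAt (fun z => A' (ψ z)) ((fderiv ℝ A' (ψ x)).comp (J x)) x :=
    HasFDerivAt.comp (F := E) (G := E →L[ℝ] E →L[ℝ] ℝ) x hA'.hasFDerivAt hψ
  have hBc : HasFDerivAt (fun z => B' (ψ z)) ((fderiv ℝ B' (ψ x)).comp (J x)) x :=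
    HasFDerivAt.comp (F := E) (G := E →L[ℝ] ℝ) x hB'.hasFDerivAt hψ
  have h1 : ∀ w u v, fderiv ℝ A x w u v = fderiv ℝ A' (ψ x) (J x w) (J x u) (J x v)
      + A' (ψ x) (H w u) (J x v) + A' (ψ x) (J x u) (H w v) := by
    intro w u v
    have e1 : HasFDerivAt (fun z => A z u v) _ x :=
      (hdA.hasFDerivAt.clm_apply (hasFDerivAt_const u x)).clm_apply (hasFDerivAt_const v x)
    have e2 := ((hAc.clm_apply (hJu u)).clm_apply (hJu v)).congr_of_eventuallyEq
      (f₁ := fun z => A z u v) (by filter_upwards [hA] with z hz using hz u v)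
    have e3 := congrArg (fun L => L w) (e1.unique e2)
    simp at e3
    linarith
  have h2 : ∀ w u, fderiv ℝ B x w u = fderiv ℝ B' (ψ x) (J x w) (J x u)
      + B' (ψ x) (H w u) := by
    intro w u
    have e1 : HasFDerivAt (fun z => B z u) _ x :=
      hdB.hasFDerivAt.clm_apply (hasFDerivAt_const u x)
    have e2 := (hBc.clm_apply (hJu u)).congr_of_eventuallyEq
      (f₁ := fun z => B z u) (by filter_upwards [hB] with z hz using hz u)
    have e3 := congrArg (fun L => L w) (e1.unique e2)
    simp at e3
    linarith
  simp only [symmDeriv, h1, h2]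
  rw [hH X y, hsymm (H y y), hX, hsymm (H y X)]
  ring

lemma hasFDerivAt_sum_smul {F : Type*} [NormedAddCommGroup F] [NormedSpace ℝ F] {ι : Type*}
    [Fintype ι] {f : ι → E → ℝ} {f' : ι → E →L[ℝ] ℝ} {x : E}
    (h : ∀ i, HasFDerivAt (f i) (f' i) x) (T : ι → F) :
    HasFDerivAt (fun z => ∑ i, f i z • T i) (∑ i, (f' i).smulRight (T i)) x :=
  HasFDerivAt.fun_sum fun i _ => (h i).smul_const (T i)

lemma hasFDerivAt_sum_sum_smul {F : Type*} [NormedAddCommGroup F] [NormedSpace ℝ F] {ι : Type*}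
    [Fintype ι] {f : ι → ι → E → ℝ} {f' : ι → ι → E →L[ℝ] ℝ} {x : E}
    (h : ∀ i j, HasFDerivAt (f i j) (f' i j) x) (T : ι → ι → F) :
    HasFDerivAt (fun z => ∑ i, ∑ j, f i j z • T i j) (∑ i, ∑ j, (f' i j).smulRight (T i j)) x :=
  HasFDerivAt.fun_sum fun i _ => hasFDerivAt_sum_smul (h i) (T i)

end Invariance

namespace LocalPair

variable {n : ℕ} (S : LocalPair n) {U : Set (Coord n)} {x : Coord n}

/-- The metric as a bilinear form. -/
def bilin (x : Coord n) : Coord n →L[ℝ] Coord n →L[ℝ] ℝ :=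
  ∑ i, ∑ j, S.a x i j • (EuclideanSpace.proj (𝕜 := ℝ) i).smulRight (EuclideanSpace.proj (𝕜 := ℝ) j)

/-- The one-form as a linear form. -/
def form (x : Coord n) : Coord n →L[ℝ] ℝ := ∑ i, S.b x i • EuclideanSpace.proj (𝕜 := ℝ) i

lemma bilin_apply (x u v : Coord n) : S.bilin x u v = ∑ i, ∑ j, S.a x i j * (u i * v j) := by
  simp [bilin]

lemma form_apply (x u : Coord n) : S.form x u = S.beta x u := by
  simp [form, beta]

lemma bilin_self (x u : Coord n) : S.bilin x u u = S.alphaSq x u := by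
  simp only [bilin_apply, alphaSq, Finset.mul_sum]
  exact Finset.sum_congr rfl fun i _ => Finset.sum_congr rfl fun j _ => by ring

lemma sum_mul_pd (f : Coord n → ℝ) (x w : Coord n) : fderiv ℝ f x w = ∑ k, w k * pd k f x := by
  have h : w = ∑ k, w k • EuclideanSpace.single k (1 : ℝ) := by
    ext i
    simp [Pi.single_apply]
  conv_lhs => rw [h]
  simp [pd]

namespace Regular

variable {S} (hS : S.Regular U) (hx : x ∈ U)

include hS hx

lemma bilin_symm (u v : Coord n) : S.bilin x u v = S.bilin x v u := by
  rw [bilin_apply, bilin_apply, Finset.sum_comm]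
  refine Finset.sum_congr rfl fun i _ => Finset.sum_congr rfl fun j _ => ?_
  rw [hS.a_symm hx j i]
  ring

lemma bilin_bUp (u : Coord n) : S.bilin x (WithLp.toLp 2 (S.bUp x)) u = S.form x u := by
  rw [hS.bilin_symm hx, bilin_apply, form_apply, beta, ← hS.a_mulVec_bUp hx]
  simp only [mulVec, dotProduct, Finset.sum_mul]
  exact Finset.sum_congr rfl fun i _ => Finset.sum_congr rfl fun j _ => by ring

lemma hasFDerivAt_a (i j : Fin n) :
    HasFDerivAt (fun z => S.a z i j) (fderiv ℝ (fun z => S.a z i j) x) x :=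
  (((hS.a_smooth i j).contDiffAt (hS.isOpen.mem_nhds hx)).differentiableAt (by simp)).hasFDerivAt

lemma hasFDerivAt_b (i : Fin n) :
    HasFDerivAt (fun z => S.b z i) (fderiv ℝ (fun z => S.b z i) x) x :=
  (((hS.b_smooth i).contDiffAt (hS.isOpen.mem_nhds hx)).differentiableAt (by simp)).hasFDerivAt

lemma hasFDerivAt_bilin : HasFDerivAt S.bilin
    (∑ i, ∑ j, (fderiv ℝ (fun z => S.a z i j) x).smulRight
      ((EuclideanSpace.proj (𝕜 := ℝ) i).smulRight (EuclideanSpace.proj (𝕜 := ℝ) j))) x := by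
  exact hasFDerivAt_sum_sum_smul (F := Coord n →L[ℝ] Coord n →L[ℝ] ℝ)
    (f := fun i j z => S.a z i j) (hS.hasFDerivAt_a hx) fun i j =>
      (EuclideanSpace.proj (𝕜 := ℝ) i).smulRight (EuclideanSpace.proj (𝕜 := ℝ) j)

lemma hasFDerivAt_form : HasFDerivAt S.form
    (∑ i, (fderiv ℝ (fun z => S.b z i) x).smulRight (EuclideanSpace.proj (𝕜 := ℝ) i)) x := by
  exact hasFDerivAt_sum_smul (F := Coord n →L[ℝ] ℝ) (f := fun i z => S.b z i)
    (hS.hasFDerivAt_b hx) fun i => EuclideanSpace.proj (𝕜 := ℝ) i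

lemma fderiv_bilin (w u v : Coord n) : fderiv ℝ S.bilin x w u v
    = ∑ i, ∑ j, ∑ k, pd k (fun z => S.a z i j) x * (w k * u i * v j) := by
  rw [(hS.hasFDerivAt_bilin hx).fderiv]
  simp [sum_mul_pd, Finset.sum_mul]
  exact Finset.sum_congr rfl fun i _ => Finset.sum_congr rfl fun j _ =>
    Finset.sum_congr rfl fun k _ => by ring

lemma fderiv_form (w u : Coord n) : fderiv ℝ S.form x w u
    = ∑ i, ∑ k, pd k (fun z => S.b z i) x * (w k * u i) := by
  rw [(hS.hasFDerivAt_form hx).fderiv]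
  simp [sum_mul_pd, Finset.sum_mul]
  exact Finset.sum_congr rfl fun i _ =>
    Finset.sum_congr rfl fun k _ => by ring

/-- The inverse metric is absorbed into bˡ, which leaves only first derivatives of a_ij, as in
`symmDeriv`. -/
lemma sum_christoffel_mul_b (i j : Fin n) : ∑ k, S.christoffel k i j x * S.b x k
    = (1 / 2) * ∑ l, S.bUp x l * (pd i (fun z => S.a z j l) x + pd j (fun z => S.a z i l) x
      - pd l (fun z => S.a z i j) x) := by
  have hsymm : ∀ k l, S.aInv x k l = S.aInv x l k := fun k l => by
    have : (S.a x)ᵀ = S.a x := by ext p q; exact (hS.a_symm hx p q).symm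
    have h2 : (S.aInv x)ᵀ = S.aInv x := by rw [aInv, transpose_nonsing_inv, this]
    exact congrFun (congrFun h2 l) k
  simp only [christoffel, bUp, Finset.mul_sum, Finset.sum_mul]
  rw [Finset.sum_comm]
  refine Finset.sum_congr rfl fun l _ => Finset.sum_congr rfl fun k _ => ?_
  rw [hsymm k l]
  ring

/-- After contraction with yⁱyʲ, two of the three derivative terms in the Christoffel symbols
coincide. -/
lemma r00_eq_symmDeriv (y : Coord n) :
    S.r00 x y = symmDeriv S.bilin S.form x (WithLp.toLp 2 (S.bUp x)) y := by
  have h1 : S.r00 x y = ∑ i, ∑ j, S.covCovector S.b i j x * (y i * y j) := by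
    have e : ∑ i, ∑ j, S.covCovector S.b j i x * (y i * y j)
        = ∑ i, ∑ j, S.covCovector S.b i j x * (y i * y j) := by
      rw [Finset.sum_comm]
      exact Finset.sum_congr rfl fun i _ => Finset.sum_congr rfl fun j _ => by ring
    have e2 : S.r00 x y = (1 / 2) * (∑ i, ∑ j, S.covCovector S.b i j x * (y i * y j))
        + (1 / 2) * ∑ i, ∑ j, S.covCovector S.b j i x * (y i * y j) := by
      simp only [r00, r, Finset.mul_sum, ← Finset.sum_add_distrib]
      exact Finset.sum_congr rfl fun i _ => Finset.sum_congr rfl fun j _ => by ring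
    rw [e2, e]
    ring
  rw [h1, symmDeriv, hS.fderiv_form hx, hS.fderiv_bilin hx, hS.fderiv_bilin hx]
  simp only [covCovector, hS.sum_christoffel_mul_b hx, sub_mul, Finset.sum_sub_distrib]
  have e3 : ∑ i, ∑ j, (1 / 2) * (∑ l, S.bUp x l * (pd i (fun z => S.a z j l) x
      + pd j (fun z => S.a z i l) x - pd l (fun z => S.a z i j) x)) * (y i * y j)
      = (1 / 2) * (∑ i, ∑ j, ∑ l, pd i (fun z => S.a z j l) x * (y i * y j * S.bUp x l))
      + (1 / 2) * (∑ i, ∑ j, ∑ l, pd j (fun z => S.a z i l) x * (y j * y i * S.bUp x l))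
      - (1 / 2) * ∑ i, ∑ j, ∑ l, pd l (fun z => S.a z i j) x * (S.bUp x l * y i * y j) := by
    simp only [Finset.mul_sum, Finset.sum_mul, ← Finset.sum_add_distrib, ← Finset.sum_sub_distrib]
    exact Finset.sum_congr rfl fun i _ => Finset.sum_congr rfl fun j _ =>
      Finset.sum_congr rfl fun l _ => by ring
  have e4 : ∑ i, ∑ j, ∑ l, pd i (fun z => S.a z j l) x * (y i * y j * S.bUp x l)
      = ∑ i, ∑ j, ∑ l, pd j (fun z => S.a z i l) x * (y j * y i * S.bUp x l) := by
    rw [Finset.sum_comm]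
  have e5 : ∑ i, ∑ j, ∑ l, pd j (fun z => S.a z i l) x * (y j * y i * S.bUp x l)
      = ∑ i, ∑ j, ∑ k, pd k (fun z => S.a z i j) x * (y k * y i * S.bUp x j) :=
    Finset.sum_congr rfl fun i _ => Finset.sum_comm
  rw [e3, e4, e5]
  have e6 : ∑ i, ∑ j, pd j (fun z => S.b z i) x * (y i * y j)
      = ∑ i, ∑ k, pd k (fun z => S.b z i) x * (y k * y i) :=
    Finset.sum_congr rfl fun i _ => Finset.sum_congr rfl fun j _ => by ring
  rw [e6]
  ring

/-- A linear form represents `b` through the metric only at `bUp`. -/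
lemma eq_bUp {X : Coord n} (h : ∀ u, S.bilin x X u = S.form x u) :
    X = WithLp.toLp 2 (S.bUp x) := by
  by_contra hne
  have h1 := hS.alphaSq_pos hx (sub_ne_zero.2 hne)
  rw [← bilin_self, hS.bilin_symm hx, map_sub, hS.bilin_symm hx, h, hS.bilin_symm hx _ (WithLp.toLp 2 _),
    hS.bilin_bUp hx, sub_self] at h1
  exact lt_irrefl _ h1

end Regular

/-- The symmetrized covariant derivative of the one-form is invariant under a change of
coordinates. -/
lemma Regular.r00_pullback {S' : LocalPair n} {U' : Set (Coord n)} {ψ : Coord n → Coord n}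
    {S : LocalPair n} (hS : S.Regular U) (hS' : S'.Regular U') (hx : x ∈ U) (hx' : ψ x ∈ U')
    (hψ : ContDiffAt ℝ ∞ ψ x)
    (hA : ∀ᶠ z in 𝓝 x, ∀ u v, S.bilin z u v = S'.bilin (ψ z) (fderiv ℝ ψ z u) (fderiv ℝ ψ z v))
    (hB : ∀ᶠ z in 𝓝 x, ∀ u, S.form z u = S'.form (ψ z) (fderiv ℝ ψ z u)) (y : Coord n) :
    S.r00 x y = S'.r00 (ψ x) (fderiv ℝ ψ x y) := by
  -- No inverse of ψ is assumed. A vector killed by its derivative would have length zero in the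
  -- source metric; equality of dimensions then gives surjectivity, so the image of b^♯ can be
  -- tested against every vector.
  have hinj : Function.Injective (fderiv ℝ ψ x) := by
    refine (injective_iff_map_eq_zero _).2 fun u hu => ?_
    by_contra hne
    have h1 := hS.alphaSq_pos hx hne
    rw [← bilin_self, hA.self_of_nhds, hu] at h1
    simp at h1
  have hsurj : Function.Surjective (fderiv ℝ ψ x) :=
    LinearMap.surjective_of_injective (f := (fderiv ℝ ψ x).toLinearMap) hinj
  have hX : ∀ u, S'.bilin (ψ x) (fderiv ℝ ψ x (WithLp.toLp 2 (S.bUp x))) u = S'.form (ψ x) u := by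
    intro u
    obtain ⟨v, rfl⟩ := hsurj u
    rw [← hA.self_of_nhds, ← hB.self_of_nhds, hS.bilin_bUp hx]
  have hd : ContDiffAt ℝ ∞ (fderiv ℝ ψ) x := hψ.fderiv_right (by simp)
  rw [hS.r00_eq_symmDeriv hx, hS'.r00_eq_symmDeriv hx', ← hS'.eq_bUp hx' hX]
  exact symmDeriv_pullback (hψ.differentiableAt (by simp)).hasFDerivAt
    (hd.differentiableAt (by simp)).hasFDerivAt
    (fun u v => (hψ.isSymmSndFDerivAt (by
      simpa only [minSmoothness_of_isRCLikeNormedField] using ENat.LEInfty.out)).eq u v)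
    (hS'.hasFDerivAt_bilin hx').differentiableAt (hS'.hasFDerivAt_form hx').differentiableAt
    hA hB (hS.hasFDerivAt_bilin hx).differentiableAt (hS.hasFDerivAt_form hx).differentiableAt
    (hS'.bilin_symm hx') hX

end LocalPair

end Kropina

end

/-! ### Regularity of the components of a Kropina structure in a chart. -/

noncomputable section

namespace Kropina

open Matrix Topology Filter Bundle

variable {n : ℕ} {M : Type*} [TopologicalSpace M] [ChartedSpace (Coord n) M]

lemma eq_sum_single_of_linear (L : Coord n →ₗ[ℝ] ℝ) (y : Coord n) :
    L y = ∑ k, y k * L (EuclideanSpace.single k 1) := by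
  have h : y = ∑ k, y k • EuclideanSpace.single k (1 : ℝ) := by
    ext i
    simp [Pi.single_apply]
  conv_lhs => rw [h]
  simp

lemma eq_sum_single_of_bilinear (B : Coord n →ₗ[ℝ] Coord n →ₗ[ℝ] ℝ) (u v : Coord n) :
    B u v = ∑ i, ∑ j, u i * v j * B (EuclideanSpace.single i 1) (EuclideanSpace.single j 1) := by
  rw [eq_sum_single_of_linear (B u) v, Finset.sum_comm]
  refine Finset.sum_congr rfl fun j _ => ?_
  have h := eq_sum_single_of_linear (B.flip (EuclideanSpace.single j 1)) u
  simp only [LinearMap.flip_apply] at h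
  rw [h, Finset.mul_sum]
  exact Finset.sum_congr rfl fun i _ => by ring

/-- `vec` as a linear map. -/
def vecL (p : M) (z : Coord n) :
    Coord n →L[ℝ] TangentSpace (𝓡 n) ((extChartAt (𝓡 n) p).symm z) :=
  mfderiv 𝓘(ℝ, Coord n) (𝓡 n) (extChartAt (𝓡 n) p).symm z

section Chart

variable [IsManifold (𝓡 n) ∞ M]

lemma mdifferentiableAt_extChartAt_symm {p : M} {z : Coord n}
    (hz : z ∈ (extChartAt (𝓡 n) p).target) :
    MDifferentiableAt 𝓘(ℝ, Coord n) (𝓡 n) (extChartAt (𝓡 n) p).symm z := by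
  have : IsManifold (𝓡 n) 1 M := IsManifold.of_le (n := ∞) (by simp)
  have h := mdifferentiableWithinAt_extChartAt_symm (I := 𝓡 n) hz
  rwa [(𝓡 n).range_eq_univ, mdifferentiableWithinAt_univ] at h

lemma vec_bijective {p : M} {z : Coord n} (hz : z ∈ (extChartAt (𝓡 n) p).target) :
    Function.Bijective (vec p z) := by
  have : IsManifold (𝓡 n) 1 M := IsManifold.of_le (n := ∞) (by simp)
  have h := isInvertible_mfderivWithin_extChartAt_symm (I := 𝓡 n) hz
  rw [(𝓡 n).range_eq_univ, mfderivWithin_univ] at h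
  exact h.bijective

/-- The section is the tangent map of the inverse chart applied to a constant vector field. -/
lemma contMDiffOn_vec (p : M) (e : Coord n) :
    ContMDiffOn 𝓘(ℝ, Coord n) ((𝓡 n).prod 𝓘(ℝ, Coord n)) ∞
      (fun z => TotalSpace.mk' (Coord n) (E := fun q : M => TangentSpace (𝓡 n) q)
        ((extChartAt (𝓡 n) p).symm z) (vec p z e)) (extChartAt (𝓡 n) p).target := by
  have hU : IsOpen (extChartAt (𝓡 n) p).target := isOpen_extChartAt_target p
  have h1 := (contMDiffOn_extChartAt_symm (I := 𝓡 n) (n := ∞) p).contMDiffOn_tangentMapWithin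
    (m := ∞) (by simp) hU.uniqueMDiffOn
  have h2 : ContMDiff 𝓘(ℝ, Coord n) 𝓘(ℝ, Coord n).tangent ∞
      (fun z : Coord n => (⟨z, e⟩ : TangentBundle 𝓘(ℝ, Coord n) (Coord n))) := by
    intro z
    exact contMDiffAt_vectorSpace_iff_contDiffAt.2 contDiffAt_const
  refine (h1.comp h2.contMDiffOn fun z hz => hz).congr fun z hz => ?_
  simp only [Function.comp, tangentMapWithin, vec]
  rw [mfderivWithin_of_isOpen hU hz]

end Chart

namespace KropinaData

variable [IsManifold (𝓡 n) ∞ M] (K : KropinaData n M)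

lemma contDiffOn_metric (p : M) (u v : Coord n) : ContDiffOn ℝ ∞
    (fun z => K.metric.inner ((extChartAt (𝓡 n) p).symm z) (vec p z u) (vec p z v))
    (extChartAt (𝓡 n) p).target := by
  rw [← contMDiffOn_iff_contDiffOn]
  have h := ContMDiffOn.clm_bundle_apply₂ (F₁ := Coord n) (F₂ := Coord n) (F₃ := ℝ)
    (E₃ := Bundle.Trivial M ℝ)
    ((K.metric.contMDiff).comp_contMDiffOn (contMDiffOn_extChartAt_symm (I := 𝓡 n) (n := ∞) p))
    (contMDiffOn_vec p u) (contMDiffOn_vec p v)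
  intro z hz
  have h' := h z hz
  simp only [contMDiffWithinAt_totalSpace] at h'
  exact h'.2

lemma contDiffOn_form (p : M) (u : Coord n) : ContDiffOn ℝ ∞
    (fun z => K.β ((extChartAt (𝓡 n) p).symm z) (vec p z u)) (extChartAt (𝓡 n) p).target := by
  rw [← contMDiffOn_iff_contDiffOn]
  have h := ContMDiffOn.clm_bundle_apply (F₁ := Coord n) (F₂ := ℝ)
    (E₂ := Bundle.Trivial M ℝ)
    (K.smooth_β.comp_contMDiffOn (contMDiffOn_extChartAt_symm (I := 𝓡 n) (n := ∞) p))
    (contMDiffOn_vec p u)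
  intro z hz
  have h' := h z hz
  simp only [contMDiffWithinAt_totalSpace] at h'
  exact h'.2

lemma beta_loc (p : M) (z y : Coord n) :
    (K.loc p).beta z y = K.β ((extChartAt (𝓡 n) p).symm z) (vec p z y) := by
  refine Eq.trans ?_ (eq_sum_single_of_linear ((K.β _).comp (vecL p z)).toLinearMap y).symm
  exact Finset.sum_congr rfl fun i _ => mul_comm _ _

lemma bilin_loc (p : M) (z u v : Coord n) : (K.loc p).bilin z u v
    = K.metric.inner ((extChartAt (𝓡 n) p).symm z) (vec p z u) (vec p z v) := by
  refine Eq.trans ?_ (eq_sum_single_of_bilinear (LinearMap.mk₂ ℝ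
    (fun u v => K.metric.inner ((extChartAt (𝓡 n) p).symm z) (vecL p z u) (vecL p z v))
    (fun u u' v => by rw [map_add, map_add]; rfl) (fun c u v => by rw [map_smul, map_smul]; rfl)
    (fun u v v' => by rw [map_add, map_add])
    (fun c u v => by rw [map_smul, map_smul])) u v).symm
  rw [LocalPair.bilin_apply]
  exact Finset.sum_congr rfl fun i _ => Finset.sum_congr rfl fun j _ => mul_comm _ _

lemma alphaSq_loc (p : M) (z y : Coord n) : (K.loc p).alphaSq z y
    = K.metric.inner ((extChartAt (𝓡 n) p).symm z) (vec p z y) (vec p z y) := by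
  rw [← LocalPair.bilin_self, bilin_loc]

/-- Positivity of the metric and non-vanishing of β carry over because `vec p z` is bijective at
each point of the chart target. -/
lemma regular_loc (p : M) : (K.loc p).Regular (extChartAt (𝓡 n) p).target where
  isOpen := isOpen_extChartAt_target p
  a_smooth i j := K.contDiffOn_metric p _ _
  b_smooth i := K.contDiffOn_form p _
  posDef z hz := by
    refine Matrix.PosDef.of_dotProduct_mulVec_pos ?_ fun y hy => ?_
    · ext i j
      exact K.metric.symm _ _ _
    · have h : 0 < (K.loc p).alphaSq z (WithLp.toLp 2 y) := by
        rw [alphaSq_loc]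
        refine K.metric.pos _ _ fun h0 => hy ?_
        have h1 : vec p z 0 = 0 := (vecL p z).map_zero
        have h2 := (vec_bijective hz).1 (h0.trans h1.symm)
        simpa using congrArg WithLp.ofLp h2
      simpa [LocalPair.Regular.alphaSq_eq_dot] using h
  b_ne z hz h0 := by
    refine K.β_ne_zero ((extChartAt (𝓡 n) p).symm z) ?_
    ext v
    obtain ⟨y, rfl⟩ := (vec_bijective hz).2 v
    refine (K.beta_loc p z y).symm.trans ?_
    simp only [LocalPair.beta, h0, Pi.zero_apply, zero_mul, Finset.sum_const_zero]
    rfl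

end KropinaData
end Kropina

end

/-! ### Changes of charts, and smoothness of the conformal factor. -/

noncomputable section

namespace Kropina

open Matrix Topology Filter Bundle

namespace LocalPair.Regular

variable {n : ℕ} {S : LocalPair n} {U : Set (Coord n)} (hS : S.Regular U)

include hS in
-- The component is already an element of the smooth algebra over U × ℝⁿ; restrict it to the zero
-- section.
lemma contDiffOn_r (i j : Fin n) : ContDiffOn ℝ ∞ (fun z => S.r z i j) U := by
  have hΩ : IsOpen (U ×ˢ (Set.univ : Set (Coord n))) := hS.isOpen.prod isOpen_univ
  have hU : ∀ w ∈ U ×ˢ (Set.univ : Set (Coord n)), w.1 ∈ U := fun w hw => hw.1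
  have h1 : ContDiffOn ℝ ∞ (extendZero ((hS.pairRing hΩ hU).r i j).1) (U ×ˢ Set.univ) :=
    ((hS.pairRing hΩ hU).r i j).2
  have h2 : ContDiff ℝ ∞ (fun z : Coord n => (z, (0 : Coord n))) :=
    contDiff_id.prodMk contDiff_const
  refine (h1.comp h2.contDiffOn fun z hz => ⟨hz, Set.mem_univ _⟩).congr fun z hz => ?_
  exact ((extendZero_apply _ (⟨(z, 0), hz, Set.mem_univ _⟩ : (U ×ˢ Set.univ : Set _))).trans
    (hS.eval_r hΩ hU _ i j)).symm

include hS in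
/-- The factor of a conformal one-form is smooth. -/
lemma contDiffOn_factor (hn : 0 < n) {c : Coord n → ℝ}
    (hr : ∀ z ∈ U, ∀ i j, S.r z i j = c z * S.a z i j) : ContDiffOn ℝ ∞ c U := by
  have hpos : ∀ z ∈ U, 0 < S.a z ⟨0, hn⟩ ⟨0, hn⟩ := fun z hz => (hS.posDef z hz).diag_pos
  -- The factor is the quotient of the first diagonal entries of r and a, and the latter is
  -- positive.
  refine ((hS.contDiffOn_r ⟨0, hn⟩ ⟨0, hn⟩).div (hS.a_smooth ⟨0, hn⟩ ⟨0, hn⟩)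
    fun z hz => (hpos z hz).ne').congr fun z hz => ?_
  change c z = S.r z ⟨0, hn⟩ ⟨0, hn⟩ / S.a z ⟨0, hn⟩ ⟨0, hn⟩
  rw [hr z hz, mul_div_cancel_right₀ _ (hpos z hz).ne']

include hS in
lemma r_eq_iff {x : Coord n} (hx : x ∈ U) {c : ℝ} :
    (∀ i j, S.r x i j = c * S.a x i j) ↔ ∀ y, S.r00 x y = c * S.alphaSq x y := by
  have hdot : ∀ v : Fin n → ℝ, c * (v ⬝ᵥ S.a x *ᵥ v) = v ⬝ᵥ (c • S.a x) *ᵥ v := fun v => by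
    rw [smul_mulVec, dotProduct_smul, smul_eq_mul]
  constructor
  · intro h y
    rw [r00_eq_dot, alphaSq_eq_dot, hdot]
    congr 2
    ext i j
    exact h i j
  · intro h
    refine eq_of_quadratic_eq (M := Matrix.of (S.r x)) (N := c • S.a x) (fun i j => S.r_symm x i j)
      (fun i j => ?_) fun v => ?_
    · simp only [Matrix.smul_apply, hS.a_symm hx i j]
    · have := h (WithLp.toLp 2 v)
      rw [r00_eq_dot, alphaSq_eq_dot, hdot] at this
      exact this

end LocalPair.Regular

variable {n : ℕ} {M : Type*} [TopologicalSpace M] [ChartedSpace (Coord n) M]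

lemma symm_pt (p : M) : (extChartAt (𝓡 n) p).symm (pt p) = p := extChartAt_to_inv p

lemma pt_mem_target (p : M) : pt p ∈ (extChartAt (𝓡 n) p).target := mem_extChartAt_target p

lemma inChart_pt (c : M → ℝ) (p : M) : inChart c p (pt (n := n) p) = c p := by
  rw [inChart, symm_pt]

section Chart

variable [IsManifold (𝓡 n) ∞ M]

/-- The tangent space at p is the model space, identified by means of the chart at p, whose
derivative at p is therefore the identity. -/
lemma coord_eq (p : M) (v : Coord n) : coord p v = v := by
  have : IsManifold (𝓡 n) 1 M := IsManifold.of_le (n := ∞) (by simp)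
  exact congrArg (fun L : Coord n →L[ℝ] Coord n => L v) (mfderiv_extChartAt_self (I := 𝓡 n))

lemma vec_pt (p : M) (y : Coord n) : (vec p (pt p) y : Coord n) = y := by
  have : IsManifold (𝓡 n) 1 M := IsManifold.of_le (n := ∞) (by simp)
  have h := mfderivWithin_range_extChartAt_symm (I := 𝓡 n) (x := p)
  rw [(𝓡 n).range_eq_univ, mfderivWithin_univ] at h
  exact congrArg (fun L : Coord n →L[ℝ] Coord n => L y) h

/-- The change of coordinates from the chart at `p` to the chart at `q`. -/
def coordChange (p q : M) (z : Coord n) : Coord n :=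
  extChartAt (𝓡 n) q ((extChartAt (𝓡 n) p).symm z)

variable {p q : M} {z : Coord n} (hz : z ∈ (extChartAt (𝓡 n) p).target)
  (hq : (extChartAt (𝓡 n) p).symm z ∈ (extChartAt (𝓡 n) q).source)

include hz hq

lemma contDiffAt_coordChange : ContDiffAt ℝ ∞ (coordChange p q) z := by
  rw [← contMDiffAt_iff_contDiffAt]
  have h1 : ContMDiffAt 𝓘(ℝ, Coord n) (𝓡 n) ∞ (extChartAt (𝓡 n) p).symm z :=
    (contMDiffOn_extChartAt_symm p).contMDiffAt ((isOpen_extChartAt_target p).mem_nhds hz)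
  have h2 : ContMDiffAt (𝓡 n) 𝓘(ℝ, Coord n) ∞ (extChartAt (𝓡 n) q)
      ((extChartAt (𝓡 n) p).symm z) :=
    contMDiffAt_extChartAt' (by rwa [extChartAt_source] at hq)
  exact h2.comp z h1

lemma eventually_mem_chart : ∀ᶠ w in 𝓝 z, w ∈ (extChartAt (𝓡 n) p).target ∧
    (extChartAt (𝓡 n) p).symm w ∈ (extChartAt (𝓡 n) q).source := by
  have h1 : ContMDiffAt 𝓘(ℝ, Coord n) (𝓡 n) ∞ (extChartAt (𝓡 n) p).symm z :=
    (contMDiffOn_extChartAt_symm p).contMDiffAt ((isOpen_extChartAt_target p).mem_nhds hz)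
  exact ((isOpen_extChartAt_target p).eventually_mem hz).and
    (h1.continuousAt.preimage_mem_nhds ((isOpen_extChartAt_source q).mem_nhds hq))

/-- The chain rule, since near z the inverse chart at p is the inverse chart at q after the change
of coordinates. The equality is stated in the model space because the two base points are only
propositionally equal. -/
lemma vec_coordChange (u : Coord n) :
    (vec p z u : Coord n) = vec q (coordChange p q z) (fderiv ℝ (coordChange p q) z u) := by
  have hev : (extChartAt (𝓡 n) p).symm =ᶠ[𝓝 z] (extChartAt (𝓡 n) q).symm ∘ coordChange p q := by
    filter_upwards [eventually_mem_chart hz hq] with w hw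
    exact ((extChartAt (𝓡 n) q).left_inv hw.2).symm
  have hd : MDifferentiableAt 𝓘(ℝ, Coord n) 𝓘(ℝ, Coord n) (coordChange p q) z :=
    ((contDiffAt_coordChange hz hq).differentiableAt (by simp)).mdifferentiableAt
  have h1 := hev.mfderiv_eq (I := 𝓘(ℝ, Coord n)) (I' := 𝓡 n)
  have h2 := mfderiv_comp z (mdifferentiableAt_extChartAt_symm
    ((extChartAt (𝓡 n) q).map_source hq)) hd
  have h3 : mfderiv 𝓘(ℝ, Coord n) 𝓘(ℝ, Coord n) (coordChange p q) z
      = fderiv ℝ (coordChange p q) z := mfderiv_eq_fderiv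
  have h4 := congrArg (fun L : Coord n →L[ℝ] Coord n => L u) (h1.trans h2)
  refine h4.trans ?_
  exact congrArg (fun L : Coord n →L[ℝ] Coord n => vec q (coordChange p q z) (L u)) h3

end Chart

namespace KropinaData

variable [IsManifold (𝓡 n) ∞ M] (K : KropinaData n M)

/-- The metric at `q`, with the tangent space identified with the coordinate space. -/
def gram (q : M) (u v : Coord n) : ℝ :=
  K.metric.inner q (show TangentSpace (𝓡 n) q from u) (show TangentSpace (𝓡 n) q from v)

/-- The one-form at `q`, with the tangent space identified with the coordinate space. -/
def oneForm (q : M) (u : Coord n) : ℝ := K.β q (show TangentSpace (𝓡 n) q from u)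

lemma bilin_loc_eq_gram (p : M) (z u v : Coord n) : (K.loc p).bilin z u v
    = K.gram ((extChartAt (𝓡 n) p).symm z) (vec p z u) (vec p z v) := K.bilin_loc p z u v

lemma form_loc_eq_oneForm (p : M) (z u : Coord n) : (K.loc p).form z u
    = K.oneForm ((extChartAt (𝓡 n) p).symm z) (vec p z u) :=
  ((K.loc p).form_apply z u).trans (K.beta_loc p z u)

lemma alphaSq_loc_pt (p : M) (v : TangentSpace (𝓡 n) p) :
    (K.loc p).alphaSq (pt p) (coord p v) = K.metric.inner p v v := by
  have h1 : coord p v = v := coord_eq p v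
  rw [← LocalPair.bilin_self, bilin_loc_eq_gram, symm_pt, vec_pt, h1]
  rfl

lemma beta_loc_pt (p : M) (v : TangentSpace (𝓡 n) p) :
    (K.loc p).beta (pt p) (coord p v) = K.β p v := by
  have h1 : coord p v = v := coord_eq p v
  rw [← LocalPair.form_apply, form_loc_eq_oneForm, symm_pt, vec_pt, h1]
  rfl

lemma inner_self_nonneg (p : M) (v : TangentSpace (𝓡 n) p) : 0 ≤ K.metric.inner p v v := by
  by_cases h : v = 0
  · rw [h, map_zero]
  · exact (K.metric.pos p v h).le

lemma α_sq (p : M) (v : TangentSpace (𝓡 n) p) : K.α p v ^ 2 = K.metric.inner p v v :=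
  Real.sq_sqrt (K.inner_self_nonneg p v)

lemma tangentInChart_α (p : M) :
    tangentInChart K.α p = fun z y => √((K.loc p).alphaSq z y) := by
  funext z y
  rw [alphaSq_loc]
  rfl

lemma tangentInChart_F (p : M) : tangentInChart K.F p = (K.loc p).kropina := by
  funext z y
  rw [LocalPair.kropina, alphaSq_loc, beta_loc, tangentInChart, F, α_sq]

variable {p q : M} {z : Coord n} (hz : z ∈ (extChartAt (𝓡 n) p).target)
  (hq : (extChartAt (𝓡 n) p).symm z ∈ (extChartAt (𝓡 n) q).source)

include hz hq

lemma bilin_coordChange (u v : Coord n) : (K.loc p).bilin z u v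
    = (K.loc q).bilin (coordChange p q z) (fderiv ℝ (coordChange p q) z u)
      (fderiv ℝ (coordChange p q) z v) := by
  rw [bilin_loc_eq_gram, bilin_loc_eq_gram, vec_coordChange hz hq u, vec_coordChange hz hq v]
  congr 1
  exact ((extChartAt (𝓡 n) q).left_inv hq).symm

lemma form_coordChange (u : Coord n) : (K.loc p).form z u
    = (K.loc q).form (coordChange p q z) (fderiv ℝ (coordChange p q) z u) := by
  rw [form_loc_eq_oneForm, form_loc_eq_oneForm, vec_coordChange hz hq u]
  congr 1
  exact ((extChartAt (𝓡 n) q).left_inv hq).symm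

lemma r00_coordChange (y : Coord n) : (K.loc p).r00 z y
    = (K.loc q).r00 (coordChange p q z) (fderiv ℝ (coordChange p q) z y) :=
  (K.regular_loc p).r00_pullback (K.regular_loc q) hz ((extChartAt (𝓡 n) q).map_source hq)
    (contDiffAt_coordChange hz hq)
    (by filter_upwards [eventually_mem_chart hz hq] with w hw using K.bilin_coordChange hw.1 hw.2)
    (by filter_upwards [eventually_mem_chart hz hq] with w hw using K.form_coordChange hw.1 hw.2) y

omit hz hq

/-- A conformal one-form is conformal in every chart. -/
lemma conformal_loc {c : M → ℝ}
    (h : ∀ q y, (K.loc q).r00 (pt q) y = c q * (K.loc q).alphaSq (pt q) y) (p : M) :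
    ∀ z ∈ (extChartAt (𝓡 n) p).target, ∀ i j,
      (K.loc p).r z i j = inChart c p z * (K.loc p).a z i j := by
  intro z hz
  -- The point with coordinates z is moved into its own preferred chart, where the hypothesis
  -- applies.
  have hq : (extChartAt (𝓡 n) p).symm z ∈
      (extChartAt (𝓡 n) ((extChartAt (𝓡 n) p).symm z)).source := mem_extChartAt_source _
  refine ((K.regular_loc p).r_eq_iff hz).2 fun y => ?_
  rw [K.r00_coordChange hz hq, ← LocalPair.bilin_self, K.bilin_coordChange hz hq,
    LocalPair.bilin_self]
  exact h _ _

end KropinaData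

section Smooth

variable {c : M → ℝ}

lemma contDiffOn_inChart [IsManifold (𝓡 n) ∞ M] (hc : ContMDiff (𝓡 n) 𝓘(ℝ, ℝ) ∞ c) (p : M) :
    ContDiffOn ℝ ∞ (inChart c p) (extChartAt (𝓡 n) p).target := by
  rw [← contMDiffOn_iff_contDiffOn]
  exact hc.comp_contMDiffOn (contMDiffOn_extChartAt_symm p)

lemma contMDiff_of_inChart
    (h : ∀ p, ContDiffOn ℝ ∞ (inChart c p) (extChartAt (𝓡 n) p).target) :
    ContMDiff (𝓡 n) 𝓘(ℝ, ℝ) ∞ c := by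
  intro p
  have h1 : ContMDiffAt 𝓘(ℝ, Coord n) 𝓘(ℝ, ℝ) ∞ (inChart c p) (extChartAt (𝓡 n) p p) :=
    ((h p).contDiffAt ((isOpen_extChartAt_target p).mem_nhds (pt_mem_target p))).contMDiffAt
  have h2 : ContMDiffAt (𝓡 n) 𝓘(ℝ, Coord n) ∞ (extChartAt (𝓡 n) p) p := contMDiffAt_extChartAt
  refine (h1.comp p h2).congr_of_eventuallyEq ?_
  filter_upwards [(isOpen_extChartAt_source p).mem_nhds (mem_extChartAt_source (I := 𝓡 n) p)]
    with q hq
  simp only [Function.comp, inChart, (extChartAt (𝓡 n) p).left_inv hq]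

end Smooth

end Kropina

end

/-! ### The Einstein condition on the manifold. -/

noncomputable section

namespace Kropina

namespace KropinaData

variable {n : ℕ} {M : Type*} [TopologicalSpace M] [ChartedSpace (Coord n) M]
  [IsManifold (𝓡 n) ∞ M] (K : KropinaData n M)

lemma bSq_pos (p : M) : 0 < K.bSq p := (K.regular_loc p).bSq_pos (pt_mem_target p)

lemma Ric_α (p : M) (v : TangentSpace (𝓡 n) p) :
    Ric K.α p v = (K.loc p).ricQuad (pt p) (coord p v) := by
  rw [Ric, tangentInChart_α, (K.regular_loc p).ricci_alpha (pt_mem_target p)]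

lemma Ric_F (p : M) (v : TangentSpace (𝓡 n) p) :
    Ric K.F p v = ricci (K.loc p).kropina (pt p) (coord p v) := by
  rw [Ric, tangentInChart_F]

lemma F_eq (p : M) (v : TangentSpace (𝓡 n) p) :
    K.F p v = (K.loc p).kropina (pt p) (coord p v) := by
  rw [LocalPair.kropina, alphaSq_loc_pt, beta_loc_pt, F, α_sq]

lemma coord_surjective (p : M) (y : Coord n) : ∃ v : TangentSpace (𝓡 n) p, coord p v = y :=
  ⟨y, coord_eq p y⟩

lemma r00_loc_pt {c : M → ℝ} (h : ∀ (p : M) v, K.r00 p v = c p * K.α p v ^ 2) (p : M)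
    (y : Coord n) : (K.loc p).r00 (pt p) y = c p * (K.loc p).alphaSq (pt p) y := by
  obtain ⟨v, rfl⟩ := coord_surjective p y
  rw [alphaSq_loc_pt, ← α_sq]
  exact h p v

lemma einsteinWith_loc {σ : M → ℝ} (h : IsEinsteinWith K.F K.domain σ) (p : M) (y : Coord n)
    (hy : 0 < (K.loc p).beta (pt p) y) :
    ricci (K.loc p).kropina (pt p) y = σ p * (K.loc p).kropina (pt p) y ^ 2 := by
  obtain ⟨v, rfl⟩ := coord_surjective p y
  rw [← Ric_F, ← F_eq]
  rw [beta_loc_pt] at hy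
  exact h p v hy

/-- The algebraic argument yields a factor at each point separately. Invariance of r₀₀ makes these
numbers the conformal factor on each chart domain, where it is smooth as a quotient of components.
-/
lemma exists_conformal_factor (hn : 2 ≤ n) {σ : M → ℝ} (h : IsEinsteinWith K.F K.domain σ) :
    ∃ c : M → ℝ, ContMDiff (𝓡 n) 𝓘(ℝ, ℝ) ∞ c ∧
      ∀ p, ∀ z ∈ (extChartAt (𝓡 n) p).target, ∀ i j,
        (K.loc p).r z i j = inChart c p z * (K.loc p).a z i j := by
  choose c hc using fun p => (K.regular_loc p).exists_conformal hn (pt_mem_target p)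
    (K.einsteinWith_loc h p)
  have h1 := K.conformal_loc fun q =>
    ((K.regular_loc q).r_eq_iff (pt_mem_target q)).1 (hc q)
  exact ⟨c, contMDiff_of_inChart fun p => (K.regular_loc p).contDiffOn_factor (by omega) (h1 p), h1⟩

/-- The Einstein scalar of an Einstein Kropina metric. -/
lemma einstein_scalar (hn : 2 ≤ n) {σ : M → ℝ} (h : IsEinsteinWith K.F K.domain σ) (p : M) :
    σ p = -(1 / (2 * K.bSq p)) * K.sSq p - (1 / 4) * K.trS p := by
  obtain ⟨c, hc, hr⟩ := K.exists_conformal_factor hn h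
  exact ((K.regular_loc p).einstein_consequences (contDiffOn_inChart hc p) (hr p)
    (pt_mem_target p) hn (K.einsteinWith_loc h p)).1

/-- The equations equivalent to the Einstein condition, for `c` and `f`, at the vector `v`. -/
def Equations (c f : M → ℝ) (p : M) (v : TangentSpace (𝓡 n) p) : Prop :=
  K.r00 p v = c p * K.α p v ^ 2 ∧
  Ric K.α p v * K.bSq p ^ 2 + ((n : ℝ) - 2) * (K.bSq p * K.s0_0 p v
    + K.bSq p * K.c0 c p v * K.β p v - (K.s0 p v + c p * K.β p v) ^ 2) = f p * K.α p v ^ 2 ∧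
  (f p + (((n : ℝ) - 2) * K.bSq p * c p ^ 2 + K.bSq p * K.b_dc c p)) * K.β p v
    + (((n : ℝ) - 3) * K.bSq p * c p * K.s0 p v + K.bSq p * K.b_s0 p v
      - K.bSq p ^ 2 * K.divS0 p v + ((n : ℝ) - 1) * K.bSq p * K.s0s p v) = 0

lemma equations_iff {c f : M → ℝ} {p : M} {v : TangentSpace (𝓡 n) p} : K.Equations c f p v ↔
    (K.loc p).r00 (pt p) (coord p v) = c p * (K.loc p).alphaSq (pt p) (coord p v) ∧
    (K.loc p).bracket (inChart c p) (pt p) (coord p v)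
      = f p * (K.loc p).alphaSq (pt p) (coord p v) ∧
    (f p + (K.loc p).isotropic (inChart c p) (pt p)) * (K.loc p).beta (pt p) (coord p v)
      + (K.loc p).mixed (inChart c p) (pt p) (coord p v) = 0 := by
  rw [Equations, LocalPair.bracket, LocalPair.isotropic, LocalPair.mixed, inChart_pt,
    alphaSq_loc_pt, beta_loc_pt, α_sq, Ric_α]
  rfl

lemma conformal_of_equations {c f : M → ℝ} (h : ∀ p v, K.Equations c f p v) (p : M) :
    ∀ z ∈ (extChartAt (𝓡 n) p).target, ∀ i j,
      (K.loc p).r z i j = inChart c p z * (K.loc p).a z i j :=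
  K.conformal_loc (K.r00_loc_pt fun p v => (h p v).1) p

lemma equations_loc {c f : M → ℝ} (h : ∀ p v, K.Equations c f p v) (p : M) (y : Coord n) :
    (K.loc p).bracket (inChart c p) (pt p) y = f p * (K.loc p).alphaSq (pt p) y ∧
    (f p + (K.loc p).isotropic (inChart c p) (pt p)) * (K.loc p).beta (pt p) y
      + (K.loc p).mixed (inChart c p) (pt p) y = 0 := by
  obtain ⟨v, rfl⟩ := coord_surjective p y
  exact (K.equations_iff.1 (h p v)).2

/-- Only c is differentiated in the equations, so f and the Einstein scalar may be chosen pointwise.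
-/
lemma isEinstein_iff (hn : 2 ≤ n) : IsEinstein K.F K.domain ↔
    ∃ c f : M → ℝ, ContMDiff (𝓡 n) 𝓘(ℝ, ℝ) ∞ c ∧ ∀ p v, K.Equations c f p v := by
  constructor
  · rintro ⟨σ, h⟩
    obtain ⟨c, hc, hr⟩ := K.exists_conformal_factor hn h
    choose f hf using fun p => ((K.regular_loc p).einstein_consequences (contDiffOn_inChart hc p)
      (hr p) (pt_mem_target p) hn (K.einsteinWith_loc h p)).2
    refine ⟨c, f, hc, fun p v => K.equations_iff.2 ⟨?_, hf p _⟩⟩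
    rw [← inChart_pt (n := n) c p]
    exact ((K.regular_loc p).r_eq_iff (pt_mem_target p)).1 (hr p _ (pt_mem_target p)) _
  · rintro ⟨c, f, hc, h⟩
    refine ⟨fun p => (K.loc p).einsteinScalar (pt p), fun p v hv => ?_⟩
    rw [Ric_F, F_eq]
    refine (K.regular_loc p).einstein_of_equations (contDiffOn_inChart hc p)
      (K.conformal_of_equations h p) (pt_mem_target p) (K.equations_loc h p) ?_
    rw [beta_loc_pt]
    exact hv

lemma equations_scalar {c f : M → ℝ} (hc : ContMDiff (𝓡 n) 𝓘(ℝ, ℝ) ∞ c)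
    (h : ∀ p v, K.Equations c f p v) (p : M) :
    f p = -((n : ℝ) - 2) * K.bSq p * c p ^ 2 - K.bSq p * K.b_dc c p
      + ((n : ℝ) - 2) * K.sSq p - K.bSq p * K.divs p - K.bSq p * K.trS p := by
  have h1 := (K.regular_loc p).scalar_eq (contDiffOn_inChart hc p)
    (K.conformal_of_equations h p) (pt_mem_target p) fun y => (K.equations_loc h p y).2
  rw [inChart_pt] at h1
  exact h1

end KropinaData

end Kropina

end

theorem theorem3p1 {n : ℕ} {M : Type*} [TopologicalSpace M]
    [ChartedSpace (Kropina.Coord n) M] [IsManifold (𝓡 n) ∞ M]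
    (K : Kropina.KropinaData n M) :
    (n = 2 →
      (Kropina.IsEinstein K.F K.domain ↔
        ∃ c lam : M → ℝ, ContMDiff (𝓡 n) 𝓘(ℝ, ℝ) ∞ c ∧
          ∀ (p : M) (v : TangentSpace (𝓡 n) p),
            K.r00 p v = c p * K.α p v ^ 2 ∧
            Kropina.Ric K.α p v = lam p * K.α p v ^ 2 ∧
            0 = lam p * K.bSq p * K.β p v - c p * K.s0 p v + K.b_dc c p * K.β p v
              + K.b_s0 p v - K.bSq p * K.divS0 p v + K.s0s p v)) ∧
    (3 ≤ n →
      (Kropina.IsEinstein K.F K.domain ↔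
        ∃ c f : M → ℝ, ContMDiff (𝓡 n) 𝓘(ℝ, ℝ) ∞ c ∧
          ∀ (p : M),
            f p = -((n : ℝ) - 2) * K.bSq p * c p ^ 2 - K.bSq p * K.b_dc c p
              + ((n : ℝ) - 2) * K.sSq p - K.bSq p * K.divs p - K.bSq p * K.trS p ∧
            ∀ (v : TangentSpace (𝓡 n) p),
              K.r00 p v = c p * K.α p v ^ 2 ∧
              f p * K.α p v ^ 2 = Kropina.Ric K.α p v * K.bSq p ^ 2
                + ((n : ℝ) - 2) * (K.bSq p * K.s0_0 p v + K.bSq p * K.c0 c p v * K.β p v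
                  - 2 * c p * K.β p v * K.s0 p v - K.s0 p v ^ 2 - c p ^ 2 * K.β p v ^ 2) ∧
              0 = (((n : ℝ) - 2) * K.sSq p - K.bSq p * K.divs p - K.bSq p * K.trS p) * K.β p v
                + ((n : ℝ) - 3) * K.bSq p * c p * K.s0 p v + K.bSq p * K.b_s0 p v
                - K.bSq p ^ 2 * K.divS0 p v + ((n : ℝ) - 1) * K.bSq p * K.s0s p v)) ∧
    (2 ≤ n → ∀ σ : M → ℝ, Kropina.IsEinsteinWith K.F K.domain σ →
      ∀ p, σ p = -(1 / (2 * K.bSq p)) * K.sSq p - (1 / 4) * K.trS p) := by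
  refine ⟨fun hn => ?_, fun hn => ?_, fun hn σ h p => K.einstein_scalar hn h p⟩
  · rw [K.isEinstein_iff hn.ge]
    have hn' : (n : ℝ) = 2 := by exact_mod_cast hn
    constructor
    · rintro ⟨c, f, hc, h⟩
      -- For n = 2 the terms with the factor n - 2 drop out and the second equation becomes b⁴ times
      -- the condition on the Ricci curvature of α, hence λ = f/b⁴. The third is b² times the stated
      -- one.
      refine ⟨c, fun p => f p / K.bSq p ^ 2, hc, fun p v => ?_⟩
      obtain ⟨h1, h2, h3⟩ := h p v
      have hb := (K.bSq_pos p).ne'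
      rw [hn'] at h2 h3
      refine ⟨h1, ?_, ?_⟩
      · field_simp
        linear_combination h2
      · refine mul_left_cancel₀ hb ?_
        field_simp
        linear_combination -h3
    · rintro ⟨c, lam, hc, h⟩
      refine ⟨c, fun p => lam p * K.bSq p ^ 2, hc, fun p v => ?_⟩
      obtain ⟨h1, h2, h3⟩ := h p v
      refine ⟨h1, ?_, ?_⟩
      · rw [hn']
        linear_combination K.bSq p ^ 2 * h2
      · rw [hn']
        linear_combination -K.bSq p * h3
  · rw [K.isEinstein_iff (by omega)]
    constructor
    · rintro ⟨c, f, hc, h⟩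
      refine ⟨c, f, hc, fun p => ⟨K.equations_scalar hc h p, fun v => ?_⟩⟩
      obtain ⟨h1, h2, h3⟩ := h p v
      -- After inserting f, its terms in b²c² and bᵏc_k cancel against the isotropic part.
      rw [K.equations_scalar hc h p] at h3
      exact ⟨h1, by linear_combination -h2, by linear_combination -h3⟩
    · rintro ⟨c, f, hc, h⟩
      refine ⟨c, f, hc, fun p v => ?_⟩
      obtain ⟨hf, h'⟩ := h p
      obtain ⟨h1, h2, h3⟩ := h' v
      exact ⟨h1, by linear_combination -h2, by rw [hf]; linear_combination -h3⟩
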